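/- **Notation.** Let $c\in\mathbb C$; on the twistor fibre over $\lambda$ of Eguchi–Hanson twistor space $c$ is the value $c(\lambda)$, which is non-zero on generic fibres. A *label* is a pair $(m,n)\in\mathbb N_0^2$ with $m\equiv n \pmod 2$. For an index pair that is not a label, generators are understood to be $0$. Write $[a]_\ell=a(a-1)\cdots(a-\ell+1)$ and, for $p,q,r,s\in\mathbb N_0$, $$R_\ell(p,q,r,s)=\frac1{\ell!}\sum_{k=0}^{\ell}(-1)^k\binom{\ell}{k}[p]_{\ell-k}[q]_k[r]_k[s]_{\ell-k},\qquad \psi_{2\ell+1}(m,n)=\frac{(-1)^\ell\,[\ell+\frac12]_\ell}{4^{2\ell}[m-\frac12]_\ell[n-\frac12]_\ell[m+n-\frac12-\ell]_\ell},$$ $$\Psi_\ell(m,n;\sigma)={}_4F_3\!\left(-\tfrac12-2\sigma,\ \tfrac32+2\sigma,\ -\tfrac{\ell}{2},\ \tfrac{1-\ell}{2};\ \tfrac12-m,\ \tfrac12-n,\ m+n+\tfrac32-\ell;\ 1\right).$$ Consider the following brackets on the complex vector space with one basis vector per label: the wedge algebra $w_\wedge$, with $\{w[p,q],w[r,s]\}=(ps-qr)\,w[p+r-1,q+s-1]$;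 the algebra $W(\mu;\mathfrak q)$, $\mu=\sigma(\sigma+1)$, with $$[W[p,q],W[r,s]]=\sum_{\ell\ge0}\mathfrak q^{2\ell}R_{2\ell+1}(p,q,r,s)\,\Psi_{2\ell+1}\big(\tfrac{p+q}2,\tfrac{r+s}2;\sigma\big)\,W[p+r-2\ell-1,q+s-2\ell-1];$$ and the algebra $W(\infty;c)$, with $$\{W[p,q],W[r,s]\}=\sum_{\ell\ge0}(2c)^{2\ell}R_{2\ell+1}(p,q,r,s)\,\psi_{2\ell+1}\big(\tfrac{p+q}2,\tfrac{r+s}2\big)\,W[p+r-2\ell-1,q+s-2\ell-1].$$ Put $W(\infty)=W(\infty;1)$. Let $\mathcal O_c=\mathbb C[X,Y,Z]/(XY-Z^2+c^2)$ be the ring of functions on a fibre, with the twistor generators $V[2p,2q]=X^pY^q$, $V[2p+1,2q+1]=X^pY^qZ$ and the scattering generators (soft modes) $$W[2p,2q]=\frac{(2p)!(2q)!}{(2p+2q)!}\sum_{\ell=0}^{\min(p,q)}\binom{p+q}{p-\ell,\,q-\ell,\,2\ell}X^{p-\ell}Y^{q-\ell}(2Z)^{2\ell},$$ $$W[2p+1,2q+1]=\frac{(2p+1)!(2q+1)!}{(2p+2q+2)!}\sum_{\ell=0}^{\min(p,q)}\binom{p+q+1}{p-\ell,\,q-\ell,\,2\ell+1}X^{p-\ell}Y^{q-\ell}(2Z)^{2\ell+1}.$$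 **Theorem.** 1. For every $c$ the ring $\mathcal O_c$ carries a unique Poisson bracket with $\{X,Y\}=4Z$, $\{X,Z\}=2X$, $\{Y,Z\}=-2Y$. 2. The $V[m,n]$, indexed by labels, form a basis of $\mathcal O_c$, and for $p,q,r,s\in\mathbb N_0$ $$\{V[2p,2q],V[2r,2s]\}=4(ps-qr)\,V[2(p+r-1)+1,2(q+s-1)+1],$$ $$\{V[2p,2q],V[2r+1,2s+1]\}=2\big(p(2s+1)-q(2r+1)\big)V[2(p+r),2(q+s)]+4c^2(ps-qr)\,V[2(p+r-1),2(q+s-1)],$$ $$\{V[2p+1,2q+1],V[2r+1,2s+1]\}=\big((2p+1)(2s+1)-(2q+1)(2r+1)\big)V[2(p+r)+1,2(q+s)+1]+4c^2(ps-qr)\,V[2(p+r)-1,2(q+s)-1].$$ 3. The brackets of $w_\wedge$ and of $W(\infty;c)$ are Lie brackets. Under $V[m,n]\leftrightarrow w[m,n]$ the bracket of $\mathcal O_c$ is $\{\cdot,\cdot\}_{w_\wedge}+c^2\varphi$, where $\varphi$ is given on generators by the $c^2$-terms in 2. The map $\varphi$ is a Lie algebra $2$-cocycle of $w_\wedge$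 with values in the adjoint module and is not a coboundary, so the deformation is non-trivial. Moreover, for each $c\ne0$ the Lie algebra $\mathcal O_c$ is not isomorphic to $w_\wedge$. 4. With $$C_0(p,q,\ell)=\frac{[p]_\ell[q]_\ell[p+q]_\ell}{\ell!\,[2(p+q)]_{2\ell}},\qquad C_1(p,q,\ell)=\frac{[p]_\ell[q]_\ell[p+q+1]_\ell}{\ell!\,[2(p+q+1)]_{2\ell}}$$ the two families are related by the upper-triangular transformation $$W[2p,2q]=\sum_{\ell=0}^{\min(p,q)}(2c)^{2\ell}C_0(p,q,\ell)V[2p-2\ell,2q-2\ell],\qquad W[2p+1,2q+1]=\sum_{\ell=0}^{\min(p,q)}(2c)^{2\ell}C_1(p,q,\ell)V[2p-2\ell+1,2q-2\ell+1],$$ and for every $c$ there is an isomorphism of Lie algebras $\mathcal O_c\cong W(\infty;c)$ that sends each scattering generator $W[m,n]\in\mathcal O_c$ to the basis vector $W[m,n]$. For $c\neq0$, $W[m,n]\mapsto c^{(m+n)/2-1}W[m,n]$ is an isomorphism $W(\infty;c)\cong W(\infty)$. 5. $W(\infty;c)$ is the scaling limit of $W(\mu;\mathfrak q)$: if $|\sigma|\to\infty$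 and $(4\mathfrak q\sigma)^2\to c^2$ (so that $\mathfrak q\to0$; in particular with $4\mathfrak q\sigma=c$ held fixed, or $16\,\mathfrak q^2\mu=c^2$ held fixed), then $\mathfrak q^{2\ell}\Psi_{2\ell+1}(m,n;\sigma)\to(2c)^{2\ell}\psi_{2\ell+1}(m,n)$ for all $\ell,m,n\in\mathbb N_0$, and the bracket of any two fixed vectors in $W(\mu;\mathfrak q)$ converges coefficientwise to their bracket in $W(\infty;c)$. 6. In an inhomogeneous coordinate $z$ on the twistor line, $c(\lambda)$ becomes $cz$. The celestial chiral algebra (CCA) of self-dual gravity on Eguchi–Hanson space is the algebra of the modes $W[p,q]_a$ ($a\in\mathbb Z$) of fields $W[p,q](z)$ with operator products $$W[p,q](z_1)W[r,s](z_2)\sim-\frac1{2z_{12}}\sum_{\ell\ge0}(2cz_2)^{2\ell}R_{2\ell+1}(p,q,r,s)\,\psi_{2\ell+1}\big(\tfrac{p+q}2,\tfrac{r+s}2\big)W[p+r-2\ell-1,q+s-2\ell-1](z_2),$$ that is, $$[W[p,q]_a,W[r,s]_b]=-\tfrac12\sum_{\ell\ge0}(2c)^{2\ell}R_{2\ell+1}\,\psi_{2\ell+1}\,W[p+r-2\ell-1,q+s-2\ell-1]_{a+b+2\ell}.$$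 This is a Lie algebra. For every $c$, $W[p,q]_a\mapsto-\tfrac12z^aW[p,q]$ is an isomorphism onto the loop algebra of the Poisson algebra of the fibres, i.e. onto $\mathbb C[z,z^{-1}][X,Y,Z]/(XY-Z^2+c^2z^2)$ with the $\mathbb C[z,z^{-1}]$-bilinear Poisson bracket of 1. For $c\ne0$, $W[p,q]_a\mapsto-\tfrac12\,c^{d-1}z^{a+d-1}\otimes W[p,q]$ with $d=(p+q)/2$ is an isomorphism of Lie algebras from the CCA onto the loop algebra $\mathcal L W(\infty)=\mathbb C[z,z^{-1}]\otimes W(\infty)$. -/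

import Mathlib

open scoped LaurentPolynomial TensorProduct

noncomputable section

namespace EguchiHanson

/-! ### Lie algebras given by a bilinear bracket -/

/-- A bilinear bracket is a Lie bracket: it is alternating and satisfies the Jacobi identity. -/
structure IsLieBracket {V : Type*} [AddCommGroup V] [Module ℂ V]
    (B : V →ₗ[ℂ] V →ₗ[ℂ] V) : Prop where
  self : ∀ x, B x x = 0
  jacobi : ∀ x y z, B x (B y z) = B (B x y) z + B y (B x z)

/-- A Poisson bracket on a commutative algebra: a Lie bracket that is a derivation of the product
in each argument. -/
structure IsPoissonBracket {O : Type*} [CommRing O] [Algebra ℂ O]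
    (B : O →ₗ[ℂ] O →ₗ[ℂ] O) : Prop extends IsLieBracket B where
  leibniz : ∀ x y z, B x (y * z) = B x y * z + y * B x z

/-- The vector space `V` regarded as a Lie algebra with the Lie bracket `B`. -/
def LieOf {V : Type*} [AddCommGroup V] [Module ℂ V] (B : V →ₗ[ℂ] V →ₗ[ℂ] V)
    (_h : IsLieBracket B) : Type _ := V

namespace LieOf

variable {V : Type*} [AddCommGroup V] [Module ℂ V] {B : V →ₗ[ℂ] V →ₗ[ℂ] V}
  (h : IsLieBracket B)

instance : AddCommGroup (LieOf B h) := inferInstanceAs (AddCommGroup V)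

instance : Module ℂ (LieOf B h) := inferInstanceAs (Module ℂ V)

/-- The identity map from `V` to the Lie algebra `LieOf B h`. -/
def of : V ≃ₗ[ℂ] LieOf B h := LinearEquiv.refl ℂ V

instance : LieRing (LieOf B h) where
  bracket x y := of h (B ((of h).symm x) ((of h).symm y))
  add_lie x y z := by simp
  lie_add x y z := by simp
  lie_self x := by simp [h.self]
  leibniz_lie x y z := by
    simp only [LinearEquiv.symm_apply_apply, h.jacobi ((of h).symm x), map_add]

instance : LieAlgebra ℂ (LieOf B h) where
  lie_smul t x y := by
    change of h (B ((of h).symm x) ((of h).symm (t • y))) =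
      t • of h (B ((of h).symm x) ((of h).symm y))
    simp

end LieOf

/-! ### The fibre ring and its Poisson bracket

The base ring `A` is `ℂ` for a single twistor fibre, and the ring of Laurent polynomials in the
coordinate of the twistor line for the family of all fibres over the punctured line. -/

section Fibre

set_option linter.unusedSectionVars false

variable (A : Type*) [CommRing A] [Algebra ℂ A]

/-- The polynomial `X Y - Z² + t`, where `X, Y, Z` are the variables `0, 1, 2`. -/
def casimir (t : A) : MvPolynomial (Fin 3) A :=
  MvPolynomial.X 0 * MvPolynomial.X 1 - MvPolynomial.X 2 ^ 2 + MvPolynomial.C t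

/-- The ring `A[X, Y, Z] / (X Y - Z² + t)`. -/
abbrev Fibre (t : A) : Type _ := MvPolynomial (Fin 3) A ⧸ Ideal.span {casimir A t}

/-- The class of a polynomial in the fibre ring. -/
abbrev toFibre (t : A) : MvPolynomial (Fin 3) A →+* Fibre A t :=
  Ideal.Quotient.mk (Ideal.span {casimir A t})

/-- The coordinate function `X`. -/
def coX (t : A) : Fibre A t := toFibre A t (MvPolynomial.X 0)

/-- The coordinate function `Y`. -/
def coY (t : A) : Fibre A t := toFibre A t (MvPolynomial.X 1)

/-- The coordinate function `Z`. -/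
def coZ (t : A) : Fibre A t := toFibre A t (MvPolynomial.X 2)

open MvPolynomial in
/-- The Poisson bracket on `A[X, Y, Z]` with
`{X, Y} = 4 Z`, `{X, Z} = 2 X`, `{Y, Z} = -2 Y`. -/
def polyBracket (f g : MvPolynomial (Fin 3) A) : MvPolynomial (Fin 3) A :=
  4 * X 2 * (pderiv 0 f * pderiv 1 g - pderiv 1 f * pderiv 0 g)
    + 2 * X 0 * (pderiv 0 f * pderiv 2 g - pderiv 2 f * pderiv 0 g)
    - 2 * X 1 * (pderiv 1 f * pderiv 2 g - pderiv 2 f * pderiv 1 g)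

variable {A}

theorem pderiv_pderiv_comm (i j : Fin 3) (f : MvPolynomial (Fin 3) A) :
    MvPolynomial.pderiv i (MvPolynomial.pderiv j f)
      = MvPolynomial.pderiv j (MvPolynomial.pderiv i f) := by
  have h : ⁅(MvPolynomial.pderiv i : Derivation A (MvPolynomial (Fin 3) A) (MvPolynomial (Fin 3) A)),
      (MvPolynomial.pderiv j : Derivation A (MvPolynomial (Fin 3) A) (MvPolynomial (Fin 3) A))⁆
        = 0 := by
    apply MvPolynomial.derivation_ext
    intro k
    simp only [Derivation.commutator_apply, MvPolynomial.pderiv_X, Derivation.zero_apply]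
    by_cases h1 : k = j <;> by_cases h2 : k = i <;>
      simp [Pi.single_apply, h1, h2, apply_ite]
  have := congrArg (fun D => D f) h
  simpa [Derivation.commutator_apply, sub_eq_zero] using this

theorem polyBracket_swap (f g : MvPolynomial (Fin 3) A) :
    polyBracket A f g = - polyBracket A g f := by
  unfold polyBracket; ring

theorem polyBracket_add (f g h : MvPolynomial (Fin 3) A) :
    polyBracket A f (g + h) = polyBracket A f g + polyBracket A f h := by
  simp only [polyBracket, map_add]; ring

theorem polyBracket_smul (c : ℂ) (f g : MvPolynomial (Fin 3) A) :
    polyBracket A f (c • g) = c • polyBracket A f g := by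
  have e : ∀ p : MvPolynomial (Fin 3) A, c • p = MvPolynomial.C (algebraMap ℂ A c) * p := fun p => by
    rw [← algebraMap_smul A c p, MvPolynomial.smul_eq_C_mul]
  simp only [polyBracket, e, Derivation.leibniz, MvPolynomial.pderiv_C, smul_eq_mul]; ring

theorem polyBracket_mul (f g h : MvPolynomial (Fin 3) A) :
    polyBracket A f (g * h) = polyBracket A f g * h + g * polyBracket A f h := by
  simp only [polyBracket, Derivation.leibniz, smul_eq_mul]; ring

theorem polyBracket_jacobi (f g h : MvPolynomial (Fin 3) A) :
    polyBracket A f (polyBracket A g h)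
      = polyBracket A (polyBracket A f g) h + polyBracket A g (polyBracket A f h) := by
  have e1 := fun p : MvPolynomial (Fin 3) A => pderiv_pderiv_comm 1 0 p
  have e2 := fun p : MvPolynomial (Fin 3) A => pderiv_pderiv_comm 2 0 p
  have e3 := fun p : MvPolynomial (Fin 3) A => pderiv_pderiv_comm 2 1 p
  have n4 : ∀ i : Fin 3, MvPolynomial.pderiv i (4 : MvPolynomial (Fin 3) A) = 0 := fun i => by
    simpa using (MvPolynomial.pderiv i : Derivation A (MvPolynomial (Fin 3) A) _).map_natCast 4
  have n2 : ∀ i : Fin 3, MvPolynomial.pderiv i (2 : MvPolynomial (Fin 3) A) = 0 := fun i => by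
    simpa using (MvPolynomial.pderiv i : Derivation A (MvPolynomial (Fin 3) A) _).map_natCast 2
  simp only [polyBracket, map_add, map_sub, Derivation.leibniz, smul_eq_mul, e1, e2, e3, n4, n2,
    MvPolynomial.pderiv_X]
  simp
  ring

theorem polyBracket_casimir (t : A) (f : MvPolynomial (Fin 3) A) :
    polyBracket A f (casimir A t) = 0 := by
  simp only [polyBracket, casimir, map_add, map_sub, Derivation.leibniz, smul_eq_mul,
    Derivation.leibniz_pow, MvPolynomial.pderiv_X, MvPolynomial.pderiv_C]
  simp
  ring

theorem polyBracket_mem (t : A) (f g : MvPolynomial (Fin 3) A)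
    (hg : g ∈ Ideal.span {casimir A t}) : polyBracket A f g ∈ Ideal.span {casimir A t} := by
  obtain ⟨k, rfl⟩ := Ideal.mem_span_singleton.1 hg
  rw [polyBracket_mul, polyBracket_casimir, zero_mul, zero_add]
  exact Ideal.mul_mem_right _ _ (Ideal.mem_span_singleton_self _)

theorem toFibre_polyBracket_congr (t : A) {f f' g g' : MvPolynomial (Fin 3) A}
    (hf : toFibre A t f = toFibre A t f') (hg : toFibre A t g = toFibre A t g') :
    toFibre A t (polyBracket A f g) = toFibre A t (polyBracket A f' g') := by
  have key : ∀ p q q' : MvPolynomial (Fin 3) A, toFibre A t q = toFibre A t q' →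
      toFibre A t (polyBracket A p q) = toFibre A t (polyBracket A p q') := by
    intro p q q' hq
    have h := polyBracket_mem t p (q - q') (Ideal.Quotient.eq.1 hq)
    have e : polyBracket A p q = polyBracket A p (q - q') + polyBracket A p q' := by
      rw [← polyBracket_add, sub_add_cancel]
    rw [e, map_add, Ideal.Quotient.eq_zero_iff_mem.2 h, zero_add]
  rw [key f g g' hg, polyBracket_swap f g', polyBracket_swap f' g', map_neg, map_neg,
    key g' f f' hf]

variable (A)

/-- The Poisson bracket induced on the fibre ring: the bracket of the classes of two polynomials is
the class of their bracket. -/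
def fibreBracketFun (t : A) (x y : Fibre A t) : Fibre A t :=
  toFibre A t (polyBracket A (Function.surjInv Ideal.Quotient.mk_surjective x)
    (Function.surjInv Ideal.Quotient.mk_surjective y))

variable {A}

theorem fibreBracketFun_mk (t : A) (f g : MvPolynomial (Fin 3) A) :
    fibreBracketFun A t (toFibre A t f) (toFibre A t g) = toFibre A t (polyBracket A f g) :=
  toFibre_polyBracket_congr t (Function.surjInv_eq _ _) (Function.surjInv_eq _ _)

theorem fibreBracketFun_swap (t : A) (x y : Fibre A t) :
    fibreBracketFun A t x y = - fibreBracketFun A t y x := by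
  obtain ⟨f, rfl⟩ := Ideal.Quotient.mk_surjective x
  obtain ⟨g, rfl⟩ := Ideal.Quotient.mk_surjective y
  rw [fibreBracketFun_mk, fibreBracketFun_mk, polyBracket_swap, map_neg]

theorem fibreBracketFun_add (t : A) (x y z : Fibre A t) :
    fibreBracketFun A t x (y + z) = fibreBracketFun A t x y + fibreBracketFun A t x z := by
  obtain ⟨f, rfl⟩ := Ideal.Quotient.mk_surjective x
  obtain ⟨g, rfl⟩ := Ideal.Quotient.mk_surjective y
  obtain ⟨h, rfl⟩ := Ideal.Quotient.mk_surjective z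
  rw [← map_add, fibreBracketFun_mk, fibreBracketFun_mk, fibreBracketFun_mk, polyBracket_add,
    map_add]

theorem fibreBracketFun_smul (t : A) (c : ℂ) (x y : Fibre A t) :
    fibreBracketFun A t x (c • y) = c • fibreBracketFun A t x y := by
  obtain ⟨f, rfl⟩ := Ideal.Quotient.mk_surjective x
  obtain ⟨g, rfl⟩ := Ideal.Quotient.mk_surjective y
  have e : ∀ p : MvPolynomial (Fin 3) A, c • toFibre A t p = toFibre A t (c • p) := fun _ => rfl
  rw [e, fibreBracketFun_mk, fibreBracketFun_mk, e, polyBracket_smul]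

variable (A)

/-- The induced Poisson bracket on the fibre ring, as a bilinear map. -/
def fibreBracket (t : A) : Fibre A t →ₗ[ℂ] Fibre A t →ₗ[ℂ] Fibre A t :=
  LinearMap.mk₂ ℂ (fibreBracketFun A t)
    (fun x y z => by
      rw [fibreBracketFun_swap, fibreBracketFun_add, neg_add, ← fibreBracketFun_swap,
        ← fibreBracketFun_swap])
    (fun c x y => by
      rw [fibreBracketFun_swap, fibreBracketFun_smul, ← smul_neg, ← fibreBracketFun_swap])
    (fibreBracketFun_add t)
    (fibreBracketFun_smul t)

variable {A}

theorem fibreBracket_mk (t : A) (f g : MvPolynomial (Fin 3) A) :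
    fibreBracket A t (toFibre A t f) (toFibre A t g) = toFibre A t (polyBracket A f g) :=
  fibreBracketFun_mk t f g

theorem fibreBracket_isLie (t : A) : IsLieBracket (fibreBracket A t) where
  self x := by
    obtain ⟨f, rfl⟩ := Ideal.Quotient.mk_surjective x
    rw [fibreBracket_mk]
    have : polyBracket A f f = 0 := by unfold polyBracket; ring
    rw [this, map_zero]
  jacobi x y z := by
    obtain ⟨f, rfl⟩ := Ideal.Quotient.mk_surjective x
    obtain ⟨g, rfl⟩ := Ideal.Quotient.mk_surjective y
    obtain ⟨h, rfl⟩ := Ideal.Quotient.mk_surjective z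
    simp only [fibreBracket_mk]
    rw [polyBracket_jacobi, map_add]

variable (A)

/-- The fibre ring with its Poisson bracket, as a Lie algebra over `ℂ`. -/
abbrev FibreLie (t : A) : Type _ := LieOf (fibreBracket A t) (fibreBracket_isLie t)

/-- The twistor generators `V[2p, 2q] = X^p Y^q`, `V[2p+1, 2q+1] = X^p Y^q Z`, and zero if a label
is negative. (Used only for labels of equal parity.) -/
def twistorGen (t : A) (m n : ℤ) : Fibre A t :=
  if 0 ≤ m ∧ 0 ≤ n then
    coX A t ^ (m.toNat / 2) * coY A t ^ (n.toNat / 2) * coZ A t ^ (m.toNat % 2)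
  else 0

/-- The scattering generators (soft modes)
`W[2p, 2q] = (2p)! (2q)! / (2p+2q)! ∑_ℓ ((p+q)! / ((p-ℓ)! (q-ℓ)! (2ℓ)!)) X^(p-ℓ) Y^(q-ℓ) (2Z)^(2ℓ)`
and `W[2p+1, 2q+1] = (2p+1)! (2q+1)! / (2p+2q+2)! ∑_ℓ
((p+q+1)! / ((p-ℓ)! (q-ℓ)! (2ℓ+1)!)) X^(p-ℓ) Y^(q-ℓ) (2Z)^(2ℓ+1)`, with `0 ≤ ℓ ≤ min(p, q)`;
in the code `m = 2p + e` and `n = 2q + e` with `e` in `{0, 1}`. -/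
def scatteringGen (t : A) (m n : ℕ) : Fibre A t :=
  ((m.factorial * n.factorial : ℂ) / (m + n).factorial) •
    ∑ l ∈ Finset.range (min (m / 2) (n / 2) + 1),
      ((((m + n) / 2).factorial : ℂ) /
          ((m / 2 - l).factorial * (n / 2 - l).factorial * (2 * l + m % 2).factorial)) •
        (coX A t ^ (m / 2 - l) * coY A t ^ (n / 2 - l) * (2 * coZ A t) ^ (2 * l + m % 2))

end Fibre

/-! ### Structure constants -/

/-- The descending Pochhammer symbol `[a]_l = a (a - 1) ⋯ (a - l + 1)`. -/
def fall (a : ℂ) (l : ℕ) : ℂ := (descPochhammer ℂ l).eval a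

/-- The ascending Pochhammer symbol `(a)_k = a (a + 1) ⋯ (a + k - 1)`. -/
def rise (a : ℂ) (k : ℕ) : ℂ := (ascPochhammer ℂ k).eval a

/-- The coefficient `C₀(p, q, l)` of the change of basis. -/
def coefC₀ (p q l : ℕ) : ℂ :=
  fall p l * fall q l * fall (p + q) l / (l.factorial * fall (2 * (p + q)) (2 * l))

/-- The coefficient `C₁(p, q, l)` of the change of basis. -/
def coefC₁ (p q l : ℕ) : ℂ :=
  fall p l * fall q l * fall (p + q + 1) l / (l.factorial * fall (2 * (p + q + 1)) (2 * l))

/-- `R_l(p, q, r, s) = (1 / l!) ∑_k (-1)^k (l choose k) [p]_(l-k) [q]_k [r]_k [s]_(l-k)`. -/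
def coefR (l p q r s : ℕ) : ℂ :=
  1 / l.factorial * ∑ k ∈ Finset.range (l + 1),
    (-1) ^ k * l.choose k * fall p (l - k) * fall q k * fall r k * fall s (l - k)

/-- The function `ψ_(2l+1)(m, n)`. -/
def psiOdd (l : ℕ) (m n : ℂ) : ℂ :=
  (-1) ^ l * fall (l + 1 / 2) l /
    (4 ^ (2 * l) * fall (m - 1 / 2) l * fall (n - 1 / 2) l * fall (m + n - 1 / 2 - l) l)

/-- The generalized hypergeometric series `₄F₃(a₁, a₂, a₃, a₄; b₁, b₂, b₃; z)`. -/
def hyp₄F₃ (a₁ a₂ a₃ a₄ b₁ b₂ b₃ z : ℂ) : ℂ :=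
  ∑' k : ℕ, rise a₁ k * rise a₂ k * rise a₃ k * rise a₄ k /
    (rise b₁ k * rise b₂ k * rise b₃ k) * z ^ k / k.factorial

/-- The function `Ψ_l(m, n; σ)`. (For odd `l` and integers `m`, `n` the series terminates and no
denominator vanishes.) -/
def PsiHyp (l : ℕ) (m n σ : ℂ) : ℂ :=
  hyp₄F₃ (-1 / 2 - 2 * σ) (3 / 2 + 2 * σ) (-l / 2) ((1 - l) / 2)
    (1 / 2 - m) (1 / 2 - n) (m + n + 3 / 2 - l) 1

/-! ### The algebras given by structure constants -/

/-- The labels of the generators: pairs of natural numbers of the same parity. -/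
abbrev Label : Type := {i : ℕ × ℕ // i.1 % 2 = i.2 % 2}

/-- The vector space with one basis vector for each label. -/
abbrev Gens : Type := Label →₀ ℂ

/-- The basis vector with label `(m, n)`, and zero if `(m, n)` is not a label. -/
def gen (m n : ℤ) : Gens :=
  if h : m.toNat % 2 = n.toNat % 2 ∧ 0 ≤ m ∧ 0 ≤ n then
    Finsupp.single ⟨(m.toNat, n.toNat), h.1⟩ 1
  else 0

/-- The bilinear bracket on a vector space with basis `ι` whose value on the basis vectors `i`, `j`
is `f i j`. -/
def bracketOf {ι : Type*} (f : ι → ι → (ι →₀ ℂ)) : (ι →₀ ℂ) →ₗ[ℂ] (ι →₀ ℂ) →ₗ[ℂ] (ι →₀ ℂ) :=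
  Finsupp.linearCombination ℂ fun i => Finsupp.linearCombination ℂ (f i)

/-- The bracket of the wedge algebra `w_∧`:
`{w[p, q], w[r, s]} = (p s - q r) w[p + r - 1, q + s - 1]`. -/
def wedgeBracket : Gens →ₗ[ℂ] Gens →ₗ[ℂ] Gens :=
  bracketOf fun i j =>
    ((i.1.1 : ℂ) * j.1.2 - i.1.2 * j.1.1) •
      gen (i.1.1 + j.1.1 - 1) (i.1.2 + j.1.2 - 1)

/-- The bracket of `W(μ; 𝔮)` with `μ = σ (σ + 1)`:
`[W[p, q], W[r, s]] = ∑_l 𝔮^(2l) R_(2l+1)(p, q, r, s) Ψ_(2l+1)((p+q)/2, (r+s)/2; σ)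
W[p + r - 2l - 1, q + s - 2l - 1]`, where `R_(2l+1)(p, q, r, s)` vanishes for `2l + 1 > p + q`, so
that `l` may be restricted to `l ≤ p + q`. -/
def wMuBracket (𝔮 σ : ℂ) : Gens →ₗ[ℂ] Gens →ₗ[ℂ] Gens :=
  bracketOf fun i j =>
    ∑ l ∈ Finset.range (i.1.1 + i.1.2 + 1),
      (𝔮 ^ (2 * l) * coefR (2 * l + 1) i.1.1 i.1.2 j.1.1 j.1.2 *
          PsiHyp (2 * l + 1) ((i.1.1 + i.1.2) / 2) ((j.1.1 + j.1.2) / 2) σ) •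
        gen (i.1.1 + j.1.1 - 2 * l - 1) (i.1.2 + j.1.2 - 2 * l - 1)

/-- The coefficient `(2c)^(2l) R_(2l+1)(p, q, r, s) ψ_(2l+1)((p+q)/2, (r+s)/2)`. -/
def wInfCoeff (c : ℂ) (l : ℕ) (i j : Label) : ℂ :=
  (2 * c) ^ (2 * l) * coefR (2 * l + 1) i.1.1 i.1.2 j.1.1 j.1.2 *
    psiOdd l ((i.1.1 + i.1.2) / 2) ((j.1.1 + j.1.2) / 2)

/-- The bracket of `W(∞)` with parameter `c`:
`{W[p, q], W[r, s]} = ∑_l (2c)^(2l) R_(2l+1)(p, q, r, s) ψ_(2l+1)((p+q)/2, (r+s)/2)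
W[p + r - 2l - 1, q + s - 2l - 1]`, where again the terms with `l > p + q` vanish. -/
def wInfBracket (c : ℂ) : Gens →ₗ[ℂ] Gens →ₗ[ℂ] Gens :=
  bracketOf fun i j =>
    ∑ l ∈ Finset.range (i.1.1 + i.1.2 + 1),
      wInfCoeff c l i j • gen (i.1.1 + j.1.1 - 2 * l - 1) (i.1.2 + j.1.2 - 2 * l - 1)

/-- The value on basis vectors of the cocycle that deforms `w_∧` in the twistor basis: zero on two
generators with even labels, and otherwise
`4 (p s - q r) V[m + m' - 3, n + n' - 3]` on `V[m, n]`, `V[m', n']`, where `p, q, r, s` are the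
integer parts of `m/2, n/2, m'/2, n'/2`. -/
def cocycleValue (i j : Label) : Gens :=
  if i.1.1 % 2 = 0 ∧ j.1.1 % 2 = 0 then 0
  else
    (4 * (((i.1.1 / 2 : ℕ) : ℂ) * (j.1.2 / 2 : ℕ) - ((i.1.2 / 2 : ℕ) : ℂ) * (j.1.1 / 2 : ℕ))) •
      gen (i.1.1 + j.1.1 - 3) (i.1.2 + j.1.2 - 3)

/-! ### The celestial chiral algebra of self-dual gravity on Eguchi-Hanson space -/

/-- The basis vector for the mode `W[m, n]_a = ∮ z^a W[m, n](z) dz / (2πi)`, and zero if `(m, n)`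
is not a label. -/
def modeGen (a m n : ℤ) : ℤ × Label →₀ ℂ :=
  if h : m.toNat % 2 = n.toNat % 2 ∧ 0 ≤ m ∧ 0 ≤ n then
    Finsupp.single (a, ⟨(m.toNat, n.toNat), h.1⟩) 1
  else 0

/-- The bracket of the modes of the fields `W[p, q](z)` with operator products
`W[p, q](z₁) W[r, s](z₂) ∼ -1 / (2 (z₁ - z₂)) ∑_l (2 c z₂)^(2l) R_(2l+1)(p, q, r, s)
ψ_(2l+1)((p+q)/2, (r+s)/2) W[p + r - 2l - 1, q + s - 2l - 1](z₂)`. -/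
def ccaBracket (c : ℂ) :
    (ℤ × Label →₀ ℂ) →ₗ[ℂ] (ℤ × Label →₀ ℂ) →ₗ[ℂ] (ℤ × Label →₀ ℂ) :=
  bracketOf fun u v =>
    (-1 / 2 : ℂ) • ∑ l ∈ Finset.range (u.2.1.1 + u.2.1.2 + 1),
      wInfCoeff c l u.2 v.2 •
        modeGen (u.1 + v.1 + 2 * l)
          (u.2.1.1 + v.2.1.1 - 2 * l - 1) (u.2.1.2 + v.2.1.2 - 2 * l - 1)

/-- The value `c² z²` of the function `c²(λ)` in the inhomogeneous coordinate `z` of the twistor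
line, as a Laurent polynomial. -/
def loopParam (c : ℂ) : ℂ[T;T⁻¹] := (LaurentPolynomial.C c * LaurentPolynomial.T 1) ^ 2

end EguchiHanson

end

open EguchiHanson

/-! Everything is extracted from one object, the Poisson algebra `Fibre A t` over an arbitrary base
ring. Taking `A = ℂ`, `t = c²` gives a single fibre; taking Laurent polynomials and `t = (c z)²`
gives the family of fibres, so one computation of brackets serves both `W(∞; c)` and the celestial
chiral algebra. Jacobi identities are never checked on structure constants: a basis identifies each
algebra given by structure constants with a ring of functions, and the Lie property is pulled back.

The twistor generators are monomials. They form a basis because the fibre ring is the free quadratic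
extension of `A[X, Y]` by `Z` with `Z² = X Y + t`, and their brackets follow from the Leibniz rule
and this relation. The bracket is affine in `t`: its constant term is the wedge bracket, its linear
term the cocycle. Comparing a few coefficients shows that the cocycle is not a coboundary.

For the scattering generators, `X, Y, Z` span a copy of `sl₂`, and `W[m, n]` with `m + n = 2 d` is a
multiple of the coefficient of `u ^ m` in `(X u² + 2 Z u + Y) ^ d`, hence a weight vector of an
irreducible representation whose highest vector is `X ^ d`. The bracket of `X ^ d` with `W[r, s]` is
computed directly, since multiplication by `X` satisfies a recursion with two terms
(`coX_mul_scatZ`, `coX_pow_mul_scatZ`). All other brackets follow by applying the lowering operator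
`ad Y`: the numbers `R_l` are coefficients of transvectants, which commute with `sl₂`
(`coefR_covariance`), and `ψ` depends only on the representations. This gives `fibreBracket_scatZ`.

For `t ≠ 0` every Lie ideal of the fibre algebra that contains a non-central element contains `X`,
hence also `Z`, and `{X, Z} = 2 X`. In the wedge algebra the generators with label sum at least 4
span an ideal with non-central elements, but bracketing with one of its elements strictly raises a
separated filtration, so `{x, z} = 2 x` forces `x = 0` there. The two algebras are therefore not
isomorphic.

In the scaling limit the hypergeometric series has `l + 1` terms, and after multiplication by `𝔮 ^
(2 l)` only the last one survives. -/

namespace EguchiHanson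

/-! ### Coefficients of the powers of a quadratic polynomial -/

section Trinomial

variable {R : Type*} [CommRing R]

/-- The coefficient of `u ^ m` in `(x u² + 2 z u + y) ^ d`. -/
def trinom (x y z : R) : ℕ → ℤ → R
  | 0, m => if m = 0 then 1 else 0
  | d + 1, m => x * trinom x y z d (m - 2) + 2 * z * trinom x y z d (m - 1) + y * trinom x y z d m

variable (x y z : R)

theorem trinom_zero (m : ℤ) : trinom x y z 0 m = if m = 0 then 1 else 0 := rfl

theorem trinom_succ (d : ℕ) (m : ℤ) : trinom x y z (d + 1) m =
    x * trinom x y z d (m - 2) + 2 * z * trinom x y z d (m - 1) + y * trinom x y z d m := rfl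

theorem trinom_eq_zero_of_neg (d : ℕ) (m : ℤ) (hm : m < 0) : trinom x y z d m = 0 := by
  induction d generalizing m with
  | zero => simp [trinom_zero, hm.ne]
  | succ d ih => rw [trinom_succ, ih _ hm, ih (m - 2) (by lia), ih (m - 1) (by lia)]; ring

theorem trinom_eq_zero_of_lt (d : ℕ) (m : ℤ) (hm : 2 * d < m) : trinom x y z d m = 0 := by
  induction d generalizing m with
  | zero => rw [trinom_zero, if_neg (by push_cast at hm; lia)]
  | succ d ih =>
    push_cast at hm
    rw [trinom_succ, ih m (by lia), ih (m - 2) (by lia), ih (m - 1) (by lia)]; ring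

/-- With `Q = x u² + 2 z u + y`, this is the coefficient of `u ^ m` in `u (Q ^ (d + 1))' = (d + 1) u
Q' Q ^ d`. -/
theorem mul_trinom_succ (d : ℕ) (m : ℤ) : (m : R) * trinom x y z (d + 1) m =
    (d + 1) * (2 * x * trinom x y z d (m - 2) + 2 * z * trinom x y z d (m - 1)) := by
  induction d generalizing m with
  | zero =>
    simp only [trinom_succ, trinom_zero]
    by_cases h0 : m = 0
    · subst h0; simp
    by_cases h1 : m = 1
    · subst h1; simp
    by_cases h2 : m = 2
    · subst h2; simp
    simp [h0, sub_eq_zero, h1, h2]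
  | succ d ih =>
    have h1 := ih m
    have h2 := ih (m - 1)
    have h3 := ih (m - 2)
    rw [trinom_succ x y z (d + 1) m]
    rw [trinom_succ] at h1
    have e2 : m - 2 - 1 = m - 3 := by ring
    have e3 : m - 1 - 2 = m - 3 := by ring
    have e4 : m - 2 - 2 = m - 4 := by ring
    have e5 : m - 1 - 1 = m - 2 := by ring
    simp only [trinom_succ, e2, e3, e4, e5] at h1 h2 h3 ⊢
    push_cast at h1 h2 h3 ⊢
    linear_combination x * h3 + 2 * z * h2 + y * h1

/-- The second derivative of `Q ^ (d + 2)` in `u`, simplified by the discriminant identity `Q'² = 4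
x Q + 4 (z² - x y) = 4 x Q + 4 t`. This is the only place where the parameter enters the recursion.
-/
theorem mul_mul_trinom_succ_succ {t : R} (ht : z ^ 2 = x * y + t) (d : ℕ) (m : ℤ) :
    (m : R) * (m - 1) * trinom x y z (d + 2) m =
      2 * (d + 2) * (2 * d + 3) * x * trinom x y z (d + 1) (m - 2) +
        4 * (d + 2) * (d + 1) * t * trinom x y z d (m - 2) := by
  have h1 := mul_trinom_succ x y z (d + 1) m
  have h2 := mul_trinom_succ x y z d (m - 1)
  have h3 := mul_trinom_succ x y z d (m - 2)
  have h4 := trinom_succ x y z d (m - 2)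
  have e2 : m - 2 - 1 = m - 3 := by ring
  have e3 : m - 1 - 2 = m - 3 := by ring
  have e4 : m - 2 - 2 = m - 4 := by ring
  have e5 : m - 1 - 1 = m - 2 := by ring
  simp only [e2, e3, e4, e5] at h1 h2 h3 h4 ⊢
  push_cast at h1 h2 h3 h4 ⊢
  linear_combination ((m : R) - 1) * h1 + (d + 2) * 2 * z * h2 + (d + 2) * 2 * x * h3 +
    4 * (d + 2) * (d + 1) * trinom x y z d (m - 2) * ht - 4 * (d + 2) * (d + 1) * x * h4

variable {S : Type*} [CommRing S] [Algebra S R] (D : Derivation S R R)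

/-- On `Q ^ d` such a derivation acts as the operator `-2 (2 d u - u² ∂_u)` in the auxiliary
variable. -/
theorem derivation_trinom_lower (hx : D x = -(4 * z)) (hy : D y = 0) (hz : D z = -(2 * y))
    (d : ℕ) (m : ℤ) :
    D (trinom x y z d m) = -(2 * (2 * d + 1 - m) * trinom x y z d (m - 1)) := by
  have n2 : D 2 = 0 := by simpa using D.map_natCast 2
  induction d generalizing m with
  | zero =>
    simp only [trinom_zero]
    by_cases h0 : m = 0
    · subst h0; simp
    by_cases h1 : m = 1
    · subst h1; simp
    simp [h0, sub_eq_zero, h1]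
  | succ d ih =>
    have e2 : m - 2 - 1 = m - 3 := by ring
    have e3 : m - 1 - 2 = m - 3 := by ring
    have e5 : m - 1 - 1 = m - 2 := by ring
    simp only [trinom_succ, map_add, Derivation.leibniz, smul_eq_mul, ih, hx, hy, hz, n2, e2, e3, e5]
    push_cast
    ring

/-- On `Q ^ d` such a derivation acts as `2 ∂_u`. -/
theorem derivation_trinom_raise (hx : D x = 0) (hy : D y = 4 * z) (hz : D z = 2 * x)
    (d : ℕ) (m : ℤ) :
    D (trinom x y z d m) = 2 * (m + 1) * trinom x y z d (m + 1) := by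
  have n2 : D 2 = 0 := by simpa using D.map_natCast 2
  induction d generalizing m with
  | zero =>
    simp only [trinom_zero]
    by_cases h0 : m = 0
    · subst h0; simp
    by_cases h1 : m + 1 = 0
    · have : m = -1 := by lia
      subst this; simp
    simp [h0, h1]
  | succ d ih =>
    have e2 : m - 2 + 1 = m - 1 := by ring
    have e3 : m + 1 - 2 = m - 1 := by ring
    have e4 : m - 1 + 1 = m := by ring
    have e5 : m + 1 - 1 = m := by ring
    simp only [trinom_succ, map_add, Derivation.leibniz, smul_eq_mul, ih, hx, hy, hz, n2, e2, e3, e4,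
      e5]
    push_cast
    ring

open Polynomial in
theorem coeff_quadratic_pow (d m : ℕ) :
    ((C x * X ^ 2 + C (2 * z) * X + C y : R[X]) ^ d).coeff m = trinom x y z d m := by
  induction d generalizing m with
  | zero => simp [trinom_zero, coeff_one]
  | succ d ih =>
    have e : (C x * X ^ 2 + C (2 * z) * X + C y : R[X]) ^ (d + 1) =
        C x * ((C x * X ^ 2 + C (2 * z) * X + C y) ^ d * X ^ 2) +
        C (2 * z) * ((C x * X ^ 2 + C (2 * z) * X + C y) ^ d * X) +
        C y * (C x * X ^ 2 + C (2 * z) * X + C y) ^ d := by ring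
    rw [e, trinom_succ]
    simp only [coeff_add, coeff_C_mul]
    rw [ih]
    match m with
    | 0 => simp [trinom_eq_zero_of_neg]
    | 1 =>
      have := ih 0
      simp [trinom_eq_zero_of_neg, coeff_mul_X_pow'] at this ⊢
      simp [this]
    | m + 2 =>
      have h1 := ih m
      have h2 := ih (m + 1)
      have e1 : ((m + 2 : ℕ) : ℤ) - 2 = m := by push_cast; ring
      have e2 : ((m + 2 : ℕ) : ℤ) - 1 = (m + 1 : ℕ) := by push_cast; ring
      rw [coeff_mul_X_pow, coeff_mul_X, e1, e2, h1, h2]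

open Polynomial in
theorem trinom_eq_sum_sum (d m : ℕ) : trinom x y z d m =
    ∑ k ∈ Finset.range (d + 1), ∑ a ∈ Finset.range (k + 1),
      if 2 * a + (d - k) = m then
        ((d.choose k * k.choose a : ℕ) : R) * (x ^ a * y ^ (k - a) * (2 * z) ^ (d - k)) else 0 := by
  have e : (C x * X ^ 2 + C (2 * z) * X + C y : R[X]) = (C x * X ^ 2 + C y) + C (2 * z) * X := by
    ring
  rw [← coeff_quadratic_pow, e, add_pow, finsetSum_coeff]
  refine Finset.sum_congr rfl fun k _ => ?_
  rw [add_pow, Finset.sum_mul, Finset.sum_mul, finsetSum_coeff]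
  refine Finset.sum_congr rfl fun a _ => ?_
  have : (C x * X ^ 2) ^ a * C y ^ (k - a) * ((k.choose a : ℕ) : R[X]) * (C (2 * z) * X) ^ (d - k) *
      ((d.choose k : ℕ) : R[X]) =
      C (((d.choose k * k.choose a : ℕ) : R) * (x ^ a * y ^ (k - a) * (2 * z) ^ (d - k))) *
        X ^ (2 * a + (d - k)) := by
    simp only [map_mul, map_pow, map_natCast, Nat.cast_mul, mul_pow, pow_add, ← pow_mul]
    ring
  rw [this, coeff_C_mul, coeff_X_pow]
  simp [eq_comm]

theorem trinom_eq_sum (p q e : ℕ) (he : e ≤ 1) : trinom x y z (p + q + e) (2 * p + e : ℕ) =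
    ∑ l ∈ Finset.range (min p q + 1),
      (((p + q + e).choose (p + q - 2 * l) * (p + q - 2 * l).choose (p - l) : ℕ) : R) *
        (x ^ (p - l) * y ^ (q - l) * (2 * z) ^ (2 * l + e)) := by
  rw [trinom_eq_sum_sum, Finset.sum_sigma']
  symm
  -- A term takes `x u²` from `a` factors, `y` from `k - a` factors and `2 z u` from the rest. The
  -- exponent of `u` forces `a = p - l`, `k - a = q - l` and `2 l + e` factors of the last kind.
  refine Finset.sum_of_injOn (fun l => (⟨p + q - 2 * l, p - l⟩ : (_ : ℕ) × ℕ)) ?_ ?_ ?_ ?_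
  · intro a ha b hb hab
    simp at ha hb hab
    lia
  · intro l hl
    simp at hl ⊢
    lia
  · rintro ⟨k, a⟩ hka hn
    simp at hka hn ⊢
    intro h
    exfalso
    exact hn (p - a) (by lia) (by lia) (by lia) (by lia)
  · intro l hl
    simp at hl
    have h1 : 2 * (p - l) + (p + q + e - (p + q - 2 * l)) = 2 * p + e := by lia
    have h2 : p + q - 2 * l - (p - l) = q - l := by lia
    have h3 : p + q + e - (p + q - 2 * l) = 2 * l + e := by lia
    dsimp only
    rw [if_pos h1, h2, h3]

end Trinomial

/-! ### Scattering generators as weight vectors -/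

section Scattering

set_option linter.unusedSectionVars false

variable (A : Type*) [CommRing A] [Algebra ℂ A] (t : A)

theorem natCast_mul_eq_smul {R : Type*} [CommRing R] [Algebra ℂ R] (k : ℕ) (x : R) :
    (k : R) * x = (k : ℂ) • x := by
  rw [Nat.cast_smul_eq_nsmul, nsmul_eq_mul]

/-- The class of the parameter `t` in the fibre ring. -/
noncomputable abbrev tau : Fibre A t := algebraMap A (Fibre A t) t

/-- The scattering generators with integer labels, zero if a label is negative. -/
noncomputable def scatZ (m n : ℤ) : Fibre A t :=
  if 0 ≤ m ∧ 0 ≤ n then scatteringGen A t m.toNat n.toNat else 0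

theorem coZ_sq : coZ A t ^ 2 = coX A t * coY A t + tau A t := by
  have e : coX A t * coY A t - coZ A t ^ 2 + tau A t = toFibre A t (casimir A t) := rfl
  have h : toFibre A t (casimir A t) = 0 :=
    Ideal.Quotient.eq_zero_iff_mem.2 (Ideal.mem_span_singleton_self _)
  linear_combination -h - e

theorem fibreBracket_leibniz (x y z : Fibre A t) : fibreBracket A t x (y * z) =
    fibreBracket A t x y * z + y * fibreBracket A t x z := by
  obtain ⟨f, rfl⟩ := Ideal.Quotient.mk_surjective x
  obtain ⟨g, rfl⟩ := Ideal.Quotient.mk_surjective y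
  obtain ⟨h, rfl⟩ := Ideal.Quotient.mk_surjective z
  rw [← map_mul, fibreBracket_mk, fibreBracket_mk, fibreBracket_mk, polyBracket_mul, map_add,
    map_mul, map_mul]

theorem fibreBracket_algebraMap (x : Fibre A t) (a : A) :
    fibreBracket A t x (algebraMap A (Fibre A t) a) = 0 := by
  obtain ⟨f, rfl⟩ := Ideal.Quotient.mk_surjective x
  have e : algebraMap A (Fibre A t) a = toFibre A t (MvPolynomial.C a) := rfl
  rw [e, fibreBracket_mk]
  simp [polyBracket]

theorem fibreBracket_neg_swap (x y : Fibre A t) :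
    fibreBracket A t x y = - fibreBracket A t y x := fibreBracketFun_swap t x y

theorem fibreBracket_self (x : Fibre A t) : fibreBracket A t x x = 0 :=
  (fibreBracket_isLie t).self x

/-- The Hamiltonian derivation of a function on the fibre. -/
noncomputable def hamiltonian (x : Fibre A t) : Derivation A (Fibre A t) (Fibre A t) :=
  Derivation.mk'
    { toFun := fibreBracket A t x
      map_add' := map_add _
      map_smul' := fun a y => by
        rw [Algebra.smul_def, fibreBracket_leibniz, fibreBracket_algebraMap, zero_mul, zero_add,
          RingHom.id_apply]
        exact (Algebra.smul_def _ _).symm }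
    (fun y z => by
      simp only [LinearMap.coe_mk, AddHom.coe_mk, smul_eq_mul]
      rw [fibreBracket_leibniz]; ring)

theorem hamiltonian_apply (x y : Fibre A t) : hamiltonian A t x y = fibreBracket A t x y := rfl

theorem fibreBracket_smul_right (a : A) (x y : Fibre A t) :
    fibreBracket A t x (a • y) = a • fibreBracket A t x y :=
  (hamiltonian A t x).map_smul a y

theorem fibreBracket_smul_left (a : A) (x y : Fibre A t) :
    fibreBracket A t (a • x) y = a • fibreBracket A t x y := by
  rw [fibreBracket_neg_swap, fibreBracket_smul_right, fibreBracket_neg_swap A t y x, smul_neg,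
    neg_neg]

theorem fibreBracket_coX_coY : fibreBracket A t (coX A t) (coY A t) = 4 * coZ A t := by
  rw [coX, coY, coZ, fibreBracket_mk]
  simp [polyBracket, MvPolynomial.pderiv_X, map_ofNat]

theorem fibreBracket_coX_coZ : fibreBracket A t (coX A t) (coZ A t) = 2 * coX A t := by
  rw [coX, coZ, fibreBracket_mk]
  simp [polyBracket, MvPolynomial.pderiv_X, map_ofNat]

theorem fibreBracket_coY_coZ : fibreBracket A t (coY A t) (coZ A t) = -(2 * coY A t) := by
  rw [coY, coZ, fibreBracket_mk]
  simp [polyBracket, MvPolynomial.pderiv_X, map_ofNat]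

theorem fibreBracket_coY_coX : fibreBracket A t (coY A t) (coX A t) = -(4 * coZ A t) := by
  rw [fibreBracket_neg_swap, fibreBracket_coX_coY]

theorem scatteringGen_eq_trinom {m n d : ℕ} (h : m + n = 2 * d) : scatteringGen A t m n =
    ((m.factorial * n.factorial : ℂ) / (2 * d).factorial) •
      trinom (coX A t) (coY A t) (coZ A t) d m := by
  obtain ⟨p, q, e, he, rfl, rfl⟩ : ∃ p q e, e ≤ 1 ∧ m = 2 * p + e ∧ n = 2 * q + e :=
    ⟨m / 2, n / 2, m % 2, by lia, by lia, by lia⟩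
  obtain rfl : d = p + q + e := by lia
  rw [trinom_eq_sum _ _ _ _ _ _ he, scatteringGen, h]
  have h1 : (2 * p + e) / 2 = p := by lia
  have h2 : (2 * q + e) / 2 = q := by lia
  have h3 : (2 * p + e) % 2 = e := by lia
  have h4 : 2 * (p + q + e) / 2 = p + q + e := by lia
  rw [h1, h2, h3, h4]
  congr 1
  refine Finset.sum_congr rfl fun l hl => ?_
  have hl' : l ≤ p ∧ l ≤ q := by simpa [Nat.lt_succ_iff] using hl
  have e1 : (p + q + e).choose (p + q - 2 * l) * (p + q - 2 * l).choose (p - l) *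
      ((p - l).factorial * (q - l).factorial * (2 * l + e).factorial) = (p + q + e).factorial := by
    rw [← Nat.choose_mul_factorial_mul_factorial (show p + q - 2 * l ≤ p + q + e by lia),
      ← Nat.choose_mul_factorial_mul_factorial (show p - l ≤ p + q - 2 * l by lia),
      show p + q - 2 * l - (p - l) = q - l by lia,
      show p + q + e - (p + q - 2 * l) = 2 * l + e by lia]
    ring
  rw [← e1, natCast_mul_eq_smul (R := Fibre A t)]
  congr 1
  push_cast
  have F : ∀ k : ℕ, (k.factorial : ℂ) ≠ 0 := fun k => Nat.cast_ne_zero.2 (Nat.factorial_ne_zero k)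
  have F1 := F (p - l)
  have F2 := F (q - l)
  have F3 := F (2 * l + e)
  field_simp

theorem scatZ_natCast (m n : ℕ) : scatZ A t m n = scatteringGen A t m n := by
  simp [scatZ]

theorem scatZ_of_neg {m n : ℤ} (h : m < 0 ∨ n < 0) : scatZ A t m n = 0 := by
  rw [scatZ, if_neg (by lia)]

theorem scatZ_eq_trinom {m n d : ℕ} (h : m + n = 2 * d) : scatZ A t m n =
    ((m.factorial * n.factorial : ℂ) / (2 * d).factorial) •
      trinom (coX A t) (coY A t) (coZ A t) d m := by
  rw [scatZ_natCast, scatteringGen_eq_trinom A t h]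

/-- The lowering operator of `sl₂`. The normalisation `m! n! / (2 d)!` turns the factor `2 d + 1 - m
= n + 1` of `derivation_trinom_lower` into the factor `m`. -/
theorem fibreBracket_coY_scatZ {m n d : ℕ} (h : m + n = 2 * d) :
    fibreBracket A t (coY A t) (scatZ A t m n) = (-2 * m : ℂ) • scatZ A t (m - 1) (n + 1) := by
  rw [scatZ_eq_trinom A t h, map_smul, ← hamiltonian_apply,
    derivation_trinom_lower _ _ _ _ (fibreBracket_coY_coX A t) (fibreBracket_self A t _)
      (fibreBracket_coY_coZ A t)]
  rcases m with _ | m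
  · rw [trinom_eq_zero_of_neg _ _ _ _ _ (by simp)]; simp
  have e1 : ((m + 1 : ℕ) : ℤ) - 1 = m := by push_cast; ring
  have e2 : (n : ℤ) + 1 = (n + 1 : ℕ) := by push_cast; ring
  rw [e1, e2, scatZ_eq_trinom A t (show m + (n + 1) = 2 * d by lia)]
  have e3 : (2 * (2 * (d : Fibre A t) + 1 - ((m + 1 : ℕ) : ℤ))) = ((2 * (n + 1) : ℕ) : Fibre A t) := by
    have : ((2 * d : ℕ) : Fibre A t) = (m + 1 + n : ℕ) := by rw [h]
    push_cast at this ⊢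
    linear_combination 2 * this
  rw [e3, natCast_mul_eq_smul (R := Fibre A t), ← neg_smul, smul_smul, smul_smul,
    Nat.factorial_succ m, Nat.factorial_succ n]
  congr 1
  push_cast
  ring

theorem fibreBracket_coX_scatZ {m n d : ℕ} (h : m + n = 2 * d) :
    fibreBracket A t (coX A t) (scatZ A t m n) = (2 * n : ℂ) • scatZ A t (m + 1) (n - 1) := by
  rw [scatZ_eq_trinom A t h, map_smul, ← hamiltonian_apply,
    derivation_trinom_raise _ _ _ _ (fibreBracket_self A t _) (fibreBracket_coX_coY A t)
      (fibreBracket_coX_coZ A t)]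
  rcases n with _ | n
  · rw [trinom_eq_zero_of_lt _ _ _ _ _ (by lia)]; simp
  have e1 : ((n + 1 : ℕ) : ℤ) - 1 = n := by push_cast; ring
  have e2 : (m : ℤ) + 1 = (m + 1 : ℕ) := by push_cast; ring
  rw [e1, e2, scatZ_eq_trinom A t (show m + 1 + n = 2 * d by lia)]
  have e3 : 2 * (((m : ℤ) : Fibre A t) + 1) = ((2 * (m + 1) : ℕ) : Fibre A t) := by
    push_cast; ring
  rw [e3, natCast_mul_eq_smul (R := Fibre A t), smul_smul, smul_smul,
    Nat.factorial_succ m, Nat.factorial_succ n]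
  congr 1
  push_cast
  ring

/-- The identity `mul_mul_trinom_succ_succ` at `u ^ (m + 2)`, divided by `(m + 2) (m + 1)`:
multiplication by `X` reaches only the representations of degree `d + 1` and `d - 1`. -/
theorem coX_mul_scatZ {m n d : ℕ} (h : m + n = 2 * d) :
    coX A t * scatZ A t m n = scatZ A t (m + 2) n -
      ((n * (n - 1) : ℂ) / ((2 * d + 1) * (2 * d - 1))) • (tau A t * scatZ A t m (n - 2)) := by
  have e2 : (m : ℤ) + 2 = (m + 2 : ℕ) := by push_cast; ring
  have F : ∀ k : ℕ, (k.factorial : ℂ) ≠ 0 := fun k => Nat.cast_ne_zero.2 (Nat.factorial_ne_zero k)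
  rw [e2, scatZ_eq_trinom A t h, scatZ_eq_trinom A t (show m + 2 + n = 2 * (d + 1) by lia)]
  -- The recursion involves the powers `d - 1`, `d`, `d + 1` of the quadratic, so `d = 0`, where `n
  -- (n - 1) = 0`, is treated apart.
  rcases d with _ | d
  · obtain ⟨rfl, rfl⟩ : m = 0 ∧ n = 0 := by lia
    simp [trinom_succ, trinom_zero]
  have h2 := mul_mul_trinom_succ_succ _ _ _ (coZ_sq A t) d (m + 2)
  have e3 : (m : ℤ) + 2 - 2 = m := by ring
  have e4 : (((m : ℤ) + 2 : ℤ) : Fibre A t) * (((m : ℤ) + 2 : ℤ) - 1) = (((m + 2) * (m + 1) : ℕ) : Fibre A t) := by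
    push_cast; ring
  have e5 : 2 * ((d : Fibre A t) + 2) * (2 * d + 3) = ((2 * (d + 2) * (2 * d + 3) : ℕ) : Fibre A t) := by
    push_cast; ring
  have e6 : 4 * ((d : Fibre A t) + 2) * (d + 1) = ((4 * (d + 2) * (d + 1) : ℕ) : Fibre A t) := by
    push_cast; ring
  rw [e3, e4, e5, e6, mul_assoc (Nat.cast _), mul_assoc (Nat.cast _), natCast_mul_eq_smul (R := Fibre A t),
    natCast_mul_eq_smul (R := Fibre A t), natCast_mul_eq_smul (R := Fibre A t)] at h2
  have hm : (((m + 2) * (m + 1) : ℕ) : ℂ) ≠ 0 := by rw [Nat.cast_ne_zero]; positivity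
  have h3 := congrArg (fun v => ((((m + 2) * (m + 1) : ℕ) : ℂ))⁻¹ • v) h2
  simp only [smul_smul, inv_mul_cancel₀ hm, one_smul, smul_add] at h3
  have e7 : ((m + 2 : ℕ) : ℤ) = (m : ℤ) + 2 := by push_cast; ring
  have f1 : ((2 * (d + 1)).factorial : ℂ) = (2 * d + 2) * (2 * d + 1) * (2 * d).factorial := by
    rw [show 2 * (d + 1) = 2 * d + 1 + 1 by ring, Nat.factorial_succ, Nat.factorial_succ]
    push_cast; ring
  have f2 : ((2 * (d + 1 + 1)).factorial : ℂ) =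
      (2 * d + 4) * (2 * d + 3) * (2 * d + 2) * (2 * d + 1) * (2 * d).factorial := by
    rw [show 2 * (d + 1 + 1) = 2 * (d + 1) + 1 + 1 by ring, Nat.factorial_succ, Nat.factorial_succ]
    push_cast; rw [f1]; ring
  have f3 : ((m + 2).factorial : ℂ) = (m + 2) * (m + 1) * m.factorial := by
    rw [Nat.factorial_succ, Nat.factorial_succ]
    push_cast; ring
  rw [e7, h3, mul_smul_comm, f1, f2, f3]
  have hd : ∀ k : ℕ, (2 * (d : ℂ) + (k + 1)) ≠ 0 := fun k => by
    have : ((2 * d + (k + 1) : ℕ) : ℂ) ≠ 0 := by rw [Nat.cast_ne_zero]; lia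
    push_cast at this; exact this
  have h1 : 2 * (d : ℂ) + 1 ≠ 0 := by simpa using hd 0
  have h2' : 2 * (d : ℂ) + 2 ≠ 0 := by convert hd 1 using 2; norm_num
  have h3' : 2 * (d : ℂ) + 3 ≠ 0 := by convert hd 2 using 2; norm_num
  have h4 : 2 * (d : ℂ) + 4 ≠ 0 := by convert hd 3 using 2; norm_num
  have F1 := F m
  have F2 := F n
  have F3 := F (2 * d)
  have G1 : (m : ℂ) + 1 ≠ 0 := by exact_mod_cast (Nat.succ_ne_zero m)
  have G2 : (m : ℂ) + 2 ≠ 0 := by exact_mod_cast (Nat.succ_ne_zero (m + 1))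
  have K0 : 2 * ((d + 1 : ℕ) : ℂ) - 1 = 2 * d + 1 := by push_cast; ring
  have K1 : 2 * ((d + 1 : ℕ) : ℂ) + 1 = 2 * d + 3 := by push_cast; ring
  have K2 : (d : ℂ) + 2 = (2 * d + 4) / 2 := by ring
  have K3 : (d : ℂ) + 1 = (2 * d + 2) / 2 := by ring
  rw [K0, K1]
  push_cast
  rw [K2, K3]
  -- For `n < 2` the exponent `m` exceeds the degree `2 d` of the lower power, so the term with the
  -- parameter is absent on both sides.
  by_cases hn : n < 2
  · rw [trinom_eq_zero_of_lt _ _ _ d m (by lia), scatZ_of_neg A t (Or.inr (by lia))]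
    simp only [mul_zero, smul_zero, add_zero, sub_zero, smul_smul]
    congr 1
    field_simp
  · obtain ⟨n, rfl⟩ : ∃ k, n = k + 2 := ⟨n - 2, by lia⟩
    have e8 : ((n + 2 : ℕ) : ℤ) - 2 = n := by push_cast; ring
    have f4 : ((n + 2).factorial : ℂ) = (n + 2) * (n + 1) * n.factorial := by
      rw [Nat.factorial_succ, Nat.factorial_succ]
      push_cast; ring
    have F4 := F n
    rw [e8, scatZ_eq_trinom A t (show m + n = 2 * d by lia), mul_smul_comm, f4]
    push_cast
    match_scalars <;> field_simp
    ring

end Scattering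

/-! ### Pochhammer symbols -/

section Pochhammer

theorem fall_zero (a : ℂ) : fall a 0 = 1 := by simp [fall]

theorem fall_succ (a : ℂ) (l : ℕ) : fall a (l + 1) = fall a l * (a - l) := by
  rw [fall, descPochhammer_succ_eval, fall]

theorem fall_succ_left (a : ℂ) (l : ℕ) : fall a (l + 1) = a * fall (a - 1) l := by
  simp [fall, descPochhammer_succ_left]

theorem fall_natCast (n l : ℕ) : fall n l = n.descFactorial l :=
  descPochhammer_eval_eq_descFactorial ℂ n l

theorem fall_eq_zero {n l : ℕ} (h : n < l) : fall n l = 0 := by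
  rw [fall_natCast, Nat.descFactorial_eq_zero_iff_lt.2 h, Nat.cast_zero]

theorem fall_natCast_ne_zero {n l : ℕ} (h : l ≤ n) : fall n l ≠ 0 := by
  rw [fall_natCast, Nat.cast_ne_zero, Ne, Nat.descFactorial_eq_zero_iff_lt]
  lia

theorem fall_self (n : ℕ) : fall n n = n.factorial := by
  rw [fall_natCast, Nat.descFactorial_self]

/-- The denominators of `ψ` and of the expansion coefficients are falling factorials at
half-integers; twice each factor is an odd integer, so none vanishes. -/
theorem ne_zero_of_half {a : ℂ} (z : ℤ) (h : 2 * a = 2 * z + 1) : a ≠ 0 := by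
  rintro rfl
  have : ((2 * z + 1 : ℤ) : ℂ) = 0 := by push_cast; rw [← h, mul_zero]
  rw [Int.cast_eq_zero] at this
  lia

theorem fall_ne_zero_of_half {a : ℂ} (z : ℤ) (h : 2 * a = 2 * z + 1) (l : ℕ) : fall a l ≠ 0 := by
  induction l with
  | zero => simp [fall_zero]
  | succ l ih =>
    rw [fall_succ]
    exact mul_ne_zero ih (ne_zero_of_half (z - l) (by push_cast; linear_combination h))

/-- Duplication: even and odd factors of the product are separated. It converts the integer
factorials in `R` and `C₀`, `C₁` into the half-integer ones in `ψ`. -/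
theorem fall_two_mul (a : ℂ) (l : ℕ) :
    fall (2 * a) (2 * l) = 4 ^ l * fall a l * fall (a - 1 / 2) l := by
  induction l with
  | zero => simp [fall_zero]
  | succ l ih =>
    rw [show 2 * (l + 1) = 2 * l + 1 + 1 by ring, fall_succ, fall_succ, ih, fall_succ, fall_succ,
      pow_succ]
    push_cast
    ring

end Pochhammer

/-! ### Expansion of `X ^ k W[m, n]` in scattering generators. -/

section PowerExpansion

/-- The coefficients of the expansion of `X ^ k W[m, n]`, `m + n = 2 e`, in scattering
generators. -/
noncomputable def coefPow (k n e l : ℕ) : ℂ :=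
  (-1) ^ l * (fall k l * fall n (2 * l)) /
    (4 ^ l * l.factorial * fall (e - 1 / 2) l * fall (k + e + 1 / 2 - l) l)

theorem coefPow_zero (k n e : ℕ) : coefPow k n e 0 = 1 := by simp [coefPow, fall_zero]

theorem coefPow_eq_zero {k n e l : ℕ} (h : k < l) : coefPow k n e l = 0 := by
  simp [coefPow, fall_eq_zero h]

/-- The Pascal-type recursion obtained by multiplying the expansion of `X ^ k W[m, n]` by `X` once
more; the closed form `coefPow` solves it. All half-integers are expressed through `u = k + e + 1/2
- l`, after which the claim is rational arithmetic. -/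
theorem coefPow_succ_succ (k n e l : ℕ) : coefPow (k + 1) n e (l + 1) = coefPow k n e (l + 1) -
    coefPow k n e l * (((n : ℂ) - 2 * l) * (n - 2 * l - 1) /
      ((2 * ((e : ℂ) + k - 2 * l) + 1) * (2 * ((e : ℂ) + k - 2 * l) - 1))) := by
  have H1 := fall_ne_zero_of_half (a := (e : ℂ) - 1 / 2) (e - 1) (by push_cast; ring) l
  have H2 := ne_zero_of_half (a := (e : ℂ) - 1 / 2 - l) (e - l - 1) (by push_cast; ring)
  set u : ℂ := k + e + 1 / 2 - l with hu
  have H3 := fall_ne_zero_of_half (a := u) (k + e - l) (by push_cast; rw [hu]; ring) l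
  have H4 := ne_zero_of_half (a := u - l) (k + e - l - l) (by push_cast; rw [hu]; ring)
  have H5 := ne_zero_of_half (a := u - l - 1) (k + e - l - l - 1) (by push_cast; rw [hu]; ring)
  have H6 := ne_zero_of_half (a := u) (k + e - l) (by push_cast; rw [hu]; ring)
  have e1 : 2 * ((e : ℂ) + k - 2 * l) + 1 = 2 * (u - l) := by rw [hu]; ring
  have e2 : 2 * ((e : ℂ) + k - 2 * l) - 1 = 2 * (u - l - 1) := by rw [hu]; ring
  have e3 : ((k + 1 : ℕ) : ℂ) + e + 1 / 2 - (l + 1 : ℕ) = u := by rw [hu]; push_cast; ring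
  have e4 : (k : ℂ) + e + 1 / 2 - (l + 1 : ℕ) = u - 1 := by rw [hu]; push_cast; ring
  have e5 : fall (u - 1) (l + 1) = fall u l * (u - l) * (u - l - 1) / u := by
    rw [eq_div_iff H6, mul_comm, ← fall_succ_left, fall_succ, fall_succ]
    push_cast; ring
  have e6 : fall ((k + 1 : ℕ) : ℂ) (l + 1) = (k + 1) * fall k l := by
    rw [fall_succ_left]; push_cast; ring_nf
  have hl : (l.factorial : ℂ) ≠ 0 := Nat.cast_ne_zero.2 (Nat.factorial_ne_zero l)
  have hl1 : (l : ℂ) + 1 ≠ 0 := by exact_mod_cast Nat.succ_ne_zero l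
  have e7 : (e : ℂ) = u - 1 / 2 - k + l := by rw [hu]; ring
  simp only [coefPow]
  rw [e1, e2, e3, e4, e5, e6, fall_succ u, fall_succ (k : ℂ), fall_succ ((e : ℂ) - 1 / 2),
    Nat.factorial_succ, show 2 * (l + 1) = 2 * l + 1 + 1 by ring, fall_succ (n : ℂ),
    fall_succ (n : ℂ), ← hu, pow_succ, pow_succ]
  have e8 : (2 : ℂ) * ((e : ℂ) - 1 / 2 - l) = 2 * (u - k - 1) := by rw [e7]; ring
  have e9 : (e : ℂ) - 1 / 2 - l = u - k - 1 := by rw [e7]; ring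
  rw [e9] at H2 ⊢
  generalize fall ((e : ℂ) - 1 / 2) l = E at *
  generalize fall u l = U at *
  generalize fall (k : ℂ) l = K at *
  generalize fall (n : ℂ) (2 * l) = N at *
  push_cast
  have h4 : (4 : ℂ) ^ l ≠ 0 := pow_ne_zero _ (by norm_num)
  clear_value u
  field_simp
  ring

variable (A : Type*) [CommRing A] [Algebra ℂ A] (t : A)

/-- For negative `n` every term vanishes, so the sums below can be manipulated without tracking when
the second label becomes negative. -/
theorem coX_mul_scatZ' {m : ℕ} {n d : ℤ} (h : m + n = 2 * d) :
    coX A t * scatZ A t m n = scatZ A t (m + 2) n -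
      ((n * (n - 1) : ℂ) / ((2 * d + 1) * (2 * d - 1))) • (tau A t * scatZ A t m (n - 2)) := by
  rcases lt_or_ge n 0 with hn | hn
  · rw [scatZ_of_neg A t (Or.inr hn), scatZ_of_neg A t (Or.inr hn),
      scatZ_of_neg A t (Or.inr (by lia))]
    simp
  · lift n to ℕ using hn
    lift d to ℕ using by lia
    exact coX_mul_scatZ A t (by exact_mod_cast h)

theorem coX_pow_mul_scatZ {m n e : ℕ} (h : m + n = 2 * e) (k : ℕ) :
    coX A t ^ k * scatZ A t m n = ∑ l ∈ Finset.range (k + 1),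
      coefPow k n e l • (tau A t ^ l * scatZ A t (m + 2 * k - 2 * l) (n - 2 * l)) := by
  induction k with
  | zero => simp [coefPow_zero]
  | succ k ih =>
    rw [pow_succ', mul_assoc, ih, Finset.mul_sum]
    have key : ∀ l ∈ Finset.range (k + 1), coX A t *
        coefPow k n e l • (tau A t ^ l * scatZ A t (m + 2 * k - 2 * l) (n - 2 * l)) =
        coefPow k n e l •
          (tau A t ^ l * scatZ A t (m + 2 * (k + 1 : ℕ) - 2 * l) (n - 2 * l)) +
        (-(coefPow k n e l * (((n : ℂ) - 2 * l) * (n - 2 * l - 1) /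
          ((2 * ((e : ℂ) + k - 2 * l) + 1) * (2 * ((e : ℂ) + k - 2 * l) - 1))))) •
          (tau A t ^ (l + 1) *
            scatZ A t (m + 2 * (k + 1 : ℕ) - 2 * (l + 1 : ℕ)) (n - 2 * (l + 1 : ℕ))) := by
      intro l hl
      have hl' : l ≤ k := by simpa [Nat.lt_succ_iff] using hl
      have h1 := coX_mul_scatZ' A t (m := m + 2 * k - 2 * l) (n := n - 2 * l)
        (d := e + k - 2 * l) (by lia)
      have c1 : ((m + 2 * k - 2 * l : ℕ) : ℤ) = m + 2 * k - 2 * l := by lia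
      rw [c1] at h1
      have c2 : (m : ℤ) + 2 * k - 2 * l + 2 = m + 2 * (k + 1 : ℕ) - 2 * l := by push_cast; ring
      have c3 : (m : ℤ) + 2 * k - 2 * l = m + 2 * (k + 1 : ℕ) - 2 * (l + 1 : ℕ) := by
        push_cast; ring
      have c4 : (n : ℤ) - 2 * l - 2 = n - 2 * (l + 1 : ℕ) := by push_cast; ring
      rw [mul_smul_comm, mul_left_comm, h1, c2, c4, c3, mul_sub, smul_sub, mul_smul_comm, smul_smul,
        neg_smul, pow_succ, mul_assoc, ← sub_eq_add_neg]
      push_cast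
      rfl
    rw [Finset.sum_congr rfl key, Finset.sum_add_distrib]
    -- Both sums must have range `k + 2` to be merged; the term added has coefficient `coefPow k n e
    -- (k + 1) = 0`.
    have ext : ∀ f : ℕ → Fibre A t, f (k + 1) = 0 →
        ∑ l ∈ Finset.range (k + 1), f l = ∑ l ∈ Finset.range (k + 1 + 1), f l := fun f hf => by
      rw [Finset.sum_range_succ f (k + 1), hf, add_zero]
    rw [ext (fun l => coefPow k n e l •
      (tau A t ^ l * scatZ A t (m + 2 * (k + 1 : ℕ) - 2 * l) (n - 2 * l)))
      (by simp [coefPow_eq_zero (Nat.lt_succ_self k)]), Finset.sum_range_succ',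
      Finset.sum_range_succ' _ (k + 1), add_right_comm, ← Finset.sum_add_distrib, coefPow_zero,
      coefPow_zero]
    congr 1
    refine Finset.sum_congr rfl fun l _ => ?_
    rw [← add_smul, coefPow_succ_succ]
    congr 1

end PowerExpansion

/-! ### The Poisson brackets of the scattering generators -/

section Main

/-- The summands of `coefR`. -/
noncomputable def coefRTerm (l p q r s k : ℕ) : ℂ :=
  (-1) ^ k * l.choose k * fall p (l - k) * fall q k * fall r k * fall s (l - k)

theorem coefR_eq (l p q r s : ℕ) : coefR l p q r s =
    1 / l.factorial * ∑ k ∈ Finset.range (l + 1), coefRTerm l p q r s k := rfl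

/-- A summand survives only if `k ≤ q` and `l - k ≤ p`, hence `l ≤ p + q`. The two variants below
pair other factors in the same way and match the labels that become negative. -/
theorem coefR_eq_zero_of_lt_left {l p q : ℕ} (r s : ℕ) (h : p + q < l) :
    coefR l p q r s = 0 := by
  rw [coefR_eq, Finset.sum_eq_zero, mul_zero]
  intro k _
  rcases lt_or_ge q k with hk | hk
  · simp [coefRTerm, fall_eq_zero hk]
  · simp [coefRTerm, fall_eq_zero (show p < l - k by lia)]

theorem coefR_eq_zero_of_lt_fst {l p r : ℕ} (q s : ℕ) (h : p + r < l) :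
    coefR l p q r s = 0 := by
  rw [coefR_eq, Finset.sum_eq_zero, mul_zero]
  intro k _
  rcases lt_or_ge r k with hk | hk
  · simp [coefRTerm, fall_eq_zero hk]
  · simp [coefRTerm, fall_eq_zero (show p < l - k by lia)]

theorem coefR_eq_zero_of_lt_snd {l q s : ℕ} (p r : ℕ) (h : q + s < l) :
    coefR l p q r s = 0 := by
  rw [coefR_eq, Finset.sum_eq_zero, mul_zero]
  intro k _
  rcases lt_or_ge q k with hk | hk
  · simp [coefRTerm, fall_eq_zero hk]
  · simp [coefRTerm, fall_eq_zero (show s < l - k by lia)]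

theorem coefR_highest (l p r s : ℕ) :
    coefR l p 0 r s = 1 / l.factorial * (fall p l * fall s l) := by
  rw [coefR_eq, Finset.sum_range_succ', Finset.sum_eq_zero]
  · simp [coefRTerm, fall_zero]
  · intro k _
    rw [coefRTerm, fall_eq_zero (n := 0) (Nat.succ_pos k)]
    ring

theorem mul_fall_pred (p l : ℕ) : (p : ℂ) * fall ((p - 1 : ℕ) : ℂ) l = fall p l * (p - l) := by
  rcases p with _ | p
  · rcases l with _ | l
    · simp [fall_zero]
    · rw [fall_eq_zero (n := 0) (Nat.succ_pos l)]
      simp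
  · rw [← fall_succ, fall_succ_left]
    push_cast
    simp

theorem fall_add_one (q k : ℕ) :
    fall ((q + 1 : ℕ) : ℂ) k = fall q k + k * fall q (k - 1) := by
  rcases k with _ | k
  · simp [fall_zero]
  · rw [fall_succ_left, fall_succ]
    push_cast
    simp only [add_sub_cancel_right]
    ring

/-- `R_l` is the coefficient with which the transvectant `(∂_a ∂_b' - ∂_b ∂_a')^l / l!` sends `a^p
b^q a'^r b'^s` to `a^(p+r-l) b^(q+s-l)` after setting `a' = a`, `b' = b`. The transvectant commutes
with the lowering operator `b ∂_a + b' ∂_a'`. The truncated `p - 1` and `r - 1` are harmless because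
of the factors `p` and `r`. -/
theorem coefR_covariance (l p q r s : ℕ) :
    (p : ℂ) * coefR l (p - 1) (q + 1) r s + r * coefR l p q (r - 1) (s + 1) =
      (p + r - l) * coefR l p q r s := by
  have a1 : ∀ k ∈ Finset.range (l + 1), (p : ℂ) * coefRTerm l (p - 1) (q + 1) r s k =
      (p - (l - k)) * coefRTerm l p q r s k + (-1) ^ k * (l.choose k * k) * fall p (l - k) *
        (p - (l - k)) * fall q (k - 1) * fall r k * fall s (l - k) := by
    intro k hk
    have hk' : k ≤ l := by simpa [Nat.lt_succ_iff] using hk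
    have h := mul_fall_pred p (l - k)
    rw [Nat.cast_sub hk'] at h
    rw [coefRTerm, coefRTerm, fall_add_one]
    linear_combination (-1) ^ k * l.choose k * (fall q k + k * fall q (k - 1)) * fall r k *
      fall s (l - k) * h
  have a2 : ∀ k ∈ Finset.range (l + 1), (r : ℂ) * coefRTerm l p q (r - 1) (s + 1) k =
      (r - k) * coefRTerm l p q r s k + (-1) ^ k * (l.choose k * (l - k)) * fall p (l - k) *
        fall q k * (fall r k * (r - k)) * fall s (l - k - 1) := by
    intro k hk
    have hk' : k ≤ l := by simpa [Nat.lt_succ_iff] using hk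
    have h := mul_fall_pred r k
    rw [coefRTerm, coefRTerm, fall_add_one, Nat.cast_sub hk']
    linear_combination (-1) ^ k * l.choose k * fall p (l - k) * fall q k *
      (fall s (l - k) + (l - k) * fall s (l - k - 1)) * h
  -- The leftover terms cancel after the shift `k ↦ k + 1` in the first sum, by `(k + 1) choose(l, k
  -- + 1) = (l - k) choose(l, k)`.
  have a3 : ∑ k ∈ Finset.range (l + 1), (-1 : ℂ) ^ k * (l.choose k * k) * fall p (l - k) *
        (p - (l - k)) * fall q (k - 1) * fall r k * fall s (l - k) +
      ∑ k ∈ Finset.range (l + 1), (-1 : ℂ) ^ k * (l.choose k * (l - k)) * fall p (l - k) *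
        fall q k * (fall r k * (r - k)) * fall s (l - k - 1) = 0 := by
    rw [Finset.sum_range_succ', Finset.sum_range_succ]
    simp only [Nat.cast_zero, mul_zero, zero_mul, add_zero, sub_self]
    rw [← Finset.sum_add_distrib, Finset.sum_eq_zero]
    intro k hk
    have hk' : k < l := by simpa using hk
    obtain ⟨j, rfl⟩ : ∃ j, l = k + j + 1 := ⟨l - k - 1, by lia⟩
    have c := Nat.choose_succ_right_eq (k + j + 1) k
    have c' : (((k + j + 1).choose (k + 1) : ℕ) : ℂ) * (k + 1) =
        (k + j + 1).choose k * (j + 1) := by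
      have : k + j + 1 - k = j + 1 := by lia
      rw [this] at c
      exact_mod_cast c
    have e1 : k + j + 1 - (k + 1) = j := by lia
    have e2 : k + j + 1 - k = j + 1 := by lia
    have e3 : k + j + 1 - k - 1 = j := by lia
    rw [e1, e3, e2, fall_succ (p : ℂ), fall_succ (r : ℂ), Nat.add_sub_cancel]
    push_cast
    rw [c', pow_succ]
    ring
  simp only [coefR_eq]
  have a4 : (p : ℂ) * ∑ k ∈ Finset.range (l + 1), coefRTerm l (p - 1) (q + 1) r s k +
      r * ∑ k ∈ Finset.range (l + 1), coefRTerm l p q (r - 1) (s + 1) k =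
      (p + r - l) * ∑ k ∈ Finset.range (l + 1), coefRTerm l p q r s k := by
    rw [Finset.mul_sum, Finset.mul_sum, Finset.sum_congr rfl a1, Finset.sum_congr rfl a2,
      Finset.sum_add_distrib, Finset.sum_add_distrib, Finset.mul_sum]
    have a5 : ∑ k ∈ Finset.range (l + 1), ((p : ℂ) - (l - k)) * coefRTerm l p q r s k +
        ∑ k ∈ Finset.range (l + 1), ((r : ℂ) - k) * coefRTerm l p q r s k =
        ∑ k ∈ Finset.range (l + 1), ((p : ℂ) + r - l) * coefRTerm l p q r s k := by
      rw [← Finset.sum_add_distrib]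
      exact Finset.sum_congr rfl fun k _ => by ring
    linear_combination a3 + a5
  linear_combination (1 / (l.factorial : ℂ)) * a4

/-- The structure constants of the scattering generators with `p + q = 2 d`, `r + s = 2 e`, up to
a power of the parameter. -/
noncomputable def coefBracket (l p q r s d e : ℕ) : ℂ :=
  4 ^ l * coefR (2 * l + 1) p q r s * psiOdd l d e

/-- With second label zero only the summand `k = 0` of `R` remains. Then `(2 l + 1)! = 4^l [l +
1/2]_l l!` cancels the numerator of `ψ`, and `[2 k + 1]_(2l) = 4^l [k + 1/2]_l [k]_l` cancels one of
its denominators. -/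
theorem coefBracket_highest (l k n r e : ℕ) : coefBracket l (2 * (k + 1)) 0 r (n + 1) (k + 1) e =
    2 * (k + 1) * (n + 1) * coefPow k n e l := by
  have hR : coefR (2 * l + 1) (2 * (k + 1)) 0 r (n + 1) =
      (2 * (k + 1)) * (n + 1) * (4 ^ l * fall k l * fall (k + 1 / 2) l) * fall n (2 * l) /
        (4 ^ l * fall (l + 1 / 2) l * l.factorial) := by
    rw [coefR_highest, fall_succ_left, fall_succ_left]
    have e1 : ((2 * (k + 1) : ℕ) : ℂ) - 1 = 2 * (k + 1 / 2) := by push_cast; ring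
    have e2 : ((n + 1 : ℕ) : ℂ) - 1 = n := by push_cast; ring
    have e3 : (((2 * l + 1).factorial : ℕ) : ℂ) = 4 ^ l * fall (l + 1 / 2) l * l.factorial := by
      rw [← fall_self, fall_succ, ← fall_self l]
      have e4 : ((2 * l + 1 : ℕ) : ℂ) = 2 * (l + 1 / 2) := by push_cast; ring
      rw [e4, fall_two_mul]
      push_cast
      ring_nf
    have e5 : (k : ℂ) + 1 / 2 - 1 / 2 = k := by ring
    rw [e1, e2, e3, fall_two_mul, e5]
    push_cast
    ring
  rw [coefBracket, hR, psiOdd, coefPow]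
  have e1 : ((k + 1 : ℕ) : ℂ) - 1 / 2 = k + 1 / 2 := by push_cast; ring
  have e2 : ((k + 1 : ℕ) : ℂ) + e - 1 / 2 - l = k + e + 1 / 2 - l := by push_cast; ring
  rw [e1, e2]
  have H1 := fall_ne_zero_of_half (a := (k : ℂ) + 1 / 2) k (by push_cast; ring) l
  have H2 := fall_ne_zero_of_half (a := (l : ℂ) + 1 / 2) l (by push_cast; ring) l
  have H3 := fall_ne_zero_of_half (a := (e : ℂ) - 1 / 2) (e - 1) (by push_cast; ring) l
  have H4 := fall_ne_zero_of_half (a := (k : ℂ) + e + 1 / 2 - l) (k + e - l) (by push_cast; ring) l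
  have hl : (l.factorial : ℂ) ≠ 0 := Nat.cast_ne_zero.2 (Nat.factorial_ne_zero l)
  have h4 : (4 : ℂ) ^ l ≠ 0 := pow_ne_zero _ (by norm_num)
  have h5 : (4 : ℂ) ^ (2 * l) = 4 ^ l * 4 ^ l := by ring
  rw [h5]
  generalize fall ((k : ℂ) + 1 / 2) l = a at *
  generalize fall ((l : ℂ) + 1 / 2) l = b at *
  generalize fall ((e : ℂ) - 1 / 2) l = c at *
  generalize fall ((k : ℂ) + e + 1 / 2 - l) l = f at *
  field_simp

theorem coefBracket_covariance (l p q r s d e : ℕ) :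
    ((p + 1 : ℕ) : ℂ) * coefBracket l p (q + 1) r s d e +
        r * coefBracket l (p + 1) q (r - 1) (s + 1) d e =
      (p + r - 2 * l) * coefBracket l (p + 1) q r s d e := by
  have h := coefR_covariance (2 * l + 1) (p + 1) q r s
  rw [Nat.add_sub_cancel] at h
  simp only [coefBracket]
  push_cast at h ⊢
  linear_combination 4 ^ l * psiOdd l d e * h

variable (A : Type*) [CommRing A] [Algebra ℂ A] (t : A)

theorem scatZ_highest (d : ℕ) : scatZ A t (2 * d : ℕ) 0 = coX A t ^ d := by
  have : scatZ A t (2 * d : ℕ) (0 : ℕ) = coX A t ^ d := by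
    rw [scatZ_natCast, scatteringGen]
    have h : ∀ k : ℕ, (k.factorial : ℂ) ≠ 0 := fun k => Nat.cast_ne_zero.2 (Nat.factorial_ne_zero k)
    simp [h]
  simpa using this

theorem fibreBracket_pow_left (k : ℕ) (x y : Fibre A t) :
    fibreBracket A t (x ^ (k + 1)) y = ((k + 1 : ℕ) : ℂ) • (x ^ k * fibreBracket A t x y) := by
  rw [fibreBracket_neg_swap, ← hamiltonian_apply, Derivation.leibniz_pow, hamiltonian_apply,
    fibreBracket_neg_swap A t y x, Nat.cast_smul_eq_nsmul]
  simp only [Nat.add_sub_cancel, smul_eq_mul, nsmul_eq_mul]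
  ring

/-- The base case `W[2 d, 0] = X ^ d`. By the Leibniz rule `{X ^ (k + 1), W[r, s]} = 2 (k + 1) s X ^
k W[r + 1, s - 1]`, which is expanded by `coX_pow_mul_scatZ`. -/
theorem fibreBracket_scatZ_highest {r s e : ℕ} (d : ℕ) (h : r + s = 2 * e) :
    fibreBracket A t (scatZ A t (2 * d : ℕ) 0) (scatZ A t r s) =
      ∑ l ∈ Finset.range (2 * d + 0 + 1), coefBracket l (2 * d) 0 r s d e •
        (tau A t ^ l * scatZ A t ((2 * d : ℕ) + r - 2 * l - 1) ((0 : ℕ) + s - 2 * l - 1)) := by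
  rw [scatZ_highest]
  rcases d with _ | k
  · rw [Finset.sum_eq_zero]
    · rw [pow_zero, fibreBracket_neg_swap, ← hamiltonian_apply, Derivation.map_one_eq_zero, neg_zero]
    · intro l _
      rw [coefBracket, coefR_eq_zero_of_lt_left _ _ (by lia)]
      simp
  rw [fibreBracket_pow_left, fibreBracket_coX_scatZ A t h]
  rcases s with _ | n
  · rw [Finset.sum_eq_zero]
    · simp
    · intro l _
      rw [coefBracket, coefR_highest, fall_eq_zero (n := 0) (Nat.succ_pos _)]
      simp
  have e1 : ((n + 1 : ℕ) : ℤ) - 1 = n := by push_cast; ring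
  have e2 : (r : ℤ) + 1 = (r + 1 : ℕ) := by push_cast; ring
  rw [e1, e2, mul_smul_comm, smul_smul, coX_pow_mul_scatZ A t (show r + 1 + n = 2 * e by lia),
    Finset.smul_sum]
  -- The ranges differ: the expansion of `X ^ k` stops at `l = k`, the stated sum at the cruder
  -- bound, where `coefPow` vanishes.
  refine Finset.sum_congr_of_eq_on_inter ?_ ?_ ?_
  · intro l hl hl'
    simp at hl hl'
    lia
  · intro l hl hl'
    have : k < l := by simpa using hl'
    rw [coefBracket_highest, coefPow_eq_zero this]
    simp
  · intro l _ _
    rw [coefBracket_highest, smul_smul]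
    congr 1
    · push_cast; ring
    · congr 2 <;> (push_cast; ring)

theorem fibreBracket_coY_scatZ_coefBracket {p q r s d e : ℕ} (h1 : p + 1 + q = 2 * d)
    (h2 : r + s = 2 * e) (l : ℕ) : fibreBracket A t (coY A t) (coefBracket l (p + 1) q r s d e •
      (tau A t ^ l * scatZ A t ((p + 1 : ℕ) + r - 2 * l - 1) (q + s - 2 * l - 1))) =
      (-2 * (p + r - 2 * l) * coefBracket l (p + 1) q r s d e) •
        (tau A t ^ l * scatZ A t (p + r - 2 * l - 1) ((q + 1 : ℕ) + s - 2 * l - 1)) := by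
  by_cases hc : 2 * l + 1 ≤ p + 1 + r ∧ 2 * l + 1 ≤ q + s
  · obtain ⟨a, ha⟩ : ∃ a : ℕ, ((p + 1 : ℕ) : ℤ) + r - 2 * l - 1 = a :=
      ⟨p + 1 + r - 2 * l - 1, by lia⟩
    obtain ⟨b, hb⟩ : ∃ b : ℕ, (q : ℤ) + s - 2 * l - 1 = b := ⟨q + s - 2 * l - 1, by lia⟩
    rw [map_smul, ← map_pow, ← Algebra.smul_def, fibreBracket_smul_right, ha, hb,
      fibreBracket_coY_scatZ A t (show a + b = 2 * (d + e - 2 * l - 1) by lia), smul_comm _ (-2 * _ : ℂ),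
      smul_smul, ← Algebra.smul_def]
    have c1 : (p : ℤ) + r - 2 * l - 1 = a - 1 := by lia
    have c2 : ((q + 1 : ℕ) : ℤ) + s - 2 * l - 1 = b + 1 := by lia
    have c3 : (a : ℂ) = p + r - 2 * l := by
      have : (a : ℤ) = p + r - 2 * l := by lia
      exact_mod_cast congrArg (Int.cast : ℤ → ℂ) this
    rw [c1, c2, c3]
    congr 1
    ring
  -- The vanishing must come from the coefficient: for `q + s = 2 l` the generator on the left has
  -- second label `-1`, but the one on the right has second label `0` and need not vanish.
  · have : coefBracket l (p + 1) q r s d e = 0 := by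
      rw [coefBracket]
      by_cases h : 2 * l + 1 ≤ p + 1 + r
      · rw [coefR_eq_zero_of_lt_snd _ _ (by lia)]; simp
      · rw [coefR_eq_zero_of_lt_fst _ _ (by lia)]; simp
    simp [this]

/-- The Poisson brackets of the scattering generators. -/
theorem fibreBracket_scatZ {p q r s d e : ℕ} (h1 : p + q = 2 * d) (h2 : r + s = 2 * e) :
    fibreBracket A t (scatZ A t p q) (scatZ A t r s) =
      ∑ l ∈ Finset.range (p + q + 1), coefBracket l p q r s d e •
        (tau A t ^ l * scatZ A t (p + r - 2 * l - 1) (q + s - 2 * l - 1)) := by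
  -- Descent along the weights: `ad Y` sends `W[p + 1, q]` to `-2 (p + 1) W[p, q + 1]`, so the
  -- Jacobi identity for `Y` expresses the bracket with `W[p, q + 1]` through brackets with `W[p +
  -- 1, q]`, and `p + 1` is invertible.
  induction q generalizing p r s with
  | zero =>
    obtain rfl : p = 2 * d := by lia
    exact fibreBracket_scatZ_highest A t d h2
  | succ q ih =>
    have e1 : (((p + 1 : ℕ) : ℤ)) - 1 = p := by push_cast; ring
    have e2 : (q : ℤ) + 1 = (q + 1 : ℕ) := by push_cast; ring
    have hY := fibreBracket_coY_scatZ A t (show p + 1 + q = 2 * d by lia)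
    rw [e1, e2] at hY
    have hY' := fibreBracket_coY_scatZ A t h2
    have hI := ih (show p + 1 + q = 2 * d by lia) h2
    have hr : (-2 * r : ℂ) • fibreBracket A t (scatZ A t (p + 1 : ℕ) q) (scatZ A t (r - 1) (s + 1)) =
        ∑ l ∈ Finset.range (p + (q + 1) + 1),
          (-2 * r * coefBracket l (p + 1) q (r - 1) (s + 1) d e) •
          (tau A t ^ l * scatZ A t (p + r - 2 * l - 1) ((q + 1 : ℕ) + s - 2 * l - 1)) := by
      rcases r with _ | r
      · simp
      · have e3 : (((r + 1 : ℕ) : ℤ)) - 1 = r := by push_cast; ring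
        have e4 : (s : ℤ) + 1 = (s + 1 : ℕ) := by push_cast; ring
        rw [e3, e4, ih (show p + 1 + q = 2 * d by lia) (show r + (s + 1) = 2 * e by lia),
          Finset.smul_sum, show p + 1 + q + 1 = p + (q + 1) + 1 by ring]
        refine Finset.sum_congr rfl fun l _ => ?_
        rw [smul_smul, Nat.add_sub_cancel]
        congr 3 <;> (push_cast; ring)
    have hJ := (fibreBracket_isLie t).jacobi (coY A t) (scatZ A t (p + 1 : ℕ) q) (scatZ A t r s)
    rw [hI, hY, hY', map_smul, map_smul, LinearMap.smul_apply, map_sum, hr,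
      Finset.sum_congr rfl (fun l _ => fibreBracket_coY_scatZ_coefBracket A t
        (show p + 1 + q = 2 * d by lia) h2 l), show p + 1 + q + 1 = p + (q + 1) + 1 by ring,
      ← sub_eq_iff_eq_add, ← Finset.sum_sub_distrib] at hJ
    have hp : (-2 * ((p + 1 : ℕ) : ℂ)) ≠ 0 :=
      mul_ne_zero (by norm_num) (Nat.cast_ne_zero.2 (Nat.succ_ne_zero p))
    rw [← smul_right_inj hp, ← hJ, Finset.smul_sum]
    refine Finset.sum_congr rfl fun l _ => ?_
    rw [← sub_smul, smul_smul]
    congr 1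
    linear_combination 2 * coefBracket_covariance l p q r s d e

end Main

/-! ### The Poisson brackets of the twistor generators -/

section Twistor

set_option linter.unusedSectionVars false

variable (A : Type*) [CommRing A] [Algebra ℂ A] (t : A)

theorem twistorGen_of_neg {m n : ℤ} (h : m < 0 ∨ n < 0) : twistorGen A t m n = 0 := by
  rw [twistorGen, if_neg (by lia)]

theorem twistorGen_eq {m n : ℤ} (p q e : ℕ) (he : e ≤ 1) (hm : m = 2 * p + e)
    (hn : n = 2 * q + e) : twistorGen A t m n = coX A t ^ p * coY A t ^ q * coZ A t ^ e := by
  have h1 : m.toNat / 2 = p := by lia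
  have h2 : n.toNat / 2 = q := by lia
  have h3 : m.toNat % 2 = e := by lia
  rw [twistorGen, if_pos (by lia), h1, h2, h3]

theorem twistorGen_even (p q : ℕ) : twistorGen A t (2 * p) (2 * q) = coX A t ^ p * coY A t ^ q := by
  rw [twistorGen_eq A t p q 0 (by simp) (by simp) (by simp), pow_zero, mul_one]

theorem twistorGen_odd (p q : ℕ) :
    twistorGen A t (2 * p + 1) (2 * q + 1) = coX A t ^ p * coY A t ^ q * coZ A t := by
  rw [twistorGen_eq A t p q 1 le_rfl (by simp) (by simp), pow_one]

theorem natCast_mul_pow_pred {R : Type*} [CommRing R] (x : R) (p r : ℕ) :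
    (p : R) * x ^ (p - 1) * x ^ r = p * x ^ (p + r - 1) := by
  rcases p with _ | p
  · simp
  · rw [Nat.add_sub_cancel, mul_assoc, ← pow_add, show p + 1 + r - 1 = p + r by lia]

theorem fibreBracket_monomial_coZ (p q : ℕ) :
    fibreBracket A t (coX A t ^ p * coY A t ^ q) (coZ A t) =
      2 * ((p : Fibre A t) - q) * (coX A t ^ p * coY A t ^ q) := by
  have hX : fibreBracket A t (coZ A t) (coX A t) = -(2 * coX A t) := by
    rw [fibreBracket_neg_swap, fibreBracket_coX_coZ]
  have hY : fibreBracket A t (coZ A t) (coY A t) = 2 * coY A t := by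
    rw [fibreBracket_neg_swap, fibreBracket_coY_coZ, neg_neg]
  rw [fibreBracket_neg_swap, ← hamiltonian_apply, Derivation.leibniz, Derivation.leibniz_pow,
    Derivation.leibniz_pow, hamiltonian_apply, hamiltonian_apply, hX, hY]
  simp only [smul_eq_mul, nsmul_eq_mul]
  have a := natCast_mul_pow_pred (coX A t) p 1
  have b := natCast_mul_pow_pred (coY A t) q 1
  rw [Nat.add_sub_cancel, pow_one] at a b
  linear_combination 2 * coY A t ^ q * a - 2 * coX A t ^ p * b

theorem fibreBracket_monomial (p q r s : ℕ) :
    fibreBracket A t (coX A t ^ p * coY A t ^ q) (coX A t ^ r * coY A t ^ s) =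
      4 * ((p : Fibre A t) * s - q * r) *
        (coX A t ^ (p + r - 1) * coY A t ^ (q + s - 1) * coZ A t) := by
  have hX : fibreBracket A t (coX A t ^ p * coY A t ^ q) (coX A t) =
      -(coX A t ^ p * (q * coY A t ^ (q - 1)) * (4 * coZ A t)) := by
    rw [fibreBracket_neg_swap, ← hamiltonian_apply, Derivation.leibniz, Derivation.leibniz_pow,
      Derivation.leibniz_pow, hamiltonian_apply, hamiltonian_apply, fibreBracket_coX_coY,
      fibreBracket_self]
    simp only [smul_eq_mul, nsmul_eq_mul]
    ring
  have hY : fibreBracket A t (coX A t ^ p * coY A t ^ q) (coY A t) =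
      p * coX A t ^ (p - 1) * coY A t ^ q * (4 * coZ A t) := by
    rw [fibreBracket_neg_swap, ← hamiltonian_apply, Derivation.leibniz, Derivation.leibniz_pow,
      Derivation.leibniz_pow, hamiltonian_apply, hamiltonian_apply, fibreBracket_coY_coX,
      fibreBracket_self]
    simp only [smul_eq_mul, nsmul_eq_mul]
    ring
  rw [← hamiltonian_apply, Derivation.leibniz, Derivation.leibniz_pow, Derivation.leibniz_pow,
    hamiltonian_apply, hamiltonian_apply, hX, hY]
  simp only [smul_eq_mul, nsmul_eq_mul]
  have a := natCast_mul_pow_pred (coX A t) p r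
  have b := natCast_mul_pow_pred (coY A t) q s
  have c := natCast_mul_pow_pred (coX A t) r p
  have d := natCast_mul_pow_pred (coY A t) s q
  rw [add_comm] at c d
  linear_combination (4 * coZ A t * s * coY A t ^ (s - 1) * coY A t ^ q) * a +
    (4 * coZ A t * p * coX A t ^ (p + r - 1)) * d -
    (4 * coZ A t * q * coY A t ^ (q - 1) * coY A t ^ s) * c -
    (4 * coZ A t * r * coX A t ^ (p + r - 1)) * b

/-- The subtraction `p + r - 1` truncates only for `p = r = 0`, and there the factor `p s - q r` is
zero; likewise for `q` and `s`. This is why negative labels never contribute to the brackets of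
twistor generators. -/
theorem cross_mul_pow {R : Type*} [CommRing R] (x y : R) (p q r s : ℕ) :
    ((p : R) * s - q * r) * (x ^ (p + r - 1) * y ^ (q + s - 1)) * (x * y) =
      ((p : R) * s - q * r) * (x ^ (p + r) * y ^ (q + s)) := by
  by_cases h : p + r = 0
  · obtain ⟨rfl, rfl⟩ : p = 0 ∧ r = 0 := by lia
    simp
  by_cases h' : q + s = 0
  · obtain ⟨rfl, rfl⟩ : q = 0 ∧ s = 0 := by lia
    simp
  obtain ⟨a, ha⟩ : ∃ a, p + r = a + 1 := ⟨p + r - 1, by lia⟩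
  obtain ⟨b, hb⟩ : ∃ b, q + s = b + 1 := ⟨q + s - 1, by lia⟩
  rw [ha, hb, Nat.add_sub_cancel, Nat.add_sub_cancel]
  ring

/-- The bracket of the two monomials produces `Z`; multiplied by the extra `Z` it gives `Z² = X Y +
t`, and `t` is the source of the deformation term. -/
theorem fibreBracket_monomial_odd (p q r s : ℕ) :
    fibreBracket A t (coX A t ^ p * coY A t ^ q) (coX A t ^ r * coY A t ^ s * coZ A t) =
      2 * ((p : Fibre A t) * (2 * s + 1) - q * (2 * r + 1)) *
        (coX A t ^ (p + r) * coY A t ^ (q + s)) +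
      4 * tau A t * ((p : Fibre A t) * s - q * r) *
        (coX A t ^ (p + r - 1) * coY A t ^ (q + s - 1)) := by
  rw [fibreBracket_leibniz, fibreBracket_monomial, fibreBracket_monomial_coZ]
  linear_combination 4 * ((p : Fibre A t) * s - q * r) *
    (coX A t ^ (p + r - 1) * coY A t ^ (q + s - 1)) * coZ_sq A t +
    4 * cross_mul_pow (coX A t) (coY A t) p q r s

theorem fibreBracket_odd_odd (p q r s : ℕ) :
    fibreBracket A t (coX A t ^ p * coY A t ^ q * coZ A t) (coX A t ^ r * coY A t ^ s * coZ A t) =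
      ((2 * (p : Fibre A t) + 1) * (2 * s + 1) - (2 * q + 1) * (2 * r + 1)) *
        (coX A t ^ (p + r) * coY A t ^ (q + s) * coZ A t) +
      4 * tau A t * ((p : Fibre A t) * s - q * r) *
        (coX A t ^ (p + r - 1) * coY A t ^ (q + s - 1) * coZ A t) := by
  have h1 : fibreBracket A t (coX A t ^ p * coY A t ^ q * coZ A t) (coX A t ^ r * coY A t ^ s) =
      -(2 * ((r : Fibre A t) * (2 * q + 1) - s * (2 * p + 1)) *
        (coX A t ^ (p + r) * coY A t ^ (q + s)) +
      4 * tau A t * ((r : Fibre A t) * q - s * p) *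
        (coX A t ^ (p + r - 1) * coY A t ^ (q + s - 1))) := by
    rw [fibreBracket_neg_swap, fibreBracket_monomial_odd, add_comm r p, add_comm s q]
  have h2 : fibreBracket A t (coX A t ^ p * coY A t ^ q * coZ A t) (coZ A t) =
      2 * ((p : Fibre A t) - q) * (coX A t ^ p * coY A t ^ q) * coZ A t := by
    rw [fibreBracket_neg_swap, fibreBracket_leibniz, fibreBracket_self,
      fibreBracket_neg_swap A t (coZ A t), fibreBracket_monomial_coZ]
    ring
  rw [fibreBracket_leibniz, h1, h2]
  ring

theorem smul_eq_algebraMap_mul (a : ℂ) (x : Fibre A t) : a • x = algebraMap ℂ (Fibre A t) a * x := by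
  have := Algebra.smul_def (R := ℂ) (A := Fibre A t) a x
  exact this

theorem algebraMap_four_mul {R : Type*} [CommRing R] (f : ℂ →+* R) (p q r s : ℕ) :
    f (4 * ((p : ℂ) * s - q * r)) = 4 * ((p : R) * s - q * r) := by
  simp [map_ofNat]

theorem algebraMap_two_mul {R : Type*} [CommRing R] (f : ℂ →+* R) (p q r s : ℕ) :
    f (2 * ((p : ℂ) * (2 * s + 1) - q * (2 * r + 1))) =
      2 * ((p : R) * (2 * s + 1) - q * (2 * r + 1)) := by
  simp [map_ofNat]

theorem algebraMap_odd_odd {R : Type*} [CommRing R] (f : ℂ →+* R) (p q r s : ℕ) :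
    f ((2 * (p : ℂ) + 1) * (2 * s + 1) - (2 * q + 1) * (2 * r + 1)) =
      (2 * (p : R) + 1) * (2 * s + 1) - (2 * q + 1) * (2 * r + 1) := by
  simp [map_ofNat]

theorem fibreBracket_twistorGen_even_even (p q r s : ℕ) :
    fibreBracket A t (twistorGen A t (2 * p) (2 * q)) (twistorGen A t (2 * r) (2 * s)) =
      (4 * ((p : ℂ) * s - q * r)) •
        twistorGen A t (2 * ((p : ℤ) + r - 1) + 1) (2 * ((q : ℤ) + s - 1) + 1) := by
  rw [twistorGen_even, twistorGen_even, fibreBracket_monomial]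
  by_cases h : p + r = 0
  · obtain ⟨rfl, rfl⟩ : p = 0 ∧ r = 0 := by lia
    simp
  by_cases h' : q + s = 0
  · obtain ⟨rfl, rfl⟩ : q = 0 ∧ s = 0 := by lia
    simp
  rw [twistorGen_eq A t (p + r - 1) (q + s - 1) 1 le_rfl (by lia) (by lia), smul_eq_algebraMap_mul,
    algebraMap_four_mul, pow_one]

theorem twistorGen_cross_even (p q r s : ℕ) : (4 * ((p : ℂ) * s - q * r)) •
    twistorGen A t (2 * ((p : ℤ) + r - 1)) (2 * ((q : ℤ) + s - 1)) =
      4 * ((p : Fibre A t) * s - q * r) * (coX A t ^ (p + r - 1) * coY A t ^ (q + s - 1)) := by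
  by_cases h : p + r = 0
  · obtain ⟨rfl, rfl⟩ : p = 0 ∧ r = 0 := by lia
    simp
  by_cases h' : q + s = 0
  · obtain ⟨rfl, rfl⟩ : q = 0 ∧ s = 0 := by lia
    simp
  rw [twistorGen_eq A t (p + r - 1) (q + s - 1) 0 (by simp) (by lia) (by lia),
    smul_eq_algebraMap_mul, algebraMap_four_mul, pow_zero, mul_one]

theorem twistorGen_cross_odd (p q r s : ℕ) : (4 * ((p : ℂ) * s - q * r)) •
    twistorGen A t (2 * ((p : ℤ) + r) - 1) (2 * ((q : ℤ) + s) - 1) =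
      4 * ((p : Fibre A t) * s - q * r) *
        (coX A t ^ (p + r - 1) * coY A t ^ (q + s - 1) * coZ A t) := by
  by_cases h : p + r = 0
  · obtain ⟨rfl, rfl⟩ : p = 0 ∧ r = 0 := by lia
    simp
  by_cases h' : q + s = 0
  · obtain ⟨rfl, rfl⟩ : q = 0 ∧ s = 0 := by lia
    simp
  rw [twistorGen_eq A t (p + r - 1) (q + s - 1) 1 le_rfl (by lia) (by lia),
    smul_eq_algebraMap_mul, algebraMap_four_mul, pow_one]

theorem fibreBracket_twistorGen_even_odd (p q r s : ℕ) :
    fibreBracket A t (twistorGen A t (2 * p) (2 * q)) (twistorGen A t (2 * r + 1) (2 * s + 1)) =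
      (2 * ((p : ℂ) * (2 * s + 1) - q * (2 * r + 1))) •
        twistorGen A t (2 * ((p : ℤ) + r)) (2 * ((q : ℤ) + s)) +
      tau A t * ((4 * ((p : ℂ) * s - q * r)) •
        twistorGen A t (2 * ((p : ℤ) + r - 1)) (2 * ((q : ℤ) + s - 1))) := by
  rw [twistorGen_even, twistorGen_odd, fibreBracket_monomial_odd,
    twistorGen_cross_even, twistorGen_eq A t (p + r) (q + s) 0 (by simp) (by simp) (by simp),
    smul_eq_algebraMap_mul, algebraMap_two_mul]
  ring

theorem fibreBracket_twistorGen_odd_odd (p q r s : ℕ) :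
    fibreBracket A t (twistorGen A t (2 * p + 1) (2 * q + 1))
        (twistorGen A t (2 * r + 1) (2 * s + 1)) =
      ((2 * (p : ℂ) + 1) * (2 * s + 1) - (2 * q + 1) * (2 * r + 1)) •
        twistorGen A t (2 * ((p : ℤ) + r) + 1) (2 * ((q : ℤ) + s) + 1) +
      tau A t * ((4 * ((p : ℂ) * s - q * r)) •
        twistorGen A t (2 * ((p : ℤ) + r) - 1) (2 * ((q : ℤ) + s) - 1)) := by
  rw [twistorGen_odd, twistorGen_odd, fibreBracket_odd_odd,
    twistorGen_cross_odd, twistorGen_eq A t (p + r) (q + s) 1 le_rfl (by simp) (by simp),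
    smul_eq_algebraMap_mul, algebraMap_odd_odd]
  ring

end Twistor

/-! ### The change of basis -/

section ChangeOfBasis

/-- The coefficients of the scattering generators in the twistor basis. -/
noncomputable def coefTwistor (p q d l : ℕ) : ℂ :=
  fall p l * fall q l / (l.factorial * fall (d - 1 / 2) l)

theorem coefTwistor_zero (p q d : ℕ) : coefTwistor p q d 0 = 1 := by simp [coefTwistor, fall_zero]

theorem coefTwistor_eq_zero {p q l : ℕ} (d : ℕ) (h : min p q < l) : coefTwistor p q d l = 0 := by
  rcases min_lt_iff.1 h with h | h
  · simp [coefTwistor, fall_eq_zero h]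
  · simp [coefTwistor, fall_eq_zero h]

/-- The recursion imposed by `coX_mul_scatZ`, read as a formula for `W[m + 2, n]`. Both parities are
covered at once because `e² = e` for `e ≤ 1`. -/
theorem coefTwistor_succ_succ (p q e l : ℕ) (he : e ≤ 1) :
    coefTwistor (p + 1) (q + 1) (p + q + e + 2) (l + 1) =
      coefTwistor p (q + 1) (p + q + e + 1) (l + 1) +
      ((2 * (q + 1) + e : ℂ) * ((2 * (q + 1) + e : ℂ) - 1) /
        ((2 * (p + q + e + 1 : ℂ) + 1) * (2 * (p + q + e + 1 : ℂ) - 1))) *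
        coefTwistor p q (p + q + e) l := by
  set u : ℂ := p + q + e + 1 / 2 with hu
  have H1 := fall_ne_zero_of_half (a := u - 1) (p + q + e - 1) (by push_cast; rw [hu]; ring) l
  have H3 := fall_ne_zero_of_half (a := u) (p + q + e) (by push_cast; rw [hu]; ring) l
  have H2 := ne_zero_of_half (a := u - l) (p + q + e - l) (by push_cast; rw [hu]; ring)
  have H4 := ne_zero_of_half (a := u) (p + q + e) (by push_cast; rw [hu]; ring)
  have H5 := ne_zero_of_half (a := u + 1) (p + q + e + 1) (by push_cast; rw [hu]; ring)
  have e1 : ((p + q + e + 2 : ℕ) : ℂ) - 1 / 2 = u + 1 := by rw [hu]; push_cast; ring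
  have e2 : ((p + q + e + 1 : ℕ) : ℂ) - 1 / 2 = u := by rw [hu]; push_cast; ring
  have e3 : ((p + q + e : ℕ) : ℂ) - 1 / 2 = u - 1 := by rw [hu]; push_cast; ring
  have e4 : 2 * (p + q + e + 1 : ℂ) + 1 = 2 * (u + 1) := by rw [hu]; ring
  have e5 : 2 * (p + q + e + 1 : ℂ) - 1 = 2 * u := by rw [hu]; ring
  have e6 : fall ((p + 1 : ℕ) : ℂ) (l + 1) = (p + 1) * fall p l := by
    rw [fall_succ_left]; push_cast; ring_nf
  have e7 : fall ((q + 1 : ℕ) : ℂ) (l + 1) = (q + 1) * fall q l := by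
    rw [fall_succ_left]; push_cast; ring_nf
  have e8 : fall (u + 1) (l + 1) = (u + 1) * fall u l := by rw [fall_succ_left]; ring_nf
  have e9 : fall u (l + 1) = u * fall (u - 1) l := fall_succ_left u l
  have e10 : fall u l = u * fall (u - 1) l / (u - l) := by
    rw [eq_div_iff H2, ← e9, fall_succ]
  have e11 : (2 * (q + 1) + e : ℂ) * ((2 * (q + 1) + e : ℂ) - 1) =
      2 * (q + 1) * (2 * (q + 1) + 2 * e - 1) := by
    have : (e : ℂ) = 0 ∨ (e : ℂ) = 1 := by
      rcases Nat.le_one_iff_eq_zero_or_eq_one.1 he with rfl | rfl <;> simp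
    rcases this with h | h <;> rw [h] <;> ring
  have hl : (l.factorial : ℂ) ≠ 0 := Nat.cast_ne_zero.2 (Nat.factorial_ne_zero l)
  have hl1 : (l : ℂ) + 1 ≠ 0 := by exact_mod_cast Nat.succ_ne_zero l
  have e12 : (q : ℂ) = u - 1 / 2 - p - e := by rw [hu]; ring
  simp only [coefTwistor]
  rw [e1, e2, e3, e4, e5, e6, e7, e8, e9, e10, e11, fall_succ (p : ℂ), Nat.factorial_succ]
  generalize fall (p : ℂ) l = P at *
  generalize fall (q : ℂ) l = Q at *
  generalize fall (u - 1) l = U at *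
  have e13 : (2 * ((q : ℂ) + 1) + 2 * e - 1) = 2 * (u - p) := by rw [e12]; ring
  rw [e13]
  push_cast
  clear_value u
  field_simp
  ring

/-- By duplication the factor `[d]_l` cancels, which is legitimate for `l ≤ d`; for larger `l` both
sides vanish. With `d = p + q` and `d = p + q + 1` this covers `C₀` and `C₁`. -/
theorem pow_four_mul_coef {p q d l : ℕ} (hd : p + q ≤ d) :
    4 ^ l * (fall p l * fall q l * fall d l / (l.factorial * fall (2 * d) (2 * l))) =
      coefTwistor p q d l := by
  rcases lt_or_ge (min p q) l with h | h
  · rw [coefTwistor_eq_zero d h]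
    rcases min_lt_iff.1 h with h | h <;> simp [fall_eq_zero h]
  rw [fall_two_mul, coefTwistor]
  have H := fall_ne_zero_of_half (a := (d : ℂ) - 1 / 2) (d - 1) (by push_cast; ring) l
  have H1 := fall_natCast_ne_zero (show l ≤ d by lia)
  have hl : (l.factorial : ℂ) ≠ 0 := Nat.cast_ne_zero.2 (Nat.factorial_ne_zero l)
  generalize fall ((d : ℂ) - 1 / 2) l = a at *
  field_simp

variable (A : Type*) [CommRing A] [Algebra ℂ A] (t : A)

theorem scatZ_zero_left (q e : ℕ) (he : e ≤ 1) :
    scatZ A t e (2 * q + e : ℕ) = coY A t ^ q * coZ A t ^ e := by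
  have h : ∀ k : ℕ, (k.factorial : ℂ) ≠ 0 := fun k => Nat.cast_ne_zero.2 (Nat.factorial_ne_zero k)
  rw [scatZ_natCast, scatteringGen]
  rcases Nat.le_one_iff_eq_zero_or_eq_one.1 he with rfl | rfl
  · simp [h]
  · have h1 : (1 + (2 * q + 1)) / 2 = q + 1 := by lia
    have h2 : (2 * q + 1) / 2 = q := by lia
    have h3 : 1 + (2 * q + 1) = 2 * q + 1 + 1 := by ring
    have h4 : 2 * coZ A t = (2 : ℂ) • coZ A t := by
      have := natCast_mul_eq_smul (R := Fibre A t) 2 (coZ A t)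
      exact_mod_cast this
    rw [h1, h2, h3, Nat.factorial_succ (2 * q + 1), h4]
    simp only [Nat.factorial_succ q, Nat.reduceDiv, Nat.zero_min, zero_add, Finset.range_one,
      Finset.sum_singleton, Nat.sub_zero, Nat.factorial_zero, Nat.factorial_one, Nat.mod_succ,
      mul_zero, pow_zero, pow_one, one_mul, mul_one, Nat.cast_one]
    rw [mul_smul_comm, smul_smul, smul_smul]
    have e1 := h (2 * q + 1)
    have e2 := h q
    have e3 : (q : ℂ) + 1 ≠ 0 := by exact_mod_cast Nat.succ_ne_zero q
    have e4 : ((2 * q + 1 + 1 : ℕ) : ℂ) = 2 * (q + 1) := by push_cast; ring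
    convert one_smul ℂ _ using 2
    push_cast [e4]
    field_simp

/-- Induction on `p` from `W[e, 2 q + e] = Y ^ q Z ^ e`. Summing up to `q` rather than `min p q`
keeps the range independent of the induction variable; the extra coefficients vanish. -/
theorem scatZ_eq_sum_twistorGen (p q e : ℕ) (he : e ≤ 1) :
    scatZ A t (2 * p + e : ℕ) (2 * q + e : ℕ) = ∑ l ∈ Finset.range (q + 1),
      coefTwistor p q (p + q + e) l •
        (tau A t ^ l * twistorGen A t (2 * p + e - 2 * l) (2 * q + e - 2 * l)) := by
  induction p generalizing q with
  | zero =>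
    rw [Finset.sum_range_succ', Finset.sum_eq_zero]
    · have := scatZ_zero_left A t q e he
      rw [Nat.mul_zero, Nat.zero_add, this, coefTwistor_zero,
        twistorGen_eq A t 0 q e he (by simp) (by simp)]
      simp
    · intro l _
      rw [coefTwistor_eq_zero _ (by simp), zero_smul]
  | succ p ih =>
    have h1 := coX_mul_scatZ A t (show (2 * p + e) + (2 * q + e) = 2 * (p + q + e) by ring)
    have hX : ∀ l, coX A t * coefTwistor p q (p + q + e) l •
        (tau A t ^ l * twistorGen A t (2 * p + e - 2 * l) (2 * q + e - 2 * l)) =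
        coefTwistor p q (p + q + e) l •
        (tau A t ^ l * twistorGen A t (2 * (p + 1 : ℕ) + e - 2 * l) (2 * q + e - 2 * l)) := by
      intro l
      rcases lt_or_ge (min p q) l with h | h
      · rw [coefTwistor_eq_zero _ h]; simp
      · rw [twistorGen_eq A t (p - l) (q - l) e he (by lia) (by lia),
          twistorGen_eq A t (p - l + 1) (q - l) e he (by lia) (by lia), mul_smul_comm]
        congr 1
        ring
    have h2 : scatZ A t (2 * (p + 1) + e : ℕ) (2 * q + e : ℕ) =
        coX A t * scatZ A t (2 * p + e : ℕ) (2 * q + e : ℕ) +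
        ((((2 * q + e : ℕ) : ℂ) * ((2 * q + e : ℕ) - 1)) / ((2 * (p + q + e : ℕ) + 1) *
          (2 * (p + q + e : ℕ) - 1))) •
        (tau A t * scatZ A t (2 * p + e : ℕ) ((2 * q + e : ℕ) - 2)) := by
      have e1 : ((2 * (p + 1) + e : ℕ) : ℤ) = (2 * p + e : ℕ) + 2 := by push_cast; ring
      rw [h1, e1, sub_add_cancel]
    rw [h2, ih, Finset.mul_sum, Finset.sum_congr rfl fun l _ => hX l]
    rcases q with _ | q
    · have : ((2 * 0 + e : ℕ) : ℂ) * ((2 * 0 + e : ℕ) - 1) = 0 := by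
        rcases Nat.le_one_iff_eq_zero_or_eq_one.1 he with rfl | rfl <;> simp
      rw [this]
      simp [coefTwistor_zero]
    have e2 : ((2 * (q + 1) + e : ℕ) : ℤ) - 2 = (2 * q + e : ℕ) := by push_cast; ring
    rw [e2, ih q, Finset.sum_range_succ', Finset.sum_range_succ' _ (q + 1), coefTwistor_zero,
      coefTwistor_zero, Finset.mul_sum, Finset.smul_sum, add_right_comm, ← Finset.sum_add_distrib]
    congr 1
    refine Finset.sum_congr rfl fun l _ => ?_
    have h3 := coefTwistor_succ_succ p q e l he
    rw [show p + 1 + (q + 1) + e = p + q + e + 2 by ring, h3, add_smul,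
      show p + (q + 1) + e = p + q + e + 1 by ring]
    congr 1
    have e3 : 2 * ((p + 1 : ℕ) : ℤ) + e - 2 * (l + 1 : ℕ) = 2 * p + e - 2 * l := by
      push_cast; ring
    have e4 : 2 * ((q + 1 : ℕ) : ℤ) + e - 2 * (l + 1 : ℕ) = 2 * q + e - 2 * l := by
      push_cast; ring
    rw [e3, e4, mul_smul_comm, smul_smul, pow_succ', mul_assoc]
    push_cast
    rfl

theorem scatteringGen_eq_sum_min (p q e : ℕ) (he : e ≤ 1) :
    scatteringGen A t (2 * p + e) (2 * q + e) = ∑ l ∈ Finset.range (min p q + 1),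
      coefTwistor p q (p + q + e) l •
        (tau A t ^ l * twistorGen A t (2 * p + e - 2 * l) (2 * q + e - 2 * l)) := by
  rw [← scatZ_natCast, scatZ_eq_sum_twistorGen A t p q e he]
  symm
  refine Finset.sum_subset (by intro l; simp) fun l _ hl => ?_
  rw [coefTwistor_eq_zero _ (by simp at hl; rw [min_lt_iff]; lia), zero_smul]

end ChangeOfBasis

/-! ### Bases of the fibre ring -/

section Unitriangular

variable {R M ι : Type*} [CommRing R] [AddCommGroup M] [Module R M]

theorem span_eq_top_of_unitriangular (b : Module.Basis ι R M) (w : ι → M) (deg : ι → ℕ)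
    (h : ∀ i, w i - b i ∈ Submodule.span R (b '' {j | deg j < deg i})) :
    Submodule.span R (Set.range w) = ⊤ := by
  have key : ∀ n i, deg i < n → b i ∈ Submodule.span R (Set.range w) := by
    intro n
    induction n with
    | zero => intro i hi; simp at hi
    | succ n ih =>
      intro i hi
      have h1 : Submodule.span R (b '' {j | deg j < deg i}) ≤ Submodule.span R (Set.range w) := by
        rw [Submodule.span_le]
        rintro _ ⟨j, hj, rfl⟩
        exact ih j (lt_of_lt_of_le hj (Nat.lt_succ_iff.1 hi))
      rw [← sub_sub_self (w i) (b i)]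
      exact Submodule.sub_mem _ (Submodule.subset_span ⟨i, rfl⟩) (h1 (h i))
  rw [eq_top_iff, ← b.span_eq, Submodule.span_le]
  rintro _ ⟨i, rfl⟩
  exact key _ i (Nat.lt_succ_self _)

/-- In a relation among the `w j`, choose `i` of maximal degree in the support. Modulo basis vectors
of lower degree the relation also holds for the `b j`, which contradicts the non-zero coefficient at
`b i`. -/
theorem linearIndependent_of_unitriangular (b : Module.Basis ι R M) (w : ι → M) (deg : ι → ℕ)
    (h : ∀ i, w i - b i ∈ Submodule.span R (b '' {j | deg j < deg i})) :
    LinearIndependent R w := by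
  rw [linearIndependent_iff]
  intro x hx
  by_contra hne
  obtain ⟨i, hi, hmax⟩ := Finset.exists_max_image x.support deg (Finsupp.support_nonempty_iff.2 hne)
  have h1 : Finsupp.linearCombination R w x - Finsupp.linearCombination R b x ∈
      Submodule.span R (b '' {j | deg j < deg i}) := by
    rw [Finsupp.linearCombination_apply, Finsupp.linearCombination_apply, Finsupp.sum, Finsupp.sum,
      ← Finset.sum_sub_distrib]
    refine Submodule.sum_mem _ fun j hj => ?_
    rw [← smul_sub]
    refine Submodule.smul_mem _ _ (Submodule.span_mono (Set.image_mono ?_) (h j))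
    intro k hk
    exact lt_of_lt_of_le hk (hmax j hj)
  rw [hx, zero_sub, Submodule.neg_mem_iff, Module.Basis.mem_span_image,
    Module.Basis.repr_linearCombination] at h1
  exact lt_irrefl (deg i) (show deg i < deg i from h1 hi)

/-- A family that is unitriangular with respect to a basis is a basis. -/
noncomputable def unitriangularBasis (b : Module.Basis ι R M) (w : ι → M) (deg : ι → ℕ)
    (h : ∀ i, w i - b i ∈ Submodule.span R (b '' {j | deg j < deg i})) : Module.Basis ι R M :=
  Module.Basis.mk (linearIndependent_of_unitriangular b w deg h)
    (span_eq_top_of_unitriangular b w deg h).ge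

end Unitriangular

theorem Label.exists_eq (i : Label) :
    ∃ p q e : ℕ, e ≤ 1 ∧ i.1.1 = 2 * p + e ∧ i.1.2 = 2 * q + e :=
  ⟨i.1.1 / 2, i.1.2 / 2, i.1.1 % 2, by lia, by lia, by have := i.2; lia⟩

/-! ### The fibre ring as a free module over its base ring. -/

section Bases

set_option linter.unusedSectionVars false

variable (A : Type*) [CommRing A] [Algebra ℂ A] (t : A)

/-- The quadratic extension of the ring of polynomials in `X` and `Y` by `Z`. -/
abbrev QuadraticModel : Type _ :=
  QuadraticAlgebra (MvPolynomial (Fin 2) A)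
    (MvPolynomial.X 0 * MvPolynomial.X 1 + MvPolynomial.C t) 0

/-- The map from polynomials in `X`, `Y`, `Z` to the quadratic model. -/
noncomputable def polyToModel : MvPolynomial (Fin 3) A →ₐ[A] QuadraticModel A t :=
  MvPolynomial.aeval ![⟨MvPolynomial.X 0, 0⟩, ⟨MvPolynomial.X 1, 0⟩, ⟨0, 1⟩]

theorem polyToModel_casimir : polyToModel A t (casimir A t) = 0 := by
  have hC : polyToModel A t (MvPolynomial.C t) = ⟨MvPolynomial.C t, 0⟩ :=
    (polyToModel A t).commutes t
  have e : polyToModel A t (casimir A t) = polyToModel A t (MvPolynomial.X 0) *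
      polyToModel A t (MvPolynomial.X 1) - polyToModel A t (MvPolynomial.X 2) ^ 2 +
      polyToModel A t (MvPolynomial.C t) := by
    simp only [casimir, map_add, map_sub, map_mul, map_pow]
  rw [e, hC]
  simp only [polyToModel, MvPolynomial.aeval_X, pow_two]
  ext <;> simp

/-- The map from the fibre ring to the quadratic model. -/
noncomputable def fibreToModel : Fibre A t →ₐ[A] QuadraticModel A t :=
  Ideal.Quotient.liftₐ _ (polyToModel A t) (by
    intro a ha
    obtain ⟨k, rfl⟩ := Ideal.mem_span_singleton.1 ha
    rw [map_mul, polyToModel_casimir, zero_mul])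

theorem fibreToModel_monomial (p q : ℕ) : fibreToModel A t (coX A t ^ p * coY A t ^ q) =
    ⟨MvPolynomial.X 0 ^ p * MvPolynomial.X 1 ^ q, 0⟩ := by
  have hX : fibreToModel A t (coX A t) = algebraMap (MvPolynomial (Fin 2) A) (QuadraticModel A t) (MvPolynomial.X 0) := by
    have : fibreToModel A t (coX A t) = polyToModel A t (MvPolynomial.X 0) := rfl
    rw [this, polyToModel, MvPolynomial.aeval_X]
    rfl
  have hY : fibreToModel A t (coY A t) = algebraMap (MvPolynomial (Fin 2) A) (QuadraticModel A t) (MvPolynomial.X 1) := by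
    have : fibreToModel A t (coY A t) = polyToModel A t (MvPolynomial.X 1) := rfl
    rw [this, polyToModel, MvPolynomial.aeval_X]
    rfl
  rw [map_mul, map_pow, map_pow, hX, hY, ← map_pow, ← map_pow, ← map_mul]
  rfl

theorem fibreToModel_coZ : fibreToModel A t (coZ A t) = ⟨0, 1⟩ := by
  have : fibreToModel A t (coZ A t) = polyToModel A t (MvPolynomial.X 2) := rfl
  rw [this, polyToModel, MvPolynomial.aeval_X]
  rfl

/-- The coefficient of a twistor generator, as a linear functional on the fibre ring. -/
noncomputable def twistorCoeff (i : Label) : Module.Dual A (Fibre A t) where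
  toFun x := MvPolynomial.coeff (Finsupp.single 0 (i.1.1 / 2) + Finsupp.single 1 (i.1.2 / 2))
    (if i.1.1 % 2 = 0 then (fibreToModel A t x).re else (fibreToModel A t x).im)
  map_add' x y := by split_ifs <;> simp
  map_smul' a x := by split_ifs <;> simp

theorem coeff_X_pow_mul_X_pow (p q r s : ℕ) :
    MvPolynomial.coeff (Finsupp.single 0 p + Finsupp.single 1 q)
      (MvPolynomial.X 0 ^ r * MvPolynomial.X 1 ^ s : MvPolynomial (Fin 2) A) =
      if p = r ∧ q = s then 1 else 0 := by
  rw [MvPolynomial.X_pow_eq_monomial, MvPolynomial.X_pow_eq_monomial, MvPolynomial.monomial_mul,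
    MvPolynomial.coeff_monomial, one_mul]
  congr 1
  rw [eq_iff_iff, DFunLike.ext_iff, Fin.forall_fin_two]
  simp [eq_comm]

theorem twistorCoeff_twistorGen (i j : Label) :
    twistorCoeff A t i (twistorGen A t j.1.1 j.1.2) = if i = j then 1 else 0 := by
  obtain ⟨p, q, e, he, h1, h2⟩ := i.exists_eq
  obtain ⟨r, s, f, hf, h3, h4⟩ := j.exists_eq
  have hij : i = j ↔ (p = r ∧ q = s) ∧ e = f := by
    rw [Subtype.ext_iff, Prod.ext_iff]
    lia
  rw [twistorGen_eq A t r s f hf (by rw [h3]; simp) (by rw [h4]; simp)]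
  have h5 : i.1.1 / 2 = p := by lia
  have h6 : i.1.2 / 2 = q := by lia
  have h7 : i.1.1 % 2 = e := by lia
  simp only [twistorCoeff, LinearMap.coe_mk, AddHom.coe_mk, h5, h6, h7, hij]
  rw [map_mul, fibreToModel_monomial]
  rcases Nat.le_one_iff_eq_zero_or_eq_one.1 hf with rfl | rfl
  · rw [pow_zero, map_one]
    rcases Nat.le_one_iff_eq_zero_or_eq_one.1 he with rfl | rfl
    · simp [coeff_X_pow_mul_X_pow]
    · simp
  · rw [pow_one, fibreToModel_coZ]
    rcases Nat.le_one_iff_eq_zero_or_eq_one.1 he with rfl | rfl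
    · simp
    · simp [coeff_X_pow_mul_X_pow]

/-- In the quadratic model `1` and `Z` are independent over `A[X, Y]`, so extracting a coefficient
there gives functionals dual to the twistor generators. -/
theorem linearIndependent_twistorGen :
    LinearIndependent A fun i : Label => twistorGen A t i.1.1 i.1.2 := by
  refine LinearIndependent.of_pairwise_dual_eq_zero_one _ (twistorCoeff A t) ?_ ?_
  · intro i j hij
    simp only [twistorCoeff_twistorGen, if_neg hij]
  · intro i
    simp only [twistorCoeff_twistorGen, if_true]

theorem monomial_mem_span (p q e : ℕ) (he : e ≤ 1) : coX A t ^ p * coY A t ^ q * coZ A t ^ e ∈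
    Submodule.span A (Set.range fun i : Label => twistorGen A t i.1.1 i.1.2) :=
  Submodule.subset_span ⟨⟨(2 * p + e, 2 * q + e), by simp⟩,
    twistorGen_eq A t p q e he (by simp) (by simp)⟩

/-- The span contains `1` and is stable under multiplication by the coordinates; only `Z` times an
odd generator needs the relation `Z² = X Y + t`. -/
theorem span_twistorGen :
    Submodule.span A (Set.range fun i : Label => twistorGen A t i.1.1 i.1.2) = ⊤ := by
  set S := Submodule.span A (Set.range fun i : Label => twistorGen A t i.1.1 i.1.2) with hS
  have stable : ∀ z : Fibre A t, (∀ p q e : ℕ, e ≤ 1 →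
      coX A t ^ p * coY A t ^ q * coZ A t ^ e * z ∈ S) → ∀ x ∈ S, x * z ∈ S := by
    intro z hz x hx
    induction hx using Submodule.span_induction with
    | mem x hx =>
      obtain ⟨i, rfl⟩ := hx
      obtain ⟨p, q, e, he, h1, h2⟩ := i.exists_eq
      simp only
      rw [twistorGen_eq A t p q e he (by rw [h1]; simp) (by rw [h2]; simp)]
      exact hz p q e he
    | zero => rw [zero_mul]; exact S.zero_mem
    | add x y _ _ hx hy => rw [add_mul]; exact S.add_mem hx hy
    | smul a x _ hx => rw [smul_mul_assoc]; exact S.smul_mem a hx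
  have hX := stable (coX A t) fun p q e he => by
    convert monomial_mem_span A t (p + 1) q e he using 1; ring
  have hY := stable (coY A t) fun p q e he => by
    convert monomial_mem_span A t p (q + 1) e he using 1; ring
  have hZ := stable (coZ A t) fun p q e he => by
    rcases Nat.le_one_iff_eq_zero_or_eq_one.1 he with rfl | rfl
    · convert monomial_mem_span A t p q 1 le_rfl using 1; ring
    · have h1 := monomial_mem_span A t (p + 1) (q + 1) 0 (by simp)
      have h2 := S.smul_mem t (monomial_mem_span A t p q 0 (by simp))
      convert S.add_mem h1 h2 using 1
      have e : t • (coX A t ^ p * coY A t ^ q * coZ A t ^ 0) =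
          tau A t * (coX A t ^ p * coY A t ^ q * coZ A t ^ 0) := by
        have := Algebra.smul_def (R := A) (A := Fibre A t) t
          (coX A t ^ p * coY A t ^ q * coZ A t ^ 0)
        exact this
      rw [e]
      linear_combination coX A t ^ p * coY A t ^ q * coZ_sq A t
  rw [eq_top_iff]
  intro x _
  obtain ⟨f, rfl⟩ := Ideal.Quotient.mk_surjective x
  induction f using MvPolynomial.induction_on with
  | C a =>
    have := S.smul_mem a (monomial_mem_span A t 0 0 0 (by simp))
    convert this using 1
    have h := Algebra.smul_def (R := A) (A := Fibre A t) a (coX A t ^ 0 * coY A t ^ 0 * coZ A t ^ 0)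
    simp only [pow_zero, mul_one] at h ⊢
    exact h.symm
  | add f g hf hg => rw [map_add]; exact S.add_mem (hf trivial) (hg trivial)
  | mul_X f i hf =>
    rw [map_mul]
    fin_cases i
    · exact hX _ (hf trivial)
    · exact hY _ (hf trivial)
    · exact hZ _ (hf trivial)

/-- The twistor generators, as a basis of the fibre ring. -/
noncomputable def twistorBasis : Module.Basis Label A (Fibre A t) :=
  Module.Basis.mk (linearIndependent_twistorGen A t) (span_twistorGen A t).ge

theorem twistorBasis_apply (i : Label) : twistorBasis A t i = twistorGen A t i.1.1 i.1.2 := by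
  simp [twistorBasis]

/-- The leading coefficient is `1`, and the term with index `l` lowers both labels by `2 l`, so the
first label can serve as the degree. -/
theorem scatteringGen_sub_twistorGen (i : Label) :
    scatteringGen A t i.1.1 i.1.2 - twistorBasis A t i ∈
      Submodule.span A (twistorBasis A t '' {j | j.1.1 < i.1.1}) := by
  obtain ⟨p, q, e, he, h1, h2⟩ := i.exists_eq
  rw [twistorBasis_apply, h1, h2, scatteringGen_eq_sum_min A t p q e he, Finset.sum_range_succ']
  have e1 : coefTwistor p q (p + q + e) 0 • (tau A t ^ 0 *
      twistorGen A t (2 * p + e - 2 * (0 : ℕ)) (2 * q + e - 2 * (0 : ℕ))) =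
      twistorGen A t (2 * p + e : ℕ) (2 * q + e : ℕ) := by
    rw [coefTwistor_zero]
    simp
  rw [e1, add_sub_cancel_right]
  refine Submodule.sum_mem _ fun l hl => ?_
  have hl' : l < p ∧ l < q := by simpa using hl
  have e2 : tau A t ^ (l + 1) *
      twistorGen A t (2 * p + e - 2 * (l + 1 : ℕ)) (2 * q + e - 2 * (l + 1 : ℕ)) =
      t ^ (l + 1) • twistorBasis A t ⟨(2 * (p - l - 1) + e, 2 * (q - l - 1) + e), by simp⟩ := by
    have h := Algebra.smul_def (R := A) (A := Fibre A t) (t ^ (l + 1))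
      (twistorBasis A t ⟨(2 * (p - l - 1) + e, 2 * (q - l - 1) + e), by simp⟩)
    refine Eq.trans ?_ h.symm
    rw [map_pow, twistorBasis_apply]
    have c1 : 2 * (p : ℤ) + e - 2 * (l + 1 : ℕ) = (2 * (p - l - 1) + e : ℕ) := by lia
    have c2 : 2 * (q : ℤ) + e - 2 * (l + 1 : ℕ) = (2 * (q - l - 1) + e : ℕ) := by lia
    rw [c1, c2]
  rw [e2, ← algebraMap_smul A]
  refine Submodule.smul_mem _ _ (Submodule.smul_mem _ _ (Submodule.subset_span ⟨_, ?_, rfl⟩))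
  show 2 * (p - l - 1) + e < 2 * p + e
  lia

/-- The scattering generators, as a basis of the fibre ring. -/
noncomputable def scatteringBasis : Module.Basis Label A (Fibre A t) :=
  unitriangularBasis (twistorBasis A t) (fun i => scatteringGen A t i.1.1 i.1.2) (fun i => i.1.1)
    (scatteringGen_sub_twistorGen A t)

theorem scatteringBasis_apply (i : Label) :
    scatteringBasis A t i = scatteringGen A t i.1.1 i.1.2 := by
  simp [scatteringBasis, unitriangularBasis]

end Bases

/-! ### Transport of Lie brackets -/

section Transport

variable {V O : Type*} [AddCommGroup V] [Module ℂ V] [AddCommGroup O] [Module ℂ O]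

/-- The device by which each bracket given by structure constants inherits its Jacobi identity from
a Poisson bracket of functions. -/
theorem IsLieBracket.of_injective {B : V →ₗ[ℂ] V →ₗ[ℂ] V} {B' : O →ₗ[ℂ] O →ₗ[ℂ] O}
    (h' : IsLieBracket B') (f : V →ₗ[ℂ] O) (hf : Function.Injective f)
    (h : ∀ x y, f (B x y) = B' (f x) (f y)) : IsLieBracket B where
  self x := hf (by rw [h, h'.self, map_zero])
  jacobi x y z := hf (by rw [map_add, h, h, h, h, h, h, h'.jacobi])

theorem IsLieBracket.swap {B : V →ₗ[ℂ] V →ₗ[ℂ] V} (h : IsLieBracket B) (x y : V) :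
    B x y = - B y x := by
  have := h.self (x + y)
  simp only [map_add, LinearMap.add_apply, h.self, zero_add, add_zero] at this
  exact eq_neg_of_add_eq_zero_right this

/-- A linear equivalence that intertwines two Lie brackets, as an isomorphism of Lie algebras. -/
noncomputable def lieOfEquiv {B : V →ₗ[ℂ] V →ₗ[ℂ] V} {B' : O →ₗ[ℂ] O →ₗ[ℂ] O}
    (hB : IsLieBracket B) (hB' : IsLieBracket B') (f : V ≃ₗ[ℂ] O)
    (h : ∀ x y, f (B x y) = B' (f x) (f y)) : LieOf B hB ≃ₗ⁅ℂ⁆ LieOf B' hB' :=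
  { (LieOf.of hB).symm ≪≫ₗ f ≪≫ₗ LieOf.of hB' with
    map_lie' := fun {x y} => congrArg (LieOf.of hB') (h ((LieOf.of hB).symm x) ((LieOf.of hB).symm y)) }

theorem lieOfEquiv_of {B : V →ₗ[ℂ] V →ₗ[ℂ] V} {B' : O →ₗ[ℂ] O →ₗ[ℂ] O}
    (hB : IsLieBracket B) (hB' : IsLieBracket B') (f : V ≃ₗ[ℂ] O)
    (h : ∀ x y, f (B x y) = B' (f x) (f y)) (x : V) :
    lieOfEquiv hB hB' f h (LieOf.of hB x) = LieOf.of hB' (f x) := rfl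

theorem LieOf.lie_of {B : V →ₗ[ℂ] V →ₗ[ℂ] V} (hB : IsLieBracket B) (x y : V) :
    ⁅LieOf.of hB x, LieOf.of hB y⁆ = LieOf.of hB (B x y) := rfl

theorem bracketOf_single {ι : Type*} (F : ι → ι → (ι →₀ ℂ)) (i j : ι) :
    bracketOf F (Finsupp.single i 1) (Finsupp.single j 1) = F i j := by
  simp [bracketOf]

theorem map_bilinear_of_single {ι : Type*} (f : (ι →₀ ℂ) →ₗ[ℂ] O)
    (B : (ι →₀ ℂ) →ₗ[ℂ] (ι →₀ ℂ) →ₗ[ℂ] (ι →₀ ℂ)) (B' : O →ₗ[ℂ] O →ₗ[ℂ] O)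
    (h : ∀ i j, f (B (Finsupp.single i 1) (Finsupp.single j 1)) =
      B' (f (Finsupp.single i 1)) (f (Finsupp.single j 1))) (x y : ι →₀ ℂ) :
    f (B x y) = B' (f x) (f y) := by
  have : B.compr₂ f = B'.compl₁₂ f f := by
    ext i j
    exact h i j
  exact LinearMap.congr_fun₂ this x y

end Transport

/-! ### The twistor basis and the wedge algebra -/

section Wedge

theorem gen_of_parity {m n : ℤ} (hm : 0 ≤ m) (hn : 0 ≤ n) (h : m.toNat % 2 = n.toNat % 2) :
    gen m n = Finsupp.single ⟨(m.toNat, n.toNat), h⟩ 1 := dif_pos ⟨h, hm, hn⟩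

theorem gen_of_neg {m n : ℤ} (h : m < 0 ∨ n < 0) : gen m n = 0 := dif_neg (by lia)

theorem gen_natCast (i : Label) : gen i.1.1 i.1.2 = Finsupp.single i 1 := by
  rw [gen_of_parity (by simp) (by simp) (by simpa using i.2)]
  simp

theorem tau_mul (t : ℂ) (x : Fibre ℂ t) : tau ℂ t * x = t • x :=
  (Algebra.smul_def (R := ℂ) (A := Fibre ℂ t) t x).symm

/-- The identification of the vector space with basis the labels with the fibre ring, by the twistor
generators. -/
noncomputable def twistorEquiv (t : ℂ) : Gens ≃ₗ[ℂ] Fibre ℂ t := (twistorBasis ℂ t).repr.symm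

theorem twistorEquiv_single (t : ℂ) (i : Label) :
    twistorEquiv t (Finsupp.single i 1) = twistorGen ℂ t i.1.1 i.1.2 := by
  rw [twistorEquiv, Module.Basis.repr_symm_single_one, twistorBasis_apply]

theorem twistorEquiv_gen (t : ℂ) {m n : ℤ} (h : m % 2 = n % 2) :
    twistorEquiv t (gen m n) = twistorGen ℂ t m n := by
  by_cases hmn : 0 ≤ m ∧ 0 ≤ n
  · rw [gen_of_parity hmn.1 hmn.2 (by lia), twistorEquiv_single]
    simp only
    rw [Int.toNat_of_nonneg hmn.1, Int.toNat_of_nonneg hmn.2]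
  · rw [gen_of_neg (by lia), twistorGen_of_neg ℂ t (by lia), map_zero]

/-- The cocycle of the deformation, as a bilinear map. -/
noncomputable def cocycle : Gens →ₗ[ℂ] Gens →ₗ[ℂ] Gens := bracketOf cocycleValue

theorem wedgeBracket_single (i j : Label) :
    wedgeBracket (Finsupp.single i 1) (Finsupp.single j 1) =
      ((i.1.1 : ℂ) * j.1.2 - i.1.2 * j.1.1) • gen (i.1.1 + j.1.1 - 1) (i.1.2 + j.1.2 - 1) :=
  bracketOf_single _ i j

theorem wedgeBracket_single_swap (i j : Label) :
    wedgeBracket (Finsupp.single i 1) (Finsupp.single j 1) =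
      - wedgeBracket (Finsupp.single j 1) (Finsupp.single i 1) := by
  rw [wedgeBracket_single, wedgeBracket_single, ← neg_smul, add_comm (i.1.1 : ℤ),
    add_comm (i.1.2 : ℤ)]
  congr 1
  ring

theorem cocycleValue_swap (i j : Label) : cocycleValue i j = - cocycleValue j i := by
  rw [cocycleValue, cocycleValue]
  by_cases h : i.1.1 % 2 = 0 ∧ j.1.1 % 2 = 0
  · rw [if_pos h, if_pos h.symm, neg_zero]
  · rw [if_neg h, if_neg (fun h' => h h'.symm), ← neg_smul, add_comm (i.1.1 : ℤ),
      add_comm (i.1.2 : ℤ)]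
    congr 1
    ring

/-- The family of brackets that deforms the bracket of the wedge algebra. -/
noncomputable def deformedBracket (t : ℂ) : Gens →ₗ[ℂ] Gens →ₗ[ℂ] Gens := wedgeBracket + t • cocycle

theorem deformedBracket_apply (t : ℂ) (x y : Gens) :
    deformedBracket t x y = wedgeBracket x y + t • cocycle x y := rfl

/-- The parity assumption leaves the three cases of the bracket formulas; the odd-even case follows
by antisymmetry of both sides. -/
theorem twistorEquiv_deformedBracket_single (t : ℂ) (i j : Label)
    (hij : i.1.1 % 2 ≤ j.1.1 % 2) :
    twistorEquiv t (deformedBracket t (Finsupp.single i 1) (Finsupp.single j 1)) =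
      fibreBracket ℂ t (twistorEquiv t (Finsupp.single i 1))
        (twistorEquiv t (Finsupp.single j 1)) := by
  obtain ⟨p, q, e, he, h1, h2⟩ := i.exists_eq
  obtain ⟨r, s, f, hf, h3, h4⟩ := j.exists_eq
  have hef : e ≤ f := by lia
  have d1 : i.1.1 / 2 = p := by lia
  have d2 : i.1.2 / 2 = q := by lia
  have d3 : j.1.1 / 2 = r := by lia
  have d4 : j.1.2 / 2 = s := by lia
  rw [twistorEquiv_single, twistorEquiv_single, deformedBracket_apply, cocycle, bracketOf_single,
    wedgeBracket_single, cocycleValue, map_add, map_smul, map_smul, twistorEquiv_gen t (by lia),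
    apply_ite (twistorEquiv t), map_smul, map_zero, twistorEquiv_gen t (by lia), d1, d2, d3, d4,
    h1, h2, h3, h4]
  have hef' : (e = 0 ∧ f = 0) ∨ (e = 0 ∧ f = 1) ∨ (e = 1 ∧ f = 1) := by lia
  rcases hef' with ⟨rfl, rfl⟩ | ⟨rfl, rfl⟩ | ⟨rfl, rfl⟩
  · rw [if_pos (by lia), smul_zero, add_zero]
    push_cast
    simp only [add_zero]
    rw [fibreBracket_twistorGen_even_even]
    congr 1
    · ring
    · congr 1 <;> ring
  · rw [if_neg (by lia)]
    push_cast
    simp only [add_zero]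
    rw [fibreBracket_twistorGen_even_odd, tau_mul]
    congr 1
    · congr 1
      · ring
      · congr 1 <;> ring
    · congr 3 <;> ring
  · rw [if_neg (by lia)]
    push_cast
    rw [fibreBracket_twistorGen_odd_odd, tau_mul]
    congr 1
    · congr 2 <;> ring
    · congr 3 <;> ring

theorem twistorEquiv_deformedBracket (t : ℂ) (x y : Gens) :
    twistorEquiv t (deformedBracket t x y) =
      fibreBracket ℂ t (twistorEquiv t x) (twistorEquiv t y) := by
  refine map_bilinear_of_single (twistorEquiv t).toLinearMap _ _ (fun i j => ?_) x y
  rcases le_total (i.1.1 % 2) (j.1.1 % 2) with h | h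
  · exact twistorEquiv_deformedBracket_single t i j h
  · have h1 := twistorEquiv_deformedBracket_single t j i h
    have h2 : deformedBracket t (Finsupp.single i 1) (Finsupp.single j 1) =
        - deformedBracket t (Finsupp.single j 1) (Finsupp.single i 1) := by
      rw [deformedBracket_apply, deformedBracket_apply, wedgeBracket_single_swap, cocycle,
        bracketOf_single, bracketOf_single, cocycleValue_swap, smul_neg, neg_add]
    simp only [LinearEquiv.coe_coe]
    rw [h2, map_neg, h1, ← fibreBracket_neg_swap]

theorem deformedBracket_isLie (t : ℂ) : IsLieBracket (deformedBracket t) :=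
  (fibreBracket_isLie t).of_injective (twistorEquiv t).toLinearMap (twistorEquiv t).injective
    (twistorEquiv_deformedBracket t)

/-- The wedge algebra is the fibre algebra of the cone `X Y = Z²`. -/
theorem wedgeBracket_isLie : IsLieBracket wedgeBracket := by
  have h := deformedBracket_isLie 0
  rwa [deformedBracket, zero_smul, add_zero] at h

theorem cocycle_self (x : Gens) : cocycle x x = 0 := by
  have h := (deformedBracket_isLie 1).self x
  rwa [deformedBracket_apply, wedgeBracket_isLie.self, zero_add, one_smul] at h

theorem cocycle_swap (x y : Gens) : cocycle x y = - cocycle y x := by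
  have := cocycle_self (x + y)
  simp only [map_add, LinearMap.add_apply, cocycle_self, zero_add, add_zero] at this
  exact eq_neg_of_add_eq_zero_right this

/-- The Jacobi identity of the deformed bracket is quadratic in `t`; subtracting its instances at `t
= 1` and `t = -1` isolates the linear term, which is the cocycle condition. -/
theorem cocycle_jacobi (x y z : Gens) :
    wedgeBracket x (cocycle y z) + cocycle x (wedgeBracket y z) =
      (wedgeBracket (cocycle x y) z + cocycle (wedgeBracket x y) z) +
        (wedgeBracket y (cocycle x z) + cocycle y (wedgeBracket x z)) := by
  have h1 := (deformedBracket_isLie 1).jacobi x y z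
  have h2 := (deformedBracket_isLie (-1)).jacobi x y z
  simp only [deformedBracket_apply, map_add, LinearMap.add_apply, one_smul, neg_smul, map_neg,
    LinearMap.neg_apply] at h1 h2
  have h3 : (2 : ℂ) • (wedgeBracket x (cocycle y z) + cocycle x (wedgeBracket y z)) =
      (2 : ℂ) • ((wedgeBracket (cocycle x y) z + cocycle (wedgeBracket x y) z) +
        (wedgeBracket y (cocycle x z) + cocycle y (wedgeBracket x z))) := by
    linear_combination (norm := module) h1 - h2
  exact (smul_right_inj (two_ne_zero' ℂ)).1 h3

end Wedge

/-! ### The algebra `W(∞)` -/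

section WInfinity

/-- The identification of the vector space with basis the labels with the fibre ring, by the
scattering generators. -/
noncomputable def scatteringEquiv (t : ℂ) : Gens ≃ₗ[ℂ] Fibre ℂ t := (scatteringBasis ℂ t).repr.symm

theorem scatteringEquiv_single (t : ℂ) (i : Label) :
    scatteringEquiv t (Finsupp.single i 1) = scatteringGen ℂ t i.1.1 i.1.2 := by
  rw [scatteringEquiv, Module.Basis.repr_symm_single_one, scatteringBasis_apply]

theorem scatteringEquiv_gen (t : ℂ) {m n : ℤ} (h : m % 2 = n % 2) :
    scatteringEquiv t (gen m n) = scatZ ℂ t m n := by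
  by_cases hmn : 0 ≤ m ∧ 0 ≤ n
  · rw [gen_of_parity hmn.1 hmn.2 (by lia), scatteringEquiv_single, scatZ, if_pos hmn]
  · rw [gen_of_neg (by lia), scatZ_of_neg ℂ t (by lia), map_zero]

theorem Label.exists_sum_eq (i : Label) : ∃ d : ℕ, i.1.1 + i.1.2 = 2 * d :=
  ⟨(i.1.1 + i.1.2) / 2, by have := i.2; lia⟩

theorem wInfCoeff_eq (c : ℂ) (l : ℕ) (i j : Label) {d e : ℕ} (hd : i.1.1 + i.1.2 = 2 * d)
    (he : j.1.1 + j.1.2 = 2 * e) :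
    wInfCoeff c l i j = (c ^ 2) ^ l * coefBracket l i.1.1 i.1.2 j.1.1 j.1.2 d e := by
  have h1 : ((i.1.1 : ℂ) + i.1.2) / 2 = d := by
    rw [← Nat.cast_add, hd]; push_cast; ring
  have h2 : ((j.1.1 : ℂ) + j.1.2) / 2 = e := by
    rw [← Nat.cast_add, he]; push_cast; ring
  rw [wInfCoeff, h1, h2, coefBracket, pow_mul, mul_pow, mul_pow]
  norm_num
  ring

theorem fibreBracket_scatteringGen (A : Type*) [CommRing A] [Algebra ℂ A] (t : A) (i j : Label)
    {d e : ℕ} (hd : i.1.1 + i.1.2 = 2 * d) (he : j.1.1 + j.1.2 = 2 * e) :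
    fibreBracket A t (scatteringGen A t i.1.1 i.1.2) (scatteringGen A t j.1.1 j.1.2) =
      ∑ l ∈ Finset.range (i.1.1 + i.1.2 + 1), coefBracket l i.1.1 i.1.2 j.1.1 j.1.2 d e •
        (tau A t ^ l * scatZ A t (i.1.1 + j.1.1 - 2 * l - 1) (i.1.2 + j.1.2 - 2 * l - 1)) := by
  rw [← scatZ_natCast, ← scatZ_natCast, fibreBracket_scatZ A t hd he]

theorem tau_pow_mul (t : ℂ) (l : ℕ) (x : Fibre ℂ t) : tau ℂ t ^ l * x = t ^ l • x := by
  rw [← map_pow]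
  exact (Algebra.smul_def (R := ℂ) (A := Fibre ℂ t) (t ^ l) x).symm

theorem scatteringEquiv_wInfBracket (c : ℂ) (x y : Gens) :
    scatteringEquiv (c ^ 2) (wInfBracket c x y) =
      fibreBracket ℂ (c ^ 2) (scatteringEquiv (c ^ 2) x) (scatteringEquiv (c ^ 2) y) := by
  refine map_bilinear_of_single (scatteringEquiv (c ^ 2)).toLinearMap _ _ (fun i j => ?_) x y
  simp only [LinearEquiv.coe_coe]
  obtain ⟨d, hd⟩ := i.exists_sum_eq
  obtain ⟨e, he⟩ := j.exists_sum_eq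
  rw [wInfBracket, bracketOf_single, scatteringEquiv_single, scatteringEquiv_single,
    fibreBracket_scatteringGen ℂ _ i j hd he, map_sum]
  refine Finset.sum_congr rfl fun l _ => ?_
  rw [map_smul, scatteringEquiv_gen _ (by have := i.2; have := j.2; lia), wInfCoeff_eq c l i j hd he,
    tau_pow_mul, smul_smul, mul_comm]

theorem wInfBracket_isLie (c : ℂ) : IsLieBracket (wInfBracket c) :=
  (fibreBracket_isLie (c ^ 2)).of_injective (scatteringEquiv (c ^ 2)).toLinearMap
    (scatteringEquiv (c ^ 2)).injective (scatteringEquiv_wInfBracket c)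

/-- The linear automorphism that multiplies each basis vector by a non-zero number. -/
noncomputable def rescale {ι : Type*} (u : ι → ℂ) (hu : ∀ i, u i ≠ 0) : (ι →₀ ℂ) ≃ₗ[ℂ] (ι →₀ ℂ) :=
  (Finsupp.basisSingleOne.unitsSMul fun i => Units.mk0 (u i) (hu i)).repr.symm

theorem rescale_single {ι : Type*} (u : ι → ℂ) (hu : ∀ i, u i ≠ 0) (i : ι) :
    rescale u hu (Finsupp.single i 1) = u i • Finsupp.single i 1 := by
  rw [rescale, Module.Basis.repr_symm_single_one, Module.Basis.unitsSMul_apply]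
  simp [Units.smul_def]

/-- The weight of the basis vector with the given label under rescaling of the parameter. -/
noncomputable def scalingWeight (c : ℂ) (i : Label) : ℂ :=
  c ^ ((((i.1.1 + i.1.2) / 2 : ℕ) : ℤ) - 1)

theorem scalingWeight_ne_zero {c : ℂ} (hc : c ≠ 0) (i : Label) : scalingWeight c i ≠ 0 :=
  zpow_ne_zero _ hc

theorem rescale_gen {c : ℂ} (hc : c ≠ 0) {m n k : ℤ} (h : m + n = 2 * k) :
    rescale (scalingWeight c) (scalingWeight_ne_zero hc) (gen m n) = c ^ (k - 1) • gen m n := by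
  by_cases hmn : 0 ≤ m ∧ 0 ≤ n
  · rw [gen_of_parity hmn.1 hmn.2 (by lia), rescale_single, scalingWeight]
    congr 3
    simp only
    lia
  · rw [gen_of_neg (by lia), map_zero, smul_zero]

theorem wInfCoeff_eq_pow_mul (c : ℂ) (l : ℕ) (i j : Label) :
    wInfCoeff c l i j = c ^ (2 * l) * wInfCoeff 1 l i j := by
  rw [wInfCoeff, wInfCoeff, mul_pow, mul_one]
  ring

/-- The term with index `l` has degree `d + e - 2 l - 1`, so its weight `c ^ (d + e - 2 l - 2)` and
the factor `c ^ (2 l)` combine to `c ^ (d - 1) c ^ (e - 1)`. -/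
theorem rescale_wInfBracket {c : ℂ} (hc : c ≠ 0) (x y : Gens) :
    rescale (scalingWeight c) (scalingWeight_ne_zero hc) (wInfBracket c x y) =
      wInfBracket 1 (rescale (scalingWeight c) (scalingWeight_ne_zero hc) x)
        (rescale (scalingWeight c) (scalingWeight_ne_zero hc) y) := by
  refine map_bilinear_of_single
    (rescale (scalingWeight c) (scalingWeight_ne_zero hc)).toLinearMap _ _ (fun i j => ?_) x y
  simp only [LinearEquiv.coe_coe]
  obtain ⟨d, hd⟩ := i.exists_sum_eq
  obtain ⟨e, he⟩ := j.exists_sum_eq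
  rw [rescale_single, rescale_single, map_smul, map_smul, LinearMap.smul_apply, wInfBracket,
    wInfBracket, bracketOf_single, bracketOf_single, map_sum, Finset.smul_sum, Finset.smul_sum]
  refine Finset.sum_congr rfl fun l _ => ?_
  rw [map_smul, rescale_gen hc (k := d + e - 2 * l - 1) (by lia), smul_smul, smul_smul, smul_smul,
    wInfCoeff_eq_pow_mul c, scalingWeight, scalingWeight, hd, he]
  congr 1
  have h1 : 2 * d / 2 = d := by lia
  have h2 : 2 * e / 2 = e := by lia
  have h3 : c ^ (2 * l) = c ^ ((2 * l : ℕ) : ℤ) := (zpow_natCast c _).symm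
  rw [h1, h2, h3, mul_right_comm, ← zpow_add₀ hc, ← zpow_add₀ hc]
  congr 2
  push_cast
  ring

end WInfinity

/-! ### The celestial chiral algebra -/

section Celestial

theorem modeGen_of_parity {a m n : ℤ} (hm : 0 ≤ m) (hn : 0 ≤ n) (h : m.toNat % 2 = n.toNat % 2) :
    modeGen a m n = Finsupp.single (a, ⟨(m.toNat, n.toNat), h⟩) 1 := dif_pos ⟨h, hm, hn⟩

theorem modeGen_of_neg {a m n : ℤ} (h : m < 0 ∨ n < 0) : modeGen a m n = 0 := dif_neg (by lia)

/-- The products of the powers of the loop coordinate with the scattering generators, as a basis of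
the ring of functions on the family of fibres. -/
noncomputable def loopBasis (t : ℂ[T;T⁻¹]) : Module.Basis (ℤ × Label) ℂ (Fibre ℂ[T;T⁻¹] t) :=
  Module.Basis.smulTower (AddMonoidAlgebra.basis ℤ ℂ : Module.Basis ℤ ℂ ℂ[T;T⁻¹])
    (scatteringBasis ℂ[T;T⁻¹] t)

theorem loopBasis_apply (t : ℂ[T;T⁻¹]) (a : ℤ) (i : Label) :
    loopBasis t (a, i) =
      (LaurentPolynomial.T a : ℂ[T;T⁻¹]) • scatteringGen ℂ[T;T⁻¹] t i.1.1 i.1.2 := by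
  rw [loopBasis, Module.Basis.smulTower_apply, scatteringBasis_apply, AddMonoidAlgebra.basis_apply]
  rfl

/-- The linear map from the modes of the celestial chiral algebra to the functions on the family of
fibres. -/
noncomputable def celestialEquiv (t : ℂ[T;T⁻¹]) :
    (ℤ × Label →₀ ℂ) ≃ₗ[ℂ] Fibre ℂ[T;T⁻¹] t :=
  rescale (fun _ => -1 / 2) (fun _ => by norm_num) ≪≫ₗ (loopBasis t).repr.symm

theorem celestialEquiv_single (t : ℂ[T;T⁻¹]) (a : ℤ) (i : Label) :
    celestialEquiv t (Finsupp.single (a, i) 1) =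
      (-1 / 2 : ℂ) • ((LaurentPolynomial.T a : ℂ[T;T⁻¹]) •
        scatteringGen ℂ[T;T⁻¹] t i.1.1 i.1.2) := by
  rw [celestialEquiv, LinearEquiv.trans_apply, rescale_single, map_smul,
    Module.Basis.repr_symm_single_one, loopBasis_apply]

theorem celestialEquiv_modeGen (t : ℂ[T;T⁻¹]) (a : ℤ) {m n : ℤ} (h : m % 2 = n % 2) :
    celestialEquiv t (modeGen a m n) =
      (-1 / 2 : ℂ) • ((LaurentPolynomial.T a : ℂ[T;T⁻¹]) • scatZ ℂ[T;T⁻¹] t m n) := by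
  by_cases hmn : 0 ≤ m ∧ 0 ≤ n
  · rw [modeGen_of_parity hmn.1 hmn.2 (by lia), celestialEquiv_single, scatZ, if_pos hmn]
  · rw [modeGen_of_neg (by lia), scatZ_of_neg _ t (by lia), map_zero, smul_zero, smul_zero]

theorem loopParam_pow (c : ℂ) (l : ℕ) :
    loopParam c ^ l = (c ^ 2) ^ l • (LaurentPolynomial.T (2 * l) : ℂ[T;T⁻¹]) := by
  rw [loopParam, mul_pow, mul_pow, ← map_pow, ← map_pow, LaurentPolynomial.T_pow,
    LaurentPolynomial.T_pow, LaurentPolynomial.smul_eq_C_mul]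
  congr 2
  push_cast
  ring

theorem tau_loopParam_pow_mul (c : ℂ) (l : ℕ) (x : Fibre ℂ[T;T⁻¹] (loopParam c)) :
    tau ℂ[T;T⁻¹] (loopParam c) ^ l * x =
      (c ^ 2) ^ l • ((LaurentPolynomial.T (2 * l) : ℂ[T;T⁻¹]) • x) := by
  rw [← map_pow, ← smul_assoc, ← loopParam_pow]
  exact (Algebra.smul_def (R := ℂ[T;T⁻¹]) (A := Fibre ℂ[T;T⁻¹] (loopParam c)) _ x).symm

/-- The powers `(c² z²) ^ l` in the bracket over Laurent polynomials account for the mode shift `a +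
b + 2 l`, and the factor `-1/2` of the map squares to match the `-1/2` of the operator product. -/
theorem celestialEquiv_ccaBracket (c : ℂ) (x y : ℤ × Label →₀ ℂ) :
    celestialEquiv (loopParam c) (ccaBracket c x y) =
      fibreBracket ℂ[T;T⁻¹] (loopParam c) (celestialEquiv (loopParam c) x)
        (celestialEquiv (loopParam c) y) := by
  refine map_bilinear_of_single (celestialEquiv (loopParam c)).toLinearMap _ _ ?_ x y
  rintro ⟨a, i⟩ ⟨b, j⟩
  simp only [LinearEquiv.coe_coe]
  obtain ⟨d, hd⟩ := i.exists_sum_eq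
  obtain ⟨e, he⟩ := j.exists_sum_eq
  rw [ccaBracket, bracketOf_single, celestialEquiv_single, celestialEquiv_single, map_smul,
    map_smul, map_smul (fibreBracket _ _), LinearMap.smul_apply, map_sum, fibreBracket_smul_left,
    fibreBracket_smul_right, fibreBracket_scatteringGen _ _ i j hd he]
  simp only [Finset.smul_sum]
  refine Finset.sum_congr rfl fun l _ => ?_
  rw [map_smul, celestialEquiv_modeGen _ _ (by have := i.2; have := j.2; lia),
    wInfCoeff_eq c l i j hd he, tau_loopParam_pow_mul, LaurentPolynomial.T_add,
    LaurentPolynomial.T_add]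
  generalize scatZ ℂ[T;T⁻¹] (loopParam c) _ _ = w
  simp only [mul_smul, smul_comm (_ : ℂ[T;T⁻¹]) (_ : ℂ)]
  simp only [smul_smul]
  congr 1
  ring

theorem ccaBracket_isLie (c : ℂ) : IsLieBracket (ccaBracket c) :=
  (fibreBracket_isLie (loopParam c)).of_injective (celestialEquiv (loopParam c)).toLinearMap
    (celestialEquiv (loopParam c)).injective (celestialEquiv_ccaBracket c)

theorem map_lie_of_single {ι L : Type*} [LieRing L] [LieAlgebra ℂ L] (f : (ι →₀ ℂ) →ₗ[ℂ] L)
    (B : (ι →₀ ℂ) →ₗ[ℂ] (ι →₀ ℂ) →ₗ[ℂ] (ι →₀ ℂ))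
    (h : ∀ i j, f (B (Finsupp.single i 1) (Finsupp.single j 1)) =
      ⁅f (Finsupp.single i 1), f (Finsupp.single j 1)⁆) (x y : ι →₀ ℂ) : f (B x y) = ⁅f x, f y⁆ :=
  map_bilinear_of_single f B
    (LinearMap.mk₂ ℂ (fun x y => ⁅x, y⁆) add_lie smul_lie lie_add fun r x y => lie_smul r x y) h x y

theorem lie_smul_smul {L : Type*} [LieRing L] [LieAlgebra ℂ L] (u v : ℂ) (x y : L) :
    ⁅u • x, v • y⁆ = (u * v) • ⁅x, y⁆ := by
  rw [smul_lie, lie_smul, smul_smul]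

theorem wInfBracket_single (c : ℂ) (i j : Label) :
    wInfBracket c (Finsupp.single i 1) (Finsupp.single j 1) =
      ∑ l ∈ Finset.range (i.1.1 + i.1.2 + 1), wInfCoeff c l i j •
        gen (i.1.1 + j.1.1 - 2 * l - 1) (i.1.2 + j.1.2 - 2 * l - 1) :=
  bracketOf_single _ i j

/-- The shift of the mode number by the weight of the label. -/
def modeShift : ℤ × Label ≃ ℤ × Label where
  toFun u := (u.1 + ((u.2.1.1 + u.2.1.2) / 2 : ℕ) - 1, u.2)
  invFun u := (u.1 - ((u.2.1.1 + u.2.1.2) / 2 : ℕ) + 1, u.2)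
  left_inv u := Prod.ext (by simp only; ring) rfl
  right_inv u := Prod.ext (by simp only; ring) rfl

/-- The linear map from the modes of the celestial chiral algebra to the loop algebra of `W(∞)`. -/
noncomputable def celestialLoopEquiv {c : ℂ} (hc : c ≠ 0) (h : IsLieBracket (wInfBracket 1)) :
    (ℤ × Label →₀ ℂ) ≃ₗ[ℂ] LieAlgebra.loopAlgebra ℂ ℤ (LieOf (wInfBracket 1) h) :=
  rescale (fun u => -1 / 2 * scalingWeight c u.2)
      (fun u => mul_ne_zero (by norm_num) (scalingWeight_ne_zero hc u.2)) ≪≫ₗ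
    (((AddMonoidAlgebra.basis ℤ ℂ).tensorProduct
      (Finsupp.basisSingleOne.map (LieOf.of h))).reindex modeShift.symm).repr.symm

theorem celestialLoopEquiv_single {c : ℂ} (hc : c ≠ 0) (h : IsLieBracket (wInfBracket 1)) (a : ℤ)
    (i : Label) : celestialLoopEquiv hc h (Finsupp.single (a, i) 1) =
      (-1 / 2 * scalingWeight c i) •
        ((AddMonoidAlgebra.single (a + (((i.1.1 + i.1.2) / 2 : ℕ) : ℤ) - 1) 1 :
          AddMonoidAlgebra ℂ ℤ) ⊗ₜ[ℂ] LieOf.of h (Finsupp.single i 1)) := by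
  rw [celestialLoopEquiv, LinearEquiv.trans_apply, rescale_single, map_smul,
    Module.Basis.repr_symm_single_one, Module.Basis.reindex_apply, Equiv.symm_symm,
    Module.Basis.tensorProduct_apply', AddMonoidAlgebra.basis_apply]
  simp [modeShift]

theorem celestialLoopEquiv_modeGen {c : ℂ} (hc : c ≠ 0) (h : IsLieBracket (wInfBracket 1)) (a : ℤ)
    {m n k : ℤ} (hk : m + n = 2 * k) : celestialLoopEquiv hc h (modeGen a m n) =
      (-1 / 2 * c ^ (k - 1)) • ((AddMonoidAlgebra.single (a + k - 1) 1 :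
          AddMonoidAlgebra ℂ ℤ) ⊗ₜ[ℂ] LieOf.of h (gen m n)) := by
  by_cases hmn : 0 ≤ m ∧ 0 ≤ n
  · have e : (((m.toNat + n.toNat) / 2 : ℕ) : ℤ) = k := by lia
    rw [modeGen_of_parity hmn.1 hmn.2 (by lia), celestialLoopEquiv_single, scalingWeight]
    simp only [e]
    rw [gen_of_parity hmn.1 hmn.2 (by lia)]
  · rw [modeGen_of_neg (by lia), gen_of_neg (by lia), map_zero, map_zero, TensorProduct.tmul_zero,
      smul_zero]

/-- The rescaling of `rescale_wInfBracket` with `c` replaced by `c z`: the shift of the mode by `d -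
1` absorbs `z ^ (2 l)` just as the weight `c ^ (d - 1)` absorbs `c ^ (2 l)`. -/
theorem celestialLoopEquiv_ccaBracket {c : ℂ} (hc : c ≠ 0) (h : IsLieBracket (wInfBracket 1))
    (x y : ℤ × Label →₀ ℂ) : celestialLoopEquiv hc h (ccaBracket c x y) =
      ⁅celestialLoopEquiv hc h x, celestialLoopEquiv hc h y⁆ := by
  refine map_lie_of_single (celestialLoopEquiv hc h).toLinearMap _ ?_ x y
  rintro ⟨a, i⟩ ⟨b, j⟩
  simp only [LinearEquiv.coe_coe]
  obtain ⟨d, hd⟩ := i.exists_sum_eq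
  obtain ⟨e, he⟩ := j.exists_sum_eq
  have h1 : (((i.1.1 + i.1.2) / 2 : ℕ) : ℤ) = d := by lia
  have h2 : (((j.1.1 + j.1.2) / 2 : ℕ) : ℤ) = e := by lia
  rw [ccaBracket, bracketOf_single, celestialLoopEquiv_single, celestialLoopEquiv_single, map_smul,
    map_sum]
  refine Eq.trans ?_ (lie_smul_smul
    (L := LieAlgebra.loopAlgebra ℂ ℤ (LieOf (wInfBracket 1) h)) _ _ _ _).symm
  rw [LieAlgebra.ExtendScalars.bracket_tmul, LieOf.lie_of,
    wInfBracket_single, map_sum, TensorProduct.tmul_sum, AddMonoidAlgebra.single_mul_single]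
  simp only [Finset.smul_sum]
  refine Finset.sum_congr rfl fun l _ => ?_
  rw [map_smul, celestialLoopEquiv_modeGen hc h _ (k := d + e - 2 * l - 1) (by lia), map_smul,
    TensorProduct.tmul_smul, wInfCoeff_eq_pow_mul c, scalingWeight, scalingWeight, h1, h2]
  have h3 : c ^ (2 * l) = c ^ ((2 * l : ℕ) : ℤ) := (zpow_natCast c _).symm
  have h4 : a + b + 2 * l + ((d : ℤ) + e - 2 * l - 1) - 1 = a + d - 1 + (b + e - 1) := by ring
  have h5 : c ^ ((2 * l : ℕ) : ℤ) * c ^ ((d : ℤ) + e - 2 * l - 1 - 1) =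
      c ^ ((d : ℤ) - 1) * c ^ ((e : ℤ) - 1) := by
    rw [← zpow_add₀ hc, ← zpow_add₀ hc]
    congr 1
    push_cast
    ring
  rw [h4, mul_one, smul_smul, smul_smul, smul_smul, h3]
  congr 1
  linear_combination (1 / 4 * wInfCoeff 1 l i j) * h5

end Celestial

/-! ### The cocycle is not a coboundary -/

section Cohomology

open LieModule.Cohomology

theorem gen_apply (m n : ℤ) (k : Label) : gen m n k = if k.1.1 = m ∧ k.1.2 = n then 1 else 0 := by
  by_cases h : k.1.1 = m ∧ k.1.2 = n
  · rw [if_pos h, ← h.1, ← h.2, gen_natCast, Finsupp.single_eq_same]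
  · rw [if_neg h, gen]
    split_ifs with h'
    · refine Finsupp.single_eq_of_ne fun hk => h ?_
      rw [hk]
      exact ⟨Int.toNat_of_nonneg h'.2.1, Int.toNat_of_nonneg h'.2.2⟩
    · rfl

/-- Bracketing with a generator translates labels by a fixed vector, so the coefficient at `k` comes
from the single label `j`. -/
theorem wedgeBracket_single_apply {i j k : Label} (h1 : i.1.1 + j.1.1 = k.1.1 + 1)
    (h2 : i.1.2 + j.1.2 = k.1.2 + 1) (x : Gens) :
    wedgeBracket (Finsupp.single i 1) x k = ((i.1.1 : ℂ) * j.1.2 - i.1.2 * j.1.1) * x j := by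
  have : Finsupp.lapply k ∘ₗ wedgeBracket (Finsupp.single i 1) =
      ((i.1.1 : ℂ) * j.1.2 - i.1.2 * j.1.1) • Finsupp.lapply j := by
    ext j'
    simp only [LinearMap.comp_apply, Finsupp.lsingle_apply, Finsupp.lapply_apply,
      LinearMap.smul_apply, wedgeBracket_single, Finsupp.smul_apply, gen_apply, smul_eq_mul]
    by_cases hj : j' = j
    · rw [hj, if_pos (by lia), Finsupp.single_eq_same]
    · rw [Finsupp.single_eq_of_ne' hj, if_neg, mul_zero, mul_zero]
      intro h
      exact hj (Subtype.ext (Prod.ext (by lia) (by lia)))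
  exact LinearMap.congr_fun this x

theorem wedgeBracket_single_apply_eq_zero {i k : Label}
    (h : k.1.1 + 1 < i.1.1 ∨ k.1.2 + 1 < i.1.2) (x : Gens) :
    wedgeBracket (Finsupp.single i 1) x k = 0 := by
  have : Finsupp.lapply k ∘ₗ wedgeBracket (Finsupp.single i 1) = 0 := by
    ext j
    simp only [LinearMap.comp_apply, Finsupp.lsingle_apply, Finsupp.lapply_apply,
      wedgeBracket_single, Finsupp.smul_apply, gen_apply, smul_eq_mul]
    rw [if_neg (by lia), mul_zero, LinearMap.zero_apply]
  exact LinearMap.congr_fun this x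

/-- The label `(m, n)`. -/
abbrev label (m n : ℕ) (h : m % 2 = n % 2 := by decide) : Label := ⟨(m, n), h⟩

theorem wedgeBracket_label (m n p q a b : ℕ) (h : m % 2 = n % 2) (h' : p % 2 = q % 2)
    (h'' : a % 2 = b % 2) (ha : m + p = a + 1) (hb : n + q = b + 1) :
    wedgeBracket (Finsupp.single (label m n h) 1) (Finsupp.single (label p q h') 1) =
      ((m : ℂ) * q - n * p) • Finsupp.single (label a b h'') 1 := by
  rw [wedgeBracket_single, ← gen_natCast]
  congr 2 <;> lia

theorem cocycle_not_coboundary (η : Gens →ₗ[ℂ] Gens) : ¬ ∀ i j : Label,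
    wedgeBracket (Finsupp.single i 1) (η (Finsupp.single j 1)) -
      wedgeBracket (Finsupp.single j 1) (η (Finsupp.single i 1)) -
      η (wedgeBracket (Finsupp.single i 1) (Finsupp.single j 1)) = cocycleValue i j := by
  intro h
  -- The pairs are chosen so that almost all terms with `η` vanish for degree reasons. With `a` the
  -- coefficient of `w[0, 2]` in `η w[2, 4]` and `b` that of `w[1, 1]` in `η w[3, 3]`, the equations
  -- read `-10 a = 8`, `4 a - 8 b = 0` and `-16 b = 0`.
  have h1 := DFunLike.congr_fun (h (label 2 0) (label 1 5)) (label 0 2)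
  have h2 := DFunLike.congr_fun (h (label 2 0) (label 2 4)) (label 1 1)
  have h3 := DFunLike.congr_fun (h (label 4 0) (label 0 4)) (label 1 1)
  rw [wedgeBracket_label 2 0 1 5 2 4 rfl rfl rfl rfl rfl, Finsupp.sub_apply, Finsupp.sub_apply,
    wedgeBracket_single_apply_eq_zero (by simp), wedgeBracket_single_apply_eq_zero (by simp),
    map_smul, cocycleValue, if_neg (by simp), Finsupp.smul_apply, Finsupp.smul_apply, gen_apply]
    at h1
  rw [wedgeBracket_label 2 0 2 4 3 3 rfl rfl rfl rfl rfl, Finsupp.sub_apply, Finsupp.sub_apply,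
    wedgeBracket_single_apply (j := label 0 2) rfl rfl,
    wedgeBracket_single_apply_eq_zero (by simp), map_smul, cocycleValue, if_pos (by simp),
    Finsupp.smul_apply] at h2
  rw [wedgeBracket_label 4 0 0 4 3 3 rfl rfl rfl rfl rfl, Finsupp.sub_apply, Finsupp.sub_apply,
    wedgeBracket_single_apply_eq_zero (by simp), wedgeBracket_single_apply_eq_zero (by simp),
    map_smul, cocycleValue, if_pos (by simp), Finsupp.smul_apply] at h3
  norm_num at h1 h2 h3
  rw [h3] at h2
  norm_num at h2
  rw [h2] at h1
  norm_num at h1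

/-- The cocycle of the deformation, as a `2`-cochain of the wedge algebra. -/
noncomputable def deformationCochain :
    twoCochain ℂ (LieOf wedgeBracket wedgeBracket_isLie) (LieOf wedgeBracket wedgeBracket_isLie) :=
  ⟨(cocycle.compr₂ (LieOf.of wedgeBracket_isLie).toLinearMap).compl₁₂
    (LieOf.of wedgeBracket_isLie).symm.toLinearMap (LieOf.of wedgeBracket_isLie).symm.toLinearMap,
    fun x => cocycle_self ((LieOf.of wedgeBracket_isLie).symm x)⟩

theorem deformationCochain_of (x y : Gens) :
    deformationCochain (LieOf.of wedgeBracket_isLie x) (LieOf.of wedgeBracket_isLie y) =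
      LieOf.of wedgeBracket_isLie (cocycle x y) := rfl

theorem deformationCochain_single (i j : Label) :
    deformationCochain (LieOf.of wedgeBracket_isLie (Finsupp.single i 1))
      (LieOf.of wedgeBracket_isLie (Finsupp.single j 1)) =
        LieOf.of wedgeBracket_isLie (cocycleValue i j) := by
  rw [deformationCochain_of, cocycle, bracketOf_single]

theorem deformationCochain_mem_twoCocycle : deformationCochain ∈
    twoCocycle ℂ (LieOf wedgeBracket wedgeBracket_isLie)
      (LieOf wedgeBracket wedgeBracket_isLie) := by
  rw [mem_twoCocycle_iff]
  ext x y z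
  obtain ⟨x, rfl⟩ := (LieOf.of wedgeBracket_isLie).surjective x
  obtain ⟨y, rfl⟩ := (LieOf.of wedgeBracket_isLie).surjective y
  obtain ⟨z, rfl⟩ := (LieOf.of wedgeBracket_isLie).surjective z
  simp only [d₂₃_apply, LieOf.lie_of, deformationCochain_of, LinearMap.zero_apply]
  simp only [← map_add, ← map_sub]
  refine (LinearEquiv.map_eq_zero_iff _).2 ?_
  have h := cocycle_jacobi x y z
  rw [wedgeBracket_isLie.swap z (cocycle x y), cocycle_swap (wedgeBracket x z) y,
    cocycle_swap (wedgeBracket y z) x]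
  linear_combination (norm := module) h

theorem deformationCochain_notMem_range : deformationCochain ∉ LinearMap.range
    (d₁₂ ℂ (LieOf wedgeBracket wedgeBracket_isLie) (LieOf wedgeBracket wedgeBracket_isLie)) := by
  rintro ⟨η, hη⟩
  refine cocycle_not_coboundary ((LieOf.of wedgeBracket_isLie).symm.toLinearMap ∘ₗ η ∘ₗ
    (LieOf.of wedgeBracket_isLie).toLinearMap) fun i j => ?_
  have h := congrArg (fun a : twoCochain ℂ (LieOf wedgeBracket wedgeBracket_isLie)
    (LieOf wedgeBracket wedgeBracket_isLie) => a (LieOf.of wedgeBracket_isLie (Finsupp.single i 1))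
      (LieOf.of wedgeBracket_isLie (Finsupp.single j 1))) hη
  simp only [deformationCochain_single, d₁₂_apply_apply] at h
  exact h

end Cohomology

/-! ### The fibre algebra is not isomorphic to the wedge algebra -/

section Ideals

variable {t : ℂ} (J : Submodule ℂ (Fibre ℂ t))

/-- Two routes from `X ^ (k + 2)` inside the ideal lead to independent combinations of `X ^ (k + 2)
Y` and `t X ^ (k + 1)`. Eliminating the former leaves `32 (k + 1) (k + 2) (k + 3) t X ^ (k + 1)`,
and `t ≠ 0` is needed to divide. -/
theorem pow_pred_mem_of_pow_mem (ht : t ≠ 0) (hJ : ∀ y, ∀ x ∈ J, fibreBracket ℂ t y x ∈ J) (k : ℕ)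
    (hk : coX ℂ t ^ (k + 2) ∈ J) : coX ℂ t ^ (k + 1) ∈ J := by
  have hXX := fibreBracket_self ℂ t (coX ℂ t)
  have hXZ := fibreBracket_coX_coZ ℂ t
  have hXY := fibreBracket_coX_coY ℂ t
  have hYZ := fibreBracket_coY_coZ ℂ t
  have hpow : ∀ n : ℕ, ∀ y, fibreBracket ℂ t (coX ℂ t ^ (n + 1)) y =
      (n + 1) * (coX ℂ t ^ n * fibreBracket ℂ t (coX ℂ t) y) := fun n y => by
    rw [fibreBracket_pow_left, ← natCast_mul_eq_smul (R := Fibre ℂ t)]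
    push_cast
    ring
  have hJ' : ∀ y, ∀ x ∈ J, fibreBracket ℂ t x y ∈ J := fun y x hx => by
    rw [fibreBracket_neg_swap]
    exact J.neg_mem (hJ y x hx)
  have hn : ∀ n : ℕ, ((n : ℂ) + 1) ≠ 0 := fun n => Nat.cast_add_one_ne_zero n
  have h1 : coX ℂ t ^ (k + 3) ∈ J := by
    have h := hJ' (coX ℂ t * coZ ℂ t) _ hk
    rw [hpow, fibreBracket_leibniz, hXX, hXZ] at h
    refine (J.smul_mem_iff (show (2 * (((k + 1 : ℕ) : ℂ) + 1)) ≠ 0 from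
      mul_ne_zero two_ne_zero (hn _))).1 ?_
    convert h using 1
    rw [smul_eq_algebraMap_mul]
    simp only [map_mul, map_add, map_natCast, map_one, map_ofNat]
    ring
  -- First route: up to `X ^ (k + 3)` by bracketing with `X Z`, then down two weights by `ad Y`.
  have h2 := hJ (coY ℂ t) _ (hJ (coY ℂ t) _ h1)
  have e2 : fibreBracket ℂ t (coY ℂ t) (fibreBracket ℂ t (coY ℂ t) (coX ℂ t ^ (k + 3))) =
      4 * (k + 3) * ((4 * k + 10) * (coX ℂ t ^ (k + 2) * coY ℂ t) +
        4 * (k + 2) * (tau ℂ t * coX ℂ t ^ (k + 1))) := by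
    have h : fibreBracket ℂ t (coY ℂ t) (coX ℂ t ^ (k + 3)) =
        (-(4 * (k + 3 : ℕ)) : ℂ) • (coX ℂ t ^ (k + 2) * coZ ℂ t) := by
      rw [fibreBracket_neg_swap, hpow, hXY, smul_eq_algebraMap_mul]
      simp only [map_mul, map_neg, map_natCast, map_ofNat]
      push_cast
      ring
    rw [h, map_smul, fibreBracket_leibniz, hYZ, fibreBracket_neg_swap, hpow, hXY,
      smul_eq_algebraMap_mul]
    simp only [map_mul, map_neg, map_natCast, map_ofNat]
    push_cast
    linear_combination (16 * ((k : Fibre ℂ t) + 3) * (k + 2) * coX ℂ t ^ (k + 1)) * coZ_sq ℂ t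
  have h3 := hJ' (coY ℂ t * coZ ℂ t) _ hk
  have e3 : fibreBracket ℂ t (coX ℂ t ^ (k + 2)) (coY ℂ t * coZ ℂ t) =
      (k + 2) * (6 * (coX ℂ t ^ (k + 2) * coY ℂ t) + 4 * (tau ℂ t * coX ℂ t ^ (k + 1))) := by
    rw [hpow, fibreBracket_leibniz, hXZ, hXY]
    push_cast
    linear_combination (4 * ((k : Fibre ℂ t) + 2) * coX ℂ t ^ (k + 1)) * coZ_sq ℂ t
  have hne : 32 * (((k + 2 : ℕ) : ℂ) + 1) * (((k + 1 : ℕ) : ℂ) + 1) * ((k : ℂ) + 1) * t ≠ 0 :=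
    mul_ne_zero (mul_ne_zero (mul_ne_zero (mul_ne_zero (by norm_num) (hn _)) (hn _)) (hn _)) ht
  refine (J.smul_mem_iff hne).1 ?_
  convert J.sub_mem (J.smul_mem (6 * ((k : ℂ) + 2)) h2)
    (J.smul_mem (4 * ((k : ℂ) + 3) * (4 * k + 10)) h3) using 1
  rw [e2, e3, smul_eq_algebraMap_mul, smul_eq_algebraMap_mul, smul_eq_algebraMap_mul]
  simp only [map_mul, map_add, map_natCast, map_one, map_ofNat]
  push_cast
  ring

theorem coX_mem_of_pow_mem (ht : t ≠ 0) (hJ : ∀ y, ∀ x ∈ J, fibreBracket ℂ t y x ∈ J) (k : ℕ)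
    (hk : coX ℂ t ^ (k + 1) ∈ J) : coX ℂ t ∈ J := by
  induction k with
  | zero => simpa using hk
  | succ k ih => exact ih (pow_pred_mem_of_pow_mem J ht hJ k hk)

theorem fibreBracket_coZ_aeval (g : Polynomial ℂ) :
    fibreBracket ℂ t (coZ ℂ t) (Polynomial.aeval (coX ℂ t) g) =
      Polynomial.aeval (coX ℂ t) (-(2 : ℂ) • (Polynomial.X * Polynomial.derivative g)) := by
  rw [← hamiltonian_apply, Derivation.map_aeval, hamiltonian_apply, fibreBracket_neg_swap,
    fibreBracket_coX_coZ, map_smul, map_mul, Polynomial.aeval_X, smul_eq_algebraMap_mul]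
  simp only [map_neg, map_ofNat, smul_eq_mul]
  ring

open Polynomial in
-- On polynomials in `X`, `ad Z` is `-2` times the Euler operator, whose eigenvectors are the
-- powers. Subtracting it from `D + 1` times the identity kills the top term, so the degree can be
-- reduced until one power is isolated.
theorem exists_pow_mem_of_aeval_mem (hJ : ∀ y, ∀ x ∈ J, fibreBracket ℂ t y x ∈ J) (D : ℕ) :
    ∀ g : ℂ[X], g.natDegree = D + 1 → aeval (coX ℂ t) g ∈ J → ∃ k, coX ℂ t ^ (k + 1) ∈ J := by
  induction D using Nat.strong_induction_on with
  | _ D ih =>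
    intro g hg hgJ
    have hder : aeval (coX ℂ t) (X * derivative g) ∈ J := by
      have h := hJ (coZ ℂ t) _ hgJ
      rw [fibreBracket_coZ_aeval, map_smul] at h
      exact (J.smul_mem_iff (by norm_num)).1 h
    set q := ((D : ℂ) + 1) • g - X * derivative g with hq
    have hqJ : aeval (coX ℂ t) q ∈ J := by
      rw [hq, map_sub, map_smul]
      exact J.sub_mem (J.smul_mem _ hgJ) hder
    have hcoeff : ∀ n, (X * derivative g).coeff n = n * g.coeff n := by
      rintro (_ | n)
      · simp
      · rw [coeff_X_mul, coeff_derivative]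
        push_cast
        ring
    have hqc : ∀ n, q.coeff n = ((D : ℂ) + 1 - n) * g.coeff n := fun n => by
      rw [hq, coeff_sub, coeff_smul, hcoeff, smul_eq_mul]
      ring
    have hqd : q.natDegree ≤ D := by
      rw [natDegree_le_iff_coeff_eq_zero]
      intro n hn
      rw [hqc]
      rcases (Nat.succ_le_of_lt hn).eq_or_lt with h | h
      · rw [← h]
        push_cast
        ring
      · rw [coeff_eq_zero_of_natDegree_lt (by lia), mul_zero]
    -- If `q` is constant, then `g` is a constant plus a multiple of `X ^ (D + 1)`, and `X g'`,
    -- already in the ideal, is that power up to a non-zero factor.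
    rcases Nat.eq_zero_or_pos q.natDegree with h0 | h0
    · refine ⟨D, ?_⟩
      have hlead : g.coeff (D + 1) ≠ 0 := by
        rw [← hg]
        exact leadingCoeff_ne_zero.2 fun h => by simp [h] at hg
      have e : X * derivative g = (((D : ℂ) + 1) * g.coeff (D + 1)) • X ^ (D + 1) := by
        ext n
        rw [hcoeff, coeff_smul, coeff_X_pow, smul_eq_mul]
        split_ifs with hn
        · rw [hn]
          push_cast
          ring
        · rcases n with _ | n
          · simp
          · have h1 := hqc (n + 1)
            rw [coeff_eq_zero_of_natDegree_lt (by lia)] at h1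
            rcases mul_eq_zero.1 h1.symm with h2 | h2
            · exfalso
              refine hn ?_
              have h3 : ((D + 1 : ℕ) : ℂ) = (n + 1 : ℕ) := by
                push_cast at h2 ⊢
                linear_combination h2
              exact (Nat.cast_injective h3).symm
            · rw [h2, mul_zero, mul_zero]
      rw [e, map_smul, map_pow, aeval_X] at hder
      exact (J.smul_mem_iff (mul_ne_zero (Nat.cast_add_one_ne_zero D) hlead)).1 hder
    · exact ih (q.natDegree - 1) (by lia) q (by lia) hqJ

/-- The action of `X` on the scattering generators. -/
noncomputable def raise : Gens →ₗ[ℂ] Gens :=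
  Finsupp.linearCombination ℂ fun i : Label => (2 * i.1.2 : ℂ) • gen (i.1.1 + 1) (i.1.2 - 1)

theorem raise_single (i : Label) : raise (Finsupp.single i 1) =
    (2 * i.1.2 : ℂ) • gen (i.1.1 + 1) (i.1.2 - 1) := by
  simp [raise]

theorem scatteringEquiv_raise (x : Gens) : scatteringEquiv t (raise x) =
    fibreBracket ℂ t (coX ℂ t) (scatteringEquiv t x) := by
  have : (scatteringEquiv t).toLinearMap ∘ₗ raise =
      fibreBracket ℂ t (coX ℂ t) ∘ₗ (scatteringEquiv t).toLinearMap := by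
    ext i
    obtain ⟨d, hd⟩ := i.exists_sum_eq
    simp only [LinearMap.comp_apply, Finsupp.lsingle_apply, LinearEquiv.coe_coe]
    rw [raise_single, map_smul, scatteringEquiv_gen _ (by have := i.2; lia), scatteringEquiv_single,
      ← scatZ_natCast, fibreBracket_coX_scatZ ℂ t hd]
  exact LinearMap.congr_fun this x

theorem raise_apply {j k : Label} (h1 : k.1.1 = j.1.1 + 1) (h2 : j.1.2 = k.1.2 + 1) (x : Gens) :
    raise x k = (2 * j.1.2) * x j := by
  have : Finsupp.lapply k ∘ₗ raise = (2 * j.1.2 : ℂ) • Finsupp.lapply j := by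
    ext j'
    simp only [LinearMap.comp_apply, Finsupp.lsingle_apply, Finsupp.lapply_apply,
      LinearMap.smul_apply, raise_single, Finsupp.smul_apply, gen_apply, smul_eq_mul]
    by_cases hj : j' = j
    · rw [hj, if_pos (by lia), Finsupp.single_eq_same]
    · rw [Finsupp.single_eq_of_ne' hj, if_neg, mul_zero, mul_zero]
      intro h
      exact hj (Subtype.ext (Prod.ext (by lia) (by lia)))
  exact LinearMap.congr_fun this x

theorem raise_apply_eq_zero {k : Label} (h : k.1.1 = 0) (x : Gens) : raise x k = 0 := by
  have : Finsupp.lapply k ∘ₗ raise = 0 := by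
    ext j
    simp only [LinearMap.comp_apply, Finsupp.lsingle_apply, Finsupp.lapply_apply, raise_single,
      Finsupp.smul_apply, gen_apply, smul_eq_mul]
    rw [if_neg (by lia), mul_zero, LinearMap.zero_apply]
  exact LinearMap.congr_fun this x

open Polynomial in
-- Each application of `ad X` lowers the second label by one and keeps distinct labels distinct, so
-- nothing cancels. Continuing until all second labels are zero leaves highest weight vectors, that
-- is, powers of `X`.
theorem exists_aeval_mem (hJ : ∀ y, ∀ x ∈ J, fibreBracket ℂ t y x ∈ J) (N : ℕ) : ∀ x : Gens,
    (∀ i : Label, x i ≠ 0 → i.1.2 ≤ N) → (∃ i : Label, i.1.1 + i.1.2 ≠ 0 ∧ x i ≠ 0) →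
    scatteringEquiv t x ∈ J → ∃ g : ℂ[X], g.natDegree ≠ 0 ∧ aeval (coX ℂ t) g ∈ J := by
  induction N with
  | zero =>
    rintro x hx ⟨i, hi, hxi⟩ hxJ
    have hx0 : ∀ j ∈ x.support, j.1.2 = 0 := fun j hj =>
      Nat.le_zero.1 (hx j (Finsupp.mem_support_iff.1 hj))
    refine ⟨∑ j ∈ x.support, monomial (j.1.1 / 2) (x j), ?_, ?_⟩
    · have hc : (∑ j ∈ x.support, monomial (j.1.1 / 2) (x j)).coeff (i.1.1 / 2) = x i := by
        rw [finsetSum_coeff, Finset.sum_eq_single i]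
        · rw [coeff_monomial, if_pos rfl]
        · intro j hj hji
          rw [coeff_monomial, if_neg]
          intro h
          have h1 := hx0 j hj
          have h2 := hx0 i (Finsupp.mem_support_iff.2 hxi)
          have h3 := i.2
          have h4 := j.2
          exact hji (Subtype.ext (Prod.ext (by lia) (by lia)))
        · intro h
          rw [Finsupp.notMem_support_iff.1 h, monomial_zero_right, coeff_zero]
      have h1 := le_natDegree_of_ne_zero (hc.trans_ne hxi)
      have h2 := hx0 i (Finsupp.mem_support_iff.2 hxi)
      have h3 := i.2
      lia
    · convert hxJ using 1
      conv_rhs => rw [← x.sum_single]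
      rw [Finsupp.sum, map_sum, map_sum]
      refine Finset.sum_congr rfl fun j hj => ?_
      have h1 := hx0 j hj
      have h2 := j.2
      obtain ⟨d, hd⟩ : ∃ d, j.1.1 = 2 * d := ⟨j.1.1 / 2, by lia⟩
      rw [← Finsupp.smul_single_one, map_smul, scatteringEquiv_single, ← scatZ_natCast, h1, hd,
        Nat.cast_zero, scatZ_highest, aeval_monomial, smul_eq_algebraMap_mul,
        Nat.mul_div_cancel_left _ two_pos]
  | succ N ih =>
    rintro x hx ⟨i, hi, hxi⟩ hxJ
    by_cases h : ∃ j : Label, j.1.2 ≠ 0 ∧ x j ≠ 0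
    · obtain ⟨j, hj, hxj⟩ := h
      refine ih (raise x) ?_ ?_ ?_
      · intro k hk
        have hk0 : k.1.1 ≠ 0 := fun h0 => hk (raise_apply_eq_zero h0 x)
        have hpar := k.2
        rw [raise_apply (j := ⟨(k.1.1 - 1, k.1.2 + 1), by simp only; lia⟩) (by simp only; lia) rfl]
          at hk
        have := hx _ (right_ne_zero_of_mul hk)
        simp only at this
        lia
      · have hpar := j.2
        refine ⟨⟨(j.1.1 + 1, j.1.2 - 1), by simp only; lia⟩, by simp, ?_⟩
        rw [raise_apply (j := j) rfl (by simp only; lia)]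
        exact mul_ne_zero (mul_ne_zero two_ne_zero (Nat.cast_ne_zero.2 hj)) hxj
      · rw [scatteringEquiv_raise]
        exact hJ _ _ hxJ
    · push Not at h
      refine ih x (fun j hj => ?_) ⟨i, hi, hxi⟩ hxJ
      by_contra h'
      exact hj (h j (by lia))

/-- A non-central element is not constant; it is reduced in turn to a polynomial in `X`, to a power
of `X`, and to `X`. -/
theorem coX_mem_of_bracket_ne_zero (ht : t ≠ 0) (hJ : ∀ y, ∀ x ∈ J, fibreBracket ℂ t y x ∈ J)
    {x y : Fibre ℂ t} (hx : x ∈ J) (hxy : fibreBracket ℂ t y x ≠ 0) : coX ℂ t ∈ J := by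
  obtain ⟨ξ, rfl⟩ := (scatteringEquiv t).surjective x
  have h : ∃ i : Label, i.1.1 + i.1.2 ≠ 0 ∧ ξ i ≠ 0 := by
    by_contra h
    push Not at h
    refine hxy ?_
    have e : ξ = ξ (label 0 0) • Finsupp.single (label 0 0) 1 := by
      ext i
      by_cases hi : i = label 0 0
      · simp [hi]
      · rw [h i, Finsupp.smul_apply, Finsupp.single_eq_of_ne hi, smul_zero]
        intro h0
        exact hi (Subtype.ext (Prod.ext (by simp only; lia) (by simp only; lia)))
    have h1 : scatteringGen ℂ t 0 0 = 1 := by simp [scatteringGen]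
    rw [e, map_smul, map_smul, scatteringEquiv_single, h1, ← hamiltonian_apply,
      Derivation.map_one_eq_zero, smul_zero]
  obtain ⟨g, hg, hgJ⟩ := exists_aeval_mem J hJ (ξ.support.sup fun i => i.1.2) ξ
    (fun i hi => Finset.le_sup (f := fun i : Label => i.1.2) (Finsupp.mem_support_iff.2 hi)) h hx
  obtain ⟨k, hk⟩ := exists_pow_mem_of_aeval_mem J hJ (g.natDegree - 1) g (by lia) hgJ
  exact coX_mem_of_pow_mem J ht hJ k hk

/-- The span of the generators with labels of sum at least `k`. -/
noncomputable def wedgeFiltration (k : ℕ) : Submodule ℂ Gens :=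
  Finsupp.supported ℂ ℂ {i : Label | k ≤ i.1.1 + i.1.2}

theorem gen_mem_wedgeFiltration {m n : ℤ} {k : ℕ} (h : k ≤ m + n) :
    gen m n ∈ wedgeFiltration k := by
  rw [wedgeFiltration, Finsupp.mem_supported']
  intro i hi
  rw [gen_apply, if_neg]
  rintro ⟨h1, h2⟩
  exact hi (show k ≤ i.1.1 + i.1.2 by lia)

theorem wedgeBracket_mem_wedgeFiltration {k l n : ℕ} (h : n + 2 ≤ k + l) {x y : Gens}
    (hx : x ∈ wedgeFiltration k) (hy : y ∈ wedgeFiltration l) :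
    wedgeBracket x y ∈ wedgeFiltration n := by
  rw [wedgeFiltration, Finsupp.supported_eq_span_single] at hx hy
  refine LinearMap.BilinMap.apply_apply_mem_of_mem_span _ _ _ wedgeBracket ?_ x y hx hy
  rintro _ ⟨i, hi, rfl⟩ _ ⟨j, hj, rfl⟩
  have hi' : k ≤ i.1.1 + i.1.2 := hi
  have hj' : l ≤ j.1.1 + j.1.2 := hj
  simp only [wedgeBracket_single]
  exact Submodule.smul_mem _ _ (gen_mem_wedgeFiltration (by lia))

/-- The bracket lowers the total label sum by 2. By parity a label sum is either at least 2, which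
compensates for this, or zero, which gives a central generator. -/
theorem wedgeBracket_mem_wedgeFiltration_right (k : ℕ) (x : Gens) {y : Gens}
    (hy : y ∈ wedgeFiltration k) : wedgeBracket x y ∈ wedgeFiltration k := by
  have hx : x ∈ Submodule.span ℂ ((fun i : Label => Finsupp.single i (1 : ℂ)) '' Set.univ) := by
    rw [← Finsupp.supported_eq_span_single, Finsupp.supported_univ]
    exact Submodule.mem_top
  rw [wedgeFiltration, Finsupp.supported_eq_span_single] at hy
  refine LinearMap.BilinMap.apply_apply_mem_of_mem_span _ _ _ wedgeBracket ?_ x y hx hy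
  rintro _ ⟨i, -, rfl⟩ _ ⟨j, hj, rfl⟩
  have hj' : k ≤ j.1.1 + j.1.2 := hj
  simp only [wedgeBracket_single]
  by_cases hi : i.1.1 + i.1.2 = 0
  · have h1 : i.1.1 = 0 := by lia
    have h2 : i.1.2 = 0 := by lia
    rw [h1, h2, Nat.cast_zero, zero_mul, zero_mul, sub_zero, zero_smul]
    exact Submodule.zero_mem _
  · have := i.2
    exact Submodule.smul_mem _ _ (gen_mem_wedgeFiltration (by lia))

/-- Bracketing with `z` raises the filtration by at least 2, so `x` lies in every step, and the
intersection of all steps is zero. -/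
theorem eq_zero_of_wedgeBracket_eq_two_smul {x z : Gens} (hx : x ∈ wedgeFiltration 4)
    (hz : z ∈ wedgeFiltration 4) (h : wedgeBracket x z = (2 : ℂ) • x) : x = 0 := by
  have key : ∀ k, x ∈ wedgeFiltration (4 + 2 * k) := by
    intro k
    induction k with
    | zero => exact hx
    | succ k ih =>
      have h1 := wedgeBracket_mem_wedgeFiltration (n := 4 + 2 * (k + 1)) (by lia) ih hz
      rw [h] at h1
      exact (Submodule.smul_mem_iff _ two_ne_zero).1 h1
  ext i
  have h1 := key (i.1.1 + i.1.2)
  rw [wedgeFiltration, Finsupp.mem_supported'] at h1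
  exact h1 i (show ¬ 4 + 2 * (i.1.1 + i.1.2) ≤ i.1.1 + i.1.2 by lia)

theorem coX_ne_zero : coX ℂ t ≠ 0 := by
  have h := (twistorBasis ℂ t).ne_zero (label 2 0)
  rw [twistorBasis_apply] at h
  simpa [twistorGen] using h

theorem fibreLie_not_equiv_wedge (ht : t ≠ 0) :
    IsEmpty (FibreLie ℂ t ≃ₗ⁅ℂ⁆ LieOf wedgeBracket wedgeBracket_isLie) := by
  refine ⟨fun Φ => ?_⟩
  let φ : Gens ≃ₗ[ℂ] Fibre ℂ t :=
    LieOf.of wedgeBracket_isLie ≪≫ₗ Φ.symm.toLinearEquiv ≪≫ₗ (LieOf.of (fibreBracket_isLie t)).symm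
  have hφ : ∀ x y, φ (wedgeBracket x y) = fibreBracket ℂ t (φ x) (φ y) := fun x y => by
    have h := Φ.symm.map_lie (LieOf.of wedgeBracket_isLie x) (LieOf.of wedgeBracket_isLie y)
    exact h
  set J := (wedgeFiltration 4).map φ.toLinearMap with hJdef
  have hJ : ∀ y, ∀ x ∈ J, fibreBracket ℂ t y x ∈ J := by
    rintro y _ ⟨x, hx, rfl⟩
    obtain ⟨y, rfl⟩ := φ.surjective y
    exact ⟨_, wedgeBracket_mem_wedgeFiltration_right 4 y hx, hφ y x⟩
  have hX : coX ℂ t ∈ J := by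
    have h1 : Finsupp.single (label 4 0) 1 ∈ wedgeFiltration 4 :=
      Finsupp.single_mem_supported ℂ 1 (show 4 ≤ 4 + 0 by simp)
    refine coX_mem_of_bracket_ne_zero J ht hJ (y := φ (Finsupp.single (label 0 2) 1))
      ⟨_, h1, rfl⟩ ?_
    simp only [LinearEquiv.coe_coe]
    rw [← hφ, ne_eq, LinearEquiv.map_eq_zero_iff,
      wedgeBracket_label 0 2 4 0 3 1 rfl rfl rfl rfl rfl]
    norm_num
  have hZ : coZ ℂ t ∈ J := by
    have h := hJ (coY ℂ t) _ hX
    rw [fibreBracket_coY_coX] at h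
    refine (J.smul_mem_iff (show (-4 : ℂ) ≠ 0 by norm_num)).1 ?_
    convert h using 1
    rw [smul_eq_algebraMap_mul, map_neg, map_ofNat]
    ring
  obtain ⟨x, hx, hx'⟩ := hX
  obtain ⟨z, hz, hz'⟩ := hZ
  have h0 : x = 0 := by
    refine eq_zero_of_wedgeBracket_eq_two_smul hx hz (φ.injective ?_)
    simp only [LinearEquiv.coe_coe] at hx' hz'
    rw [hφ, map_smul, hx', hz', fibreBracket_coX_coZ, smul_eq_algebraMap_mul, map_ofNat]
  rw [h0, map_zero] at hx'
  exact coX_ne_zero hx'.symm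

end Ideals

/-! ### The scaling limit -/

section Limit

open Filter Topology

theorem rise_zero (a : ℂ) : rise a 0 = 1 := by simp [rise]

theorem rise_succ (a : ℂ) (k : ℕ) : rise a (k + 1) = rise a k * (a + k) :=
  ascPochhammer_succ_eval k a

theorem rise_neg (a : ℂ) (k : ℕ) : rise (-a) k = (-1) ^ k * fall a k :=
  ascPochhammer_eval_neg_eq_descPochhammer ℂ a k

theorem fall_eq_rise (a : ℂ) (k : ℕ) : fall a k = rise (a - k + 1) k :=
  descPochhammer_eval_eq_ascPochhammer ℂ a k

/-- The part of the `k`-th term of the series for `Ψ` that does not depend on `σ`. -/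
noncomputable def psiCoeff (l : ℕ) (m n : ℂ) (k : ℕ) : ℂ :=
  rise (-(l + 1 / 2)) k * rise (-l) k /
    (rise (1 / 2 - m) k * rise (1 / 2 - n) k * rise (m + n + 1 / 2 - 2 * l) k) / k.factorial

/-- At the odd index `2 l + 1` the fourth upper parameter is `-l`, which terminates the series after
`k = l`. -/
theorem PsiHyp_odd (l : ℕ) (m n σ : ℂ) : PsiHyp (2 * l + 1) m n σ = ∑ k ∈ Finset.range (l + 1),
    rise (-1 / 2 - 2 * σ) k * rise (3 / 2 + 2 * σ) k * psiCoeff l m n k := by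
  have e1 : -((2 * l + 1 : ℕ) : ℂ) / 2 = -(l + 1 / 2) := by push_cast; ring
  have e2 : (1 - ((2 * l + 1 : ℕ) : ℂ)) / 2 = -l := by push_cast; ring
  have e3 : m + n + 3 / 2 - ((2 * l + 1 : ℕ) : ℂ) = m + n + 1 / 2 - 2 * l := by push_cast; ring
  rw [PsiHyp, hyp₄F₃, e1, e2, e3, tsum_eq_sum (s := Finset.range (l + 1))]
  · refine Finset.sum_congr rfl fun k _ => ?_
    rw [psiCoeff, one_pow]
    ring
  · intro k hk
    rw [rise_neg (l : ℂ), fall_eq_zero (by simpa using hk)]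
    ring

theorem psiCoeff_self (c : ℂ) (l : ℕ) (m n : ℂ) :
    (-c ^ 2 / 4) ^ l * psiCoeff l m n l = (2 * c) ^ (2 * l) * psiOdd l m n := by
  have e1 : (1 : ℂ) / 2 - m = -(m - 1 / 2) := by ring
  have e2 : (1 : ℂ) / 2 - n = -(n - 1 / 2) := by ring
  have e3 : m + n + 1 / 2 - 2 * l = (m + n - 1 / 2 - l) - l + 1 := by ring
  have e4 : (-c ^ 2 / 4) ^ l = (-1) ^ l * (c ^ 2) ^ l / 4 ^ l := by
    rw [div_pow, neg_pow]
  have e5 : (2 * c) ^ (2 * l) = 4 ^ l * (c ^ 2) ^ l := by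
    rw [pow_mul, mul_pow, mul_pow]
    norm_num
  have e6 : (4 : ℂ) ^ (2 * l) = 4 ^ l * 4 ^ l := by ring
  have e7 : ((-1 : ℂ) ^ l) ≠ 0 := by simp
  have h4 : (4 : ℂ) ^ l ≠ 0 := pow_ne_zero _ (by norm_num)
  have hl : (l.factorial : ℂ) ≠ 0 := Nat.cast_ne_zero.2 l.factorial_ne_zero
  have e8 : ((-1 : ℂ) ^ l) * (-1) ^ l = 1 := by rw [← mul_pow]; simp
  rw [psiCoeff, psiOdd, e1, e2, e3, ← fall_eq_rise, rise_neg, rise_neg, rise_neg, rise_neg,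
    fall_self, e4, e5, e6]
  generalize (-1 : ℂ) ^ l = u at *
  generalize fall (l + 1 / 2) l = w
  generalize fall (m - 1 / 2) l = x
  generalize fall (n - 1 / 2) l = y
  generalize fall (m + n - 1 / 2 - l) l = z
  -- Both sides have the same denominators up to sign, so no non-vanishing of `x`, `y`, `z` is
  -- needed.
  have e9 : u⁻¹ = u := inv_eq_of_mul_eq_one_left e8
  simp only [div_eq_mul_inv, mul_inv, e9]
  field_simp
  linear_combination ((u * u + 1) * w * (c ^ 2) ^ l * x⁻¹ * y⁻¹ * z⁻¹) * e8

variable {ι : Type*} {F : Filter ι} {c : ℂ} {𝔮 σ : ι → ℂ}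

/-- Both quantities equal the convergent `(4 𝔮 σ)²` times a negative power of `σ`, up to the
constant `1/16`. -/
theorem tendsto_sq_mul (hσ : Tendsto σ F (Bornology.cobounded ℂ))
    (h : Tendsto (fun a => (4 * 𝔮 a * σ a) ^ 2) F (𝓝 (c ^ 2))) :
    Tendsto (fun a => 𝔮 a ^ 2) F (𝓝 0) ∧ Tendsto (fun a => 𝔮 a ^ 2 * σ a) F (𝓝 0) := by
  have hinv : Tendsto (fun a => (σ a)⁻¹) F (𝓝 0) := tendsto_inv₀_cobounded.comp hσ
  have hne : ∀ᶠ a in F, σ a ≠ 0 := hσ.eventually_ne_cobounded 0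
  have h1 : Tendsto (fun a => (4 * 𝔮 a * σ a) ^ 2 * (σ a)⁻¹ * (1 / 16)) F (𝓝 0) := by
    simpa only [mul_zero, zero_mul] using (h.mul hinv).mul_const (1 / 16)
  have h2 : Tendsto (fun a => (4 * 𝔮 a * σ a) ^ 2 * (σ a)⁻¹ * (1 / 16) * (σ a)⁻¹) F (𝓝 0) := by
    simpa only [mul_zero] using h1.mul hinv
  refine ⟨h2.congr' ?_, h1.congr' ?_⟩
  · filter_upwards [hne] with a ha
    field_simp
    ring
  · filter_upwards [hne] with a ha
    field_simp
    ring

/-- The `k`-th factors multiply to `(k - 1/2) (k + 3/2) - 4 σ - 4 σ²`; after multiplication by `𝔮²`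
only `-4 𝔮² σ² = -(4 𝔮 σ)² / 4` survives. -/
theorem tendsto_pow_mul_rise (hσ : Tendsto σ F (Bornology.cobounded ℂ))
    (h : Tendsto (fun a => (4 * 𝔮 a * σ a) ^ 2) F (𝓝 (c ^ 2))) (k : ℕ) :
    Tendsto (fun a => (𝔮 a ^ 2) ^ k * (rise (-1 / 2 - 2 * σ a) k * rise (3 / 2 + 2 * σ a) k)) F
      (𝓝 ((-c ^ 2 / 4) ^ k)) := by
  obtain ⟨h1, h2⟩ := tendsto_sq_mul hσ h
  induction k with
  | zero => simp [rise_zero, tendsto_const_nhds]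
  | succ k ih =>
    have h3 : Tendsto (fun a => 𝔮 a ^ 2 * (((k : ℂ) - 1 / 2) * (k + 3 / 2)) + 𝔮 a ^ 2 * σ a * (-4) +
        (4 * 𝔮 a * σ a) ^ 2 * (-1 / 4)) F (𝓝 (-c ^ 2 / 4)) := by
      convert ((h1.mul_const _).add (h2.mul_const _)).add (h.mul_const _) using 2
      ring
    rw [pow_succ]
    refine (ih.mul h3).congr fun a => ?_
    rw [rise_succ, rise_succ]
    ring

/-- The `k`-th term absorbs `𝔮 ^ (2 k)` and keeps a factor `𝔮 ^ (2 (l - k))`, which tends to zero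
unless `k = l`. -/
theorem tendsto_PsiHyp (hσ : Tendsto σ F (Bornology.cobounded ℂ))
    (h : Tendsto (fun a => (4 * 𝔮 a * σ a) ^ 2) F (𝓝 (c ^ 2))) (l : ℕ) (m n : ℂ) :
    Tendsto (fun a => 𝔮 a ^ (2 * l) * PsiHyp (2 * l + 1) m n (σ a)) F
      (𝓝 ((2 * c) ^ (2 * l) * psiOdd l m n)) := by
  obtain ⟨h1, -⟩ := tendsto_sq_mul hσ h
  have hterm : ∀ k ∈ Finset.range (l + 1), Tendsto (fun a => (𝔮 a ^ 2) ^ (l - k) *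
      ((𝔮 a ^ 2) ^ k * (rise (-1 / 2 - 2 * σ a) k * rise (3 / 2 + 2 * σ a) k)) *
        psiCoeff l m n k) F (𝓝 (0 ^ (l - k) * (-c ^ 2 / 4) ^ k * psiCoeff l m n k)) := fun k _ =>
    ((h1.pow (l - k)).mul (tendsto_pow_mul_rise hσ h k)).mul_const _
  have hsum := tendsto_finsetSum _ hterm
  rw [Finset.sum_range_succ, Finset.sum_eq_zero, zero_add, Nat.sub_self, pow_zero, one_mul,
    psiCoeff_self] at hsum
  · refine hsum.congr fun a => ?_
    rw [PsiHyp_odd, Finset.mul_sum]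
    refine Finset.sum_congr rfl fun k hk => ?_
    have hk' : k ≤ l := Nat.lt_succ_iff.1 (Finset.mem_range.1 hk)
    rw [← mul_assoc ((𝔮 a ^ 2) ^ (l - k)), ← pow_add, Nat.sub_add_cancel hk', ← pow_mul, mul_assoc]
  · intro k hk
    have hk' : l - k ≠ 0 := by have := Finset.mem_range.1 hk; lia
    rw [zero_pow hk', zero_mul, zero_mul]

theorem tendsto_wMuBracket (hσ : Tendsto σ F (Bornology.cobounded ℂ))
    (h : Tendsto (fun a => (4 * 𝔮 a * σ a) ^ 2) F (𝓝 (c ^ 2))) (x y : Gens) (i : Label) :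
    Tendsto (fun a => wMuBracket (𝔮 a) (σ a) x y i) F (𝓝 (wInfBracket c x y i)) := by
  induction x using Finsupp.induction_linear with
  | zero => simp [tendsto_const_nhds]
  | add x x' hx hx' => simpa using hx.add hx'
  | single j u =>
    induction y using Finsupp.induction_linear with
    | zero => simp [tendsto_const_nhds]
    | add y y' hy hy' => simpa using hy.add hy'
    | single k v =>
      have e : ∀ B : Gens →ₗ[ℂ] Gens →ₗ[ℂ] Gens, B (Finsupp.single j u) (Finsupp.single k v) i =
          u * v * B (Finsupp.single j 1) (Finsupp.single k 1) i := fun B => by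
        rw [← Finsupp.smul_single_one j u, ← Finsupp.smul_single_one k v, map_smul, map_smul,
          LinearMap.smul_apply, Finsupp.smul_apply, Finsupp.smul_apply, smul_eq_mul, smul_eq_mul]
        ring
      simp only [e]
      refine Tendsto.const_mul _ ?_
      rw [wInfBracket_single]
      simp only [wMuBracket, bracketOf_single, Finsupp.finsetSum_apply, Finsupp.smul_apply,
        smul_eq_mul]
      refine tendsto_finsetSum _ fun l _ => Tendsto.mul_const _ ?_
      have h1 := (tendsto_PsiHyp hσ h l (((j.1.1 : ℂ) + j.1.2) / 2)
        (((k.1.1 : ℂ) + k.1.2) / 2)).const_mul (coefR (2 * l + 1) j.1.1 j.1.2 k.1.1 k.1.2)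
      rw [wInfCoeff]
      convert h1 using 2
      · ring
      · ring

end Limit

/-! ### Uniqueness of the Poisson bracket -/

section Uniqueness

variable {t : ℂ}

theorem adjoin_coordinates (t : ℂ) :
    Algebra.adjoin ℂ {coX ℂ t, coY ℂ t, coZ ℂ t} = ⊤ := by
  rw [eq_top_iff]
  intro x _
  obtain ⟨f, rfl⟩ := Ideal.Quotient.mk_surjective x
  induction f using MvPolynomial.induction_on with
  | C a => exact Subalgebra.algebraMap_mem _ a
  | add f g hf hg => rw [map_add]; exact add_mem (hf trivial) (hg trivial)
  | mul_X f i hf =>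
    rw [map_mul]
    refine mul_mem (hf trivial) (Algebra.subset_adjoin ?_)
    fin_cases i
    · exact Or.inl rfl
    · exact Or.inr (Or.inl rfl)
    · exact Or.inr (Or.inr rfl)

section

variable {O : Type*} [CommRing O] [Algebra ℂ O] {B B' : O →ₗ[ℂ] O →ₗ[ℂ] O}

theorem IsPoissonBracket.apply_algebraMap (hB : IsPoissonBracket B) (x : O) (a : ℂ) :
    B x (algebraMap ℂ O a) = 0 := by
  have h := hB.leibniz x 1 1
  rw [mul_one, mul_one, one_mul] at h
  rw [Algebra.algebraMap_eq_smul_one, map_smul, left_eq_add.1 h, smul_zero]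

theorem IsPoissonBracket.eqOn_adjoin (hB : IsPoissonBracket B) (hB' : IsPoissonBracket B') {x : O}
    {s : Set O} (h : ∀ y ∈ s, B x y = B' x y) {y : O} (hy : y ∈ Algebra.adjoin ℂ s) :
    B x y = B' x y := by
  induction hy using Algebra.adjoin_induction with
  | mem y hy => exact h y hy
  | algebraMap a => rw [hB.apply_algebraMap, hB'.apply_algebraMap]
  | add y z _ _ hy hz => rw [map_add, map_add, hy, hz]
  | mul y z _ _ hy hz => rw [hB.leibniz, hB'.leibniz, hy, hz]

/-- The Leibniz rule propagates equality from generators in the second argument, and antisymmetry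
transfers it to the first. -/
theorem IsPoissonBracket.eq_of_generators (hB : IsPoissonBracket B) (hB' : IsPoissonBracket B')
    {s : Set O} (hs : Algebra.adjoin ℂ s = ⊤) (h : ∀ x ∈ s, ∀ y ∈ s, B x y = B' x y) : B = B' := by
  have h1 : ∀ x ∈ s, ∀ y, B x y = B' x y := fun x hx y =>
    hB.eqOn_adjoin hB' (h x hx) (hs ▸ Algebra.mem_top)
  refine LinearMap.ext₂ fun x y => hB.eqOn_adjoin hB' (fun z hz => ?_) (hs ▸ Algebra.mem_top)
  rw [hB.toIsLieBracket.swap, hB'.toIsLieBracket.swap, h1 z hz]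

theorem IsPoissonBracket.eq_of_three_generators (hB : IsPoissonBracket B)
    (hB' : IsPoissonBracket B') {x y z : O} (hs : Algebra.adjoin ℂ {x, y, z} = ⊤)
    (hxy : B x y = B' x y) (hxz : B x z = B' x z) (hyz : B y z = B' y z) : B = B' := by
  refine hB.eq_of_generators hB' hs ?_
  rintro u (rfl | rfl | rfl) v (rfl | rfl | rfl)
  · rw [hB.self, hB'.self]
  · exact hxy
  · exact hxz
  · rw [hB.toIsLieBracket.swap, hB'.toIsLieBracket.swap, hxy]
  · rw [hB.self, hB'.self]
  · exact hyz
  · rw [hB.toIsLieBracket.swap, hB'.toIsLieBracket.swap, hxz]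
  · rw [hB.toIsLieBracket.swap, hB'.toIsLieBracket.swap, hyz]
  · rw [hB.self, hB'.self]

end

theorem fibreBracket_isPoisson : IsPoissonBracket (fibreBracket ℂ t) where
  toIsLieBracket := fibreBracket_isLie t
  leibniz := fibreBracket_leibniz ℂ t

theorem ofNat_mul_eq_smul (n : ℕ) [n.AtLeastTwo] (x : Fibre ℂ t) :
    OfNat.ofNat n * x = (OfNat.ofNat n : ℂ) • x := by
  rw [smul_eq_algebraMap_mul, map_ofNat]

theorem isPoissonBracket_iff (B : Fibre ℂ t →ₗ[ℂ] Fibre ℂ t →ₗ[ℂ] Fibre ℂ t) :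
    (IsPoissonBracket B ∧ B (coX ℂ t) (coY ℂ t) = (4 : ℂ) • coZ ℂ t ∧
      B (coX ℂ t) (coZ ℂ t) = (2 : ℂ) • coX ℂ t ∧ B (coY ℂ t) (coZ ℂ t) = (-2 : ℂ) • coY ℂ t) ↔
    B = fibreBracket ℂ t := by
  have h1 : fibreBracket ℂ t (coX ℂ t) (coY ℂ t) = (4 : ℂ) • coZ ℂ t := by
    rw [fibreBracket_coX_coY, ofNat_mul_eq_smul]
  have h2 : fibreBracket ℂ t (coX ℂ t) (coZ ℂ t) = (2 : ℂ) • coX ℂ t := by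
    rw [fibreBracket_coX_coZ, ofNat_mul_eq_smul]
  have h3 : fibreBracket ℂ t (coY ℂ t) (coZ ℂ t) = (-2 : ℂ) • coY ℂ t := by
    rw [fibreBracket_coY_coZ, ofNat_mul_eq_smul, neg_smul]
  constructor
  · rintro ⟨hB, hXY, hXZ, hYZ⟩
    exact hB.eq_of_three_generators fibreBracket_isPoisson (adjoin_coordinates t) (hXY.trans h1.symm) (hXZ.trans h2.symm)
      (hYZ.trans h3.symm)
  · rintro rfl
    exact ⟨fibreBracket_isPoisson, h1, h2, h3⟩

end Uniqueness

/-! ### The isomorphisms of Lie algebras -/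

section Isomorphisms

theorem two_mul_pow_mul_coefC₀ (c : ℂ) (p q l : ℕ) :
    (2 * c) ^ (2 * l) * coefC₀ p q l = coefTwistor p q (p + q) l * (c ^ 2) ^ l := by
  have h := pow_four_mul_coef (l := l) (le_refl (p + q))
  push_cast at h
  rw [← h, coefC₀, pow_mul, mul_pow, mul_pow]
  norm_num
  ring

theorem two_mul_pow_mul_coefC₁ (c : ℂ) (p q l : ℕ) :
    (2 * c) ^ (2 * l) * coefC₁ p q l = coefTwistor p q (p + q + 1) l * (c ^ 2) ^ l := by
  have h := pow_four_mul_coef (l := l) (Nat.le_succ (p + q))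
  push_cast at h
  rw [← h, coefC₁, pow_mul, mul_pow, mul_pow]
  norm_num
  ring

theorem scatteringGen_even_eq_sum (c : ℂ) (p q : ℕ) :
    scatteringGen ℂ (c ^ 2) (2 * p) (2 * q) =
      ∑ l ∈ Finset.range (min p q + 1), ((2 * c) ^ (2 * l) * coefC₀ p q l) •
        twistorGen ℂ (c ^ 2) (2 * (p : ℤ) - 2 * l) (2 * (q : ℤ) - 2 * l) := by
  have h := scatteringGen_eq_sum_min ℂ (c ^ 2) p q 0 (Nat.zero_le 1)
  simp only [add_zero, Nat.cast_zero] at h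
  rw [h]
  refine Finset.sum_congr rfl fun l _ => ?_
  rw [tau_pow_mul, smul_smul, two_mul_pow_mul_coefC₀]

theorem scatteringGen_odd_eq_sum (c : ℂ) (p q : ℕ) :
    scatteringGen ℂ (c ^ 2) (2 * p + 1) (2 * q + 1) =
      ∑ l ∈ Finset.range (min p q + 1), ((2 * c) ^ (2 * l) * coefC₁ p q l) •
        twistorGen ℂ (c ^ 2) (2 * (p : ℤ) - 2 * l + 1) (2 * (q : ℤ) - 2 * l + 1) := by
  rw [scatteringGen_eq_sum_min ℂ (c ^ 2) p q 1 le_rfl]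
  refine Finset.sum_congr rfl fun l _ => ?_
  rw [tau_pow_mul, smul_smul, two_mul_pow_mul_coefC₁, Nat.cast_one, sub_add_eq_add_sub,
    sub_add_eq_add_sub]

/-- The identification of the wedge algebra with the fibre ring by the twistor generators. -/
noncomputable def deformationEquiv (t : ℂ) :
    LieOf wedgeBracket wedgeBracket_isLie ≃ₗ[ℂ] FibreLie ℂ t :=
  (LieOf.of wedgeBracket_isLie).symm ≪≫ₗ twistorEquiv t ≪≫ₗ LieOf.of (fibreBracket_isLie t)

theorem deformationEquiv_of (t : ℂ) (x : Gens) :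
    deformationEquiv t (LieOf.of wedgeBracket_isLie x) =
      LieOf.of (fibreBracket_isLie t) (twistorEquiv t x) := rfl

theorem lie_deformationEquiv (t : ℂ) (x y : LieOf wedgeBracket wedgeBracket_isLie) :
    ⁅deformationEquiv t x, deformationEquiv t y⁆ =
      deformationEquiv t (⁅x, y⁆ + t • deformationCochain x y) := by
  obtain ⟨x, rfl⟩ := (LieOf.of wedgeBracket_isLie).surjective x
  obtain ⟨y, rfl⟩ := (LieOf.of wedgeBracket_isLie).surjective y
  rw [deformationEquiv_of, deformationEquiv_of, LieOf.lie_of, ← twistorEquiv_deformedBracket,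
    LieOf.lie_of, deformationCochain_of, ← map_smul, ← map_add, deformationEquiv_of,
    deformedBracket_apply]

/-- The isomorphism of the fibre algebra with `W(∞)` given by the scattering generators. -/
noncomputable def scatteringLieEquiv (c : ℂ) :
    FibreLie ℂ (c ^ 2) ≃ₗ⁅ℂ⁆ LieOf (wInfBracket c) (wInfBracket_isLie c) :=
  (lieOfEquiv (wInfBracket_isLie c) (fibreBracket_isLie (c ^ 2)) (scatteringEquiv (c ^ 2))
    (scatteringEquiv_wInfBracket c)).symm

theorem scatteringLieEquiv_scatteringGen (c : ℂ) (i : Label) :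
    scatteringLieEquiv c
        (LieOf.of (fibreBracket_isLie (c ^ 2)) (scatteringGen ℂ (c ^ 2) i.1.1 i.1.2)) =
      LieOf.of (wInfBracket_isLie c) (Finsupp.single i 1) := by
  rw [scatteringLieEquiv, ← scatteringEquiv_single, ← lieOfEquiv_of (wInfBracket_isLie c)
    (fibreBracket_isLie (c ^ 2)) (scatteringEquiv (c ^ 2)) (scatteringEquiv_wInfBracket c),
    LieEquiv.symm_apply_apply]

/-- The isomorphism of the celestial chiral algebra with the loop algebra of `W(∞)`. -/
noncomputable def celestialLoopLieEquiv {c : ℂ} (hc : c ≠ 0) :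
    LieOf (ccaBracket c) (ccaBracket_isLie c) ≃ₗ⁅ℂ⁆
      LieAlgebra.loopAlgebra ℂ ℤ (LieOf (wInfBracket 1) (wInfBracket_isLie 1)) :=
  { (LieOf.of (ccaBracket_isLie c)).symm ≪≫ₗ celestialLoopEquiv hc (wInfBracket_isLie 1) with
    map_lie' := fun {x y} => celestialLoopEquiv_ccaBracket hc (wInfBracket_isLie 1)
      ((LieOf.of (ccaBracket_isLie c)).symm x) ((LieOf.of (ccaBracket_isLie c)).symm y) }

theorem celestialLoopLieEquiv_of {c : ℂ} (hc : c ≠ 0) (x : ℤ × Label →₀ ℂ) :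
    celestialLoopLieEquiv hc (LieOf.of (ccaBracket_isLie c) x) =
      celestialLoopEquiv hc (wInfBracket_isLie 1) x := rfl

end Isomorphisms

end EguchiHanson

theorem mainTheorem1 :
    -- The Poisson bracket of the fibre ring exists and is unique.
    (∀ (c : ℂ) (B : Fibre ℂ (c ^ 2) →ₗ[ℂ] Fibre ℂ (c ^ 2) →ₗ[ℂ] Fibre ℂ (c ^ 2)),
      (IsPoissonBracket B ∧
        B (coX ℂ (c ^ 2)) (coY ℂ (c ^ 2)) = (4 : ℂ) • coZ ℂ (c ^ 2) ∧
        B (coX ℂ (c ^ 2)) (coZ ℂ (c ^ 2)) = (2 : ℂ) • coX ℂ (c ^ 2) ∧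
        B (coY ℂ (c ^ 2)) (coZ ℂ (c ^ 2)) = (-2 : ℂ) • coY ℂ (c ^ 2)) ↔
      B = fibreBracket ℂ (c ^ 2)) ∧
    -- The twistor generators form a basis, with the stated structure constants.
    (∀ c : ℂ,
      (∃ b : Module.Basis Label ℂ (Fibre ℂ (c ^ 2)),
        ∀ i, b i = twistorGen ℂ (c ^ 2) i.1.1 i.1.2) ∧
      ∀ p q r s : ℕ,
        fibreBracket ℂ (c ^ 2) (twistorGen ℂ (c ^ 2) (2 * p) (2 * q))
            (twistorGen ℂ (c ^ 2) (2 * r) (2 * s)) =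
          (4 * ((p : ℂ) * s - q * r)) •
            twistorGen ℂ (c ^ 2) (2 * ((p : ℤ) + r - 1) + 1) (2 * ((q : ℤ) + s - 1) + 1) ∧
        fibreBracket ℂ (c ^ 2) (twistorGen ℂ (c ^ 2) (2 * p) (2 * q))
            (twistorGen ℂ (c ^ 2) (2 * r + 1) (2 * s + 1)) =
          (2 * ((p : ℂ) * (2 * s + 1) - q * (2 * r + 1))) •
              twistorGen ℂ (c ^ 2) (2 * ((p : ℤ) + r)) (2 * ((q : ℤ) + s)) +
            (4 * c ^ 2 * ((p : ℂ) * s - q * r)) •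
              twistorGen ℂ (c ^ 2) (2 * ((p : ℤ) + r - 1)) (2 * ((q : ℤ) + s - 1)) ∧
        fibreBracket ℂ (c ^ 2) (twistorGen ℂ (c ^ 2) (2 * p + 1) (2 * q + 1))
            (twistorGen ℂ (c ^ 2) (2 * r + 1) (2 * s + 1)) =
          ((2 * (p : ℂ) + 1) * (2 * s + 1) - (2 * q + 1) * (2 * r + 1)) •
              twistorGen ℂ (c ^ 2) (2 * ((p : ℤ) + r) + 1) (2 * ((q : ℤ) + s) + 1) +
            (4 * c ^ 2 * ((p : ℂ) * s - q * r)) •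
              twistorGen ℂ (c ^ 2) (2 * ((p : ℤ) + r) - 1) (2 * ((q : ℤ) + s) - 1)) ∧
    -- The scaling limit of the structure constants of `W(μ; 𝔮)`, and of its bracket.
    (∀ (c : ℂ) (ι : Type) (F : Filter ι) (𝔮 σ : ι → ℂ),
      Filter.Tendsto σ F (Bornology.cobounded ℂ) →
      Filter.Tendsto (fun a => (4 * 𝔮 a * σ a) ^ 2) F (nhds (c ^ 2)) →
      (∀ l m n : ℕ,
        Filter.Tendsto (fun a => 𝔮 a ^ (2 * l) * PsiHyp (2 * l + 1) m n (σ a)) F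
          (nhds ((2 * c) ^ (2 * l) * psiOdd l m n))) ∧
      ∀ (x y : Gens) (i : Label),
        Filter.Tendsto (fun a => wMuBracket (𝔮 a) (σ a) x y i) F
          (nhds (wInfBracket c x y i))) ∧
    -- `w_∧`, `W(∞)` and the mode algebra of the celestial chiral algebra are Lie algebras.
    ∃ (hw : IsLieBracket wedgeBracket) (hW : ∀ c : ℂ, IsLieBracket (wInfBracket c))
      (hC : ∀ c : ℂ, IsLieBracket (ccaBracket c)),
      -- The fibre algebra is a non-trivial deformation of `w_∧`.
      (∃ φ : LieModule.Cohomology.twoCochain ℂ (LieOf wedgeBracket hw) (LieOf wedgeBracket hw),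
        (∀ i j : Label,
          φ (LieOf.of hw (Finsupp.single i 1)) (LieOf.of hw (Finsupp.single j 1)) =
            LieOf.of hw (cocycleValue i j)) ∧
        φ ∈ LieModule.Cohomology.twoCocycle ℂ (LieOf wedgeBracket hw) (LieOf wedgeBracket hw) ∧
        φ ∉ LinearMap.range
          (LieModule.Cohomology.d₁₂ ℂ (LieOf wedgeBracket hw) (LieOf wedgeBracket hw)) ∧
        ∀ c : ℂ, ∃ V : LieOf wedgeBracket hw ≃ₗ[ℂ] FibreLie ℂ (c ^ 2),
          (∀ i : Label, V (LieOf.of hw (Finsupp.single i 1)) =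
            LieOf.of (fibreBracket_isLie (c ^ 2)) (twistorGen ℂ (c ^ 2) i.1.1 i.1.2)) ∧
          ∀ x y, ⁅V x, V y⁆ = V (⁅x, y⁆ + c ^ 2 • φ x y)) ∧
      (∀ c : ℂ, c ≠ 0 → IsEmpty (FibreLie ℂ (c ^ 2) ≃ₗ⁅ℂ⁆ LieOf wedgeBracket hw)) ∧
      -- The change of basis, which carries the fibre algebra isomorphically onto `W(∞)`.
      (∀ c : ℂ,
        (∀ p q : ℕ,
          scatteringGen ℂ (c ^ 2) (2 * p) (2 * q) =
            ∑ l ∈ Finset.range (min p q + 1), ((2 * c) ^ (2 * l) * coefC₀ p q l) •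
              twistorGen ℂ (c ^ 2) (2 * (p : ℤ) - 2 * l) (2 * (q : ℤ) - 2 * l) ∧
          scatteringGen ℂ (c ^ 2) (2 * p + 1) (2 * q + 1) =
            ∑ l ∈ Finset.range (min p q + 1), ((2 * c) ^ (2 * l) * coefC₁ p q l) •
              twistorGen ℂ (c ^ 2) (2 * (p : ℤ) - 2 * l + 1) (2 * (q : ℤ) - 2 * l + 1)) ∧
        ∃ Φ : FibreLie ℂ (c ^ 2) ≃ₗ⁅ℂ⁆ LieOf (wInfBracket c) (hW c),
          ∀ i : Label,
            Φ (LieOf.of (fibreBracket_isLie (c ^ 2)) (scatteringGen ℂ (c ^ 2) i.1.1 i.1.2)) =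
              LieOf.of (hW c) (Finsupp.single i 1)) ∧
      -- On generic fibres `W(∞)` does not depend on the parameter.
      (∀ c : ℂ, c ≠ 0 →
        ∃ Φ : LieOf (wInfBracket c) (hW c) ≃ₗ⁅ℂ⁆ LieOf (wInfBracket 1) (hW 1),
          ∀ i : Label, Φ (LieOf.of (hW c) (Finsupp.single i 1)) =
            c ^ ((((i.1.1 + i.1.2) / 2 : ℕ) : ℤ) - 1) •
              LieOf.of (hW 1) (Finsupp.single i 1)) ∧
      -- The celestial chiral algebra is the loop algebra of the Poisson algebra of the fibres.
      (∀ c : ℂ,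
        ∃ Φ : LieOf (ccaBracket c) (hC c) ≃ₗ⁅ℂ⁆ FibreLie ℂ[T;T⁻¹] (loopParam c),
          ∀ (a : ℤ) (i : Label), Φ (LieOf.of (hC c) (Finsupp.single (a, i) 1)) =
            LieOf.of (fibreBracket_isLie (loopParam c))
              ((-1 / 2 : ℂ) • ((LaurentPolynomial.T a : ℂ[T;T⁻¹]) •
                scatteringGen ℂ[T;T⁻¹] (loopParam c) i.1.1 i.1.2))) ∧
      -- The celestial chiral algebra is the loop algebra of `W(∞)`.
      (∀ c : ℂ, c ≠ 0 →
        ∃ Φ : LieOf (ccaBracket c) (hC c) ≃ₗ⁅ℂ⁆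
            LieAlgebra.loopAlgebra ℂ ℤ (LieOf (wInfBracket 1) (hW 1)),
          ∀ (a : ℤ) (i : Label), Φ (LieOf.of (hC c) (Finsupp.single (a, i) 1)) =
            ((-1 / 2 : ℂ) * c ^ ((((i.1.1 + i.1.2) / 2 : ℕ) : ℤ) - 1)) •
              ((AddMonoidAlgebra.single (a + (((i.1.1 + i.1.2) / 2 : ℕ) : ℤ) - 1) 1 :
                  AddMonoidAlgebra ℂ ℤ) ⊗ₜ[ℂ]
                LieOf.of (hW 1) (Finsupp.single i 1))) := by
  refine ⟨fun c B => isPoissonBracket_iff B, fun c => ⟨⟨twistorBasis ℂ (c ^ 2),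
    twistorBasis_apply ℂ (c ^ 2)⟩, fun p q r s => ⟨?_, ?_, ?_⟩⟩, fun c ι F 𝔮 σ hσ h =>
    ⟨fun l m n => tendsto_PsiHyp hσ h l m n, tendsto_wMuBracket hσ h⟩,
    wedgeBracket_isLie, wInfBracket_isLie, ccaBracket_isLie,
    ⟨deformationCochain, deformationCochain_single, deformationCochain_mem_twoCocycle,
      deformationCochain_notMem_range, fun c => ⟨deformationEquiv (c ^ 2), fun i => ?_,
        lie_deformationEquiv (c ^ 2)⟩⟩,
    fun c hc => fibreLie_not_equiv_wedge (pow_ne_zero 2 hc),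
    fun c => ⟨fun p q => ⟨scatteringGen_even_eq_sum c p q, scatteringGen_odd_eq_sum c p q⟩,
      scatteringLieEquiv c, scatteringLieEquiv_scatteringGen c⟩,
    fun c hc => ⟨lieOfEquiv _ _ _ (rescale_wInfBracket hc), fun i => ?_⟩,
    fun c => ⟨lieOfEquiv _ _ _ (celestialEquiv_ccaBracket c), fun a i => ?_⟩,
    fun c hc => ⟨celestialLoopLieEquiv hc, fun a i => ?_⟩⟩
  · exact fibreBracket_twistorGen_even_even ℂ (c ^ 2) p q r s
  · rw [fibreBracket_twistorGen_even_odd, tau_mul, smul_smul]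
    congr 2
    ring
  · rw [fibreBracket_twistorGen_odd_odd, tau_mul, smul_smul]
    congr 2
    ring
  · rw [deformationEquiv_of, twistorEquiv_single]
  · rw [lieOfEquiv_of, rescale_single, map_smul, scalingWeight]
  · rw [lieOfEquiv_of, celestialEquiv_single]
  · rw [celestialLoopLieEquiv_of, celestialLoopEquiv_single, scalingWeight]
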